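/- Let $G=(N,A,c)$ be a connected undirected graph without loops and parallel arcs, with $n$ nodes, $m$ arcs and non-negative real capacities $c(e)$, $e\in A$, and let $s\neq t$ be two nodes of $G$. A feasible flow on a subgraph $(N,A',c)$, $A'\subseteq A$, is obtained by replacing each arc of $A'$ by two oppositely directed arcs of the same capacity and assigning to each directed arc a flow between $0$ and its capacity so that inflow equals outflow at every node other than $s,t$; its value is the net outflow at $s$, and $\mathrm{maxFlow}$ denotes the maximum value. The vitality of $e\in A$ is $\mathrm{flowVit}(e)=\mathrm{maxFlow}(G)-\mathrm{maxFlow}(G-e)$, where $G-e=(N,A\setminus\{e\},c)$. Consider algorithms on a random access machine with exact real numbers (unit cost for reading and writing variables and array cells, integer successor and predecessor, real addition and subtraction, and integer and real comparisons), which may also call a given max-flow routine, i.e. a black box that returns some maximum flow assignment for any instance of the above kind (connected undirected graph without loops and parallel arcs, non-negative real capacities, two distinct terminals). **Theorem.** There are such an algorithm and a constant $K$, both independent of the routine, such that for every max-flow routine and every input $(G,s,t)$, with $G$ given by its list of arcs and capacities, the algorithm computes $\mathrm{flowVit}(e)$ for all $e\in A$ with at most $2(n-1)$ calls to the routine, each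 on an instance with at most $n$ nodes and at most $m$ arcs, and at most $K\,m\,n$ further elementary steps. Consequently, if $\mathrm{MF}(n,m)$ bounds the worst-case time of the routine on instances with at most $n$ nodes and at most $m$ arcs, then the total running time is at most $K\,(n\cdot \mathrm{MF}(n,m)+m\cdot n)$, that is, $O(n\cdot \mathrm{MF}(n,m)+m\cdot n)$. -/

import Mathlib

namespace MaxFlowVitality

/-- A max-flow instance: a connected undirected graph without loops and parallel arcs, on the nodes
`0, …, n - 1`, whose arcs are listed as `0, …, m - 1` (arc `i` joins `tail i` and `head i`, the
order of the two endpoints carries no meaning), with non-negative real capacities and two distinct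
terminals `s`, `t`. -/
structure Network where
  n : ℕ
  m : ℕ
  tail : Fin m → Fin n
  head : Fin m → Fin n
  cap : Fin m → ℝ
  s : Fin n
  t : Fin n
  cap_nonneg : ∀ i, 0 ≤ cap i
  s_ne_t : s ≠ t
  loopless : ∀ i, tail i ≠ head i
  simple : Function.Injective fun i => s(tail i, head i)
  connected : (SimpleGraph.fromEdgeSet (Set.range fun i => s(tail i, head i))).Connected

namespace Network

variable (I : Network)

/-- The directed arcs obtained by replacing each undirected arc `i` by the pair
`(i, false) = (tail i, head i)` and `(i, true) = (head i, tail i)`. -/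
abbrev DArc : Type := Fin I.m × Bool

def src (d : I.DArc) : Fin I.n := if d.2 then I.head d.1 else I.tail d.1

def dst (d : I.DArc) : Fin I.n := if d.2 then I.tail d.1 else I.head d.1

/-- Total flow of `f` leaving `v` in the subgraph with arc set `A`. -/
noncomputable def outflow (A : Finset (Fin I.m)) (f : I.DArc → ℝ) (v : Fin I.n) : ℝ :=
  ∑ d : I.DArc with d.1 ∈ A ∧ I.src d = v, f d

/-- Total flow of `f` entering `v` in the subgraph with arc set `A`. -/
noncomputable def inflow (A : Finset (Fin I.m)) (f : I.DArc → ℝ) (v : Fin I.n) : ℝ :=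
  ∑ d : I.DArc with d.1 ∈ A ∧ I.dst d = v, f d

/-- `f` is a feasible flow assignment from `s` to `t` in the subgraph with arc set `A`. -/
def Feasible (A : Finset (Fin I.m)) (f : I.DArc → ℝ) : Prop :=
  (∀ d : I.DArc, d.1 ∈ A → 0 ≤ f d ∧ f d ≤ I.cap d.1) ∧
    ∀ v, v ≠ I.s → v ≠ I.t → I.inflow A f v = I.outflow A f v

/-- The flow from `s` to `t` under the assignment `f`, in the subgraph with arc set `A`. -/
noncomputable def value (A : Finset (Fin I.m)) (f : I.DArc → ℝ) : ℝ :=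
  I.outflow A f I.s - I.inflow A f I.s

/-- The maximum flow in the subgraph with arc set `A`. The set of values contains `0` and is
bounded by the sum of the capacities, so the supremum is never a default value. -/
noncomputable def maxFlow (A : Finset (Fin I.m)) : ℝ :=
  sSup (I.value A '' {f | I.Feasible A f})

/-- The vitality of the arc `e`: the loss of maximum flow when `e` is removed. -/
noncomputable def flowVit (e : Fin I.m) : ℝ :=
  I.maxFlow Finset.univ - I.maxFlow (Finset.univ.erase e)

/-- `f` is a maximum flow assignment of the whole network. -/
def IsMaxFlowAssignment (f : I.DArc → ℝ) : Prop :=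
  I.Feasible Finset.univ f ∧
    ∀ g, I.Feasible Finset.univ g → I.value Finset.univ g ≤ I.value Finset.univ f

end Network

/-- A max-flow routine: on every network it returns some maximum flow assignment, and it takes
a certain time. Nothing else is known about the assignment that it returns. -/
structure MaxFlowRoutine where
  flow : (I : Network) → I.DArc → ℝ
  time : Network → ℕ
  correct : ∀ I : Network, I.IsMaxFlowAssignment (flow I)

/-- `MF n m` bounds the worst-case time of the routine on networks with at most `n` nodes and at
most `m` arcs. -/
def MaxFlowRoutine.RunsIn (R : MaxFlowRoutine) (MF : ℕ → ℕ → ℕ) : Prop :=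
  ∀ (n m : ℕ) (J : Network), J.n ≤ n → J.m ≤ m → R.time J ≤ MF n m

/-! A real random access machine, programmed in a structured imperative language. Variables and
arrays are named by numbers; a program mentions only finitely many of them. The only integer
operations are successor and predecessor, so that an integer grows by at most one per step; the
only real operations are addition, subtraction and comparison, the only real constant is `0`. -/

/-- Memory: integer variables, integer arrays, real variables, real arrays. -/
structure State where
  ivar : ℕ → ℕ
  iarr : ℕ → ℕ → ℕ
  rvar : ℕ → ℝ
  rarr : ℕ → ℕ → ℝ

/-- Integer expressions. -/
inductive IExp where
  | lit (k : ℕ)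
  | var (x : ℕ)
  | read (a : ℕ) (i : IExp)
  | succ (e : IExp)
  | pred (e : IExp)

def IExp.eval (σ : State) : IExp → ℕ
  | .lit k => k
  | .var x => σ.ivar x
  | .read a i => σ.iarr a (i.eval σ)
  | .succ e => e.eval σ + 1
  | .pred e => e.eval σ - 1

/-- The number of elementary operations that evaluating an expression takes. -/
def IExp.cost : IExp → ℕ
  | .lit _ => 1
  | .var _ => 1
  | .read _ i => i.cost + 1
  | .succ e => e.cost + 1
  | .pred e => e.cost + 1

/-- Real expressions. -/
inductive RExp where
  | zero
  | var (x : ℕ)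
  | read (a : ℕ) (i : IExp)
  | add (e₁ e₂ : RExp)
  | sub (e₁ e₂ : RExp)

noncomputable def RExp.eval (σ : State) : RExp → ℝ
  | .zero => 0
  | .var x => σ.rvar x
  | .read a i => σ.rarr a (i.eval σ)
  | .add e₁ e₂ => e₁.eval σ + e₂.eval σ
  | .sub e₁ e₂ => e₁.eval σ - e₂.eval σ

def RExp.cost : RExp → ℕ
  | .zero => 1
  | .var _ => 1
  | .read _ i => i.cost + 1
  | .add e₁ e₂ => e₁.cost + e₂.cost + 1
  | .sub e₁ e₂ => e₁.cost + e₂.cost + 1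

/-- Tests. -/
inductive BExp where
  | eqI (e₁ e₂ : IExp)
  | ltI (e₁ e₂ : IExp)
  | ltR (e₁ e₂ : RExp)
  | not (b : BExp)
  | and (b₁ b₂ : BExp)

def BExp.Holds (σ : State) : BExp → Prop
  | .eqI e₁ e₂ => e₁.eval σ = e₂.eval σ
  | .ltI e₁ e₂ => e₁.eval σ < e₂.eval σ
  | .ltR e₁ e₂ => e₁.eval σ < e₂.eval σ
  | .not b => ¬ b.Holds σ
  | .and b₁ b₂ => b₁.Holds σ ∧ b₂.Holds σ

def BExp.cost : BExp → ℕ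
  | .eqI e₁ e₂ => e₁.cost + e₂.cost + 1
  | .ltI e₁ e₂ => e₁.cost + e₂.cost + 1
  | .ltR e₁ e₂ => e₁.cost + e₂.cost + 1
  | .not b => b.cost + 1
  | .and b₁ b₂ => b₁.cost + b₂.cost + 1

/-- Where a network is stored: integer variables for `n`, `m`, `s`, `t`, integer arrays for the
endpoints of the arcs, a real array for the capacities. -/
structure Layout where
  n : ℕ
  m : ℕ
  s : ℕ
  t : ℕ
  tail : ℕ
  head : ℕ
  cap : ℕ

/-- The network `I` is stored in the memory `σ` at the places given by `L`. -/
structure Stored (L : Layout) (I : Network) (σ : State) : Prop where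
  n : σ.ivar L.n = I.n
  m : σ.ivar L.m = I.m
  s : σ.ivar L.s = I.s
  t : σ.ivar L.t = I.t
  tail : ∀ i : Fin I.m, σ.iarr L.tail i = I.tail i
  head : ∀ i : Fin I.m, σ.iarr L.head i = I.head i
  cap : ∀ i : Fin I.m, σ.rarr L.cap i = I.cap i

/-- Programs. `maxflow L a b` calls the max-flow routine on the network stored at `L`; the routine
writes its flow on the directed arcs `(tail i, head i)` to the real array `a` and its flow on the
directed arcs `(head i, tail i)` to the real array `b`. -/
inductive Cmd where
  | skip
  | setI (x : ℕ) (e : IExp)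
  | setR (x : ℕ) (e : RExp)
  | storeI (a : ℕ) (i : IExp) (e : IExp)
  | storeR (a : ℕ) (i : IExp) (e : RExp)
  | seq (c₁ c₂ : Cmd)
  | cond (b : BExp) (c₁ c₂ : Cmd)
  | loop (b : BExp) (c : Cmd)
  | maxflow (L : Layout) (a b : ℕ)

/-- Overwrite the first `k` entries of an array. -/
def overwrite {k : ℕ} (g : Fin k → ℝ) (old : ℕ → ℝ) : ℕ → ℝ :=
  fun j => if h : j < k then g ⟨j, h⟩ else old j

noncomputable def State.writeFlow (σ : State) (I : Network) (f : I.DArc → ℝ) (a b : ℕ) : State :=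
  let r := Function.update σ.rarr a (overwrite (fun i => f (i, false)) (σ.rarr a))
  { σ with rarr := Function.update r b (overwrite (fun i => f (i, true)) (r b)) }

/-- `Exec R c σ σ' k l`: with `R` as the max-flow routine, the program `c` started in memory `σ`
halts in memory `σ'`, after `k` elementary steps outside the routine and after calling the routine
successively on the networks in the list `l`. A call on data that are not a network never halts. -/
inductive Exec (R : MaxFlowRoutine) : Cmd → State → State → ℕ → List Network → Prop where
  | skip (σ : State) : Exec R .skip σ σ 1 []
  | setI (σ : State) (x : ℕ) (e : IExp) :
      Exec R (.setI x e) σ { σ with ivar := Function.update σ.ivar x (e.eval σ) } (e.cost + 1) []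
  | setR (σ : State) (x : ℕ) (e : RExp) :
      Exec R (.setR x e) σ { σ with rvar := Function.update σ.rvar x (e.eval σ) } (e.cost + 1) []
  | storeI (σ : State) (a : ℕ) (i e : IExp) :
      Exec R (.storeI a i e) σ
        { σ with
          iarr := Function.update σ.iarr a (Function.update (σ.iarr a) (i.eval σ) (e.eval σ)) }
        (i.cost + e.cost + 1) []
  | storeR (σ : State) (a : ℕ) (i : IExp) (e : RExp) :
      Exec R (.storeR a i e) σ
        { σ with
          rarr := Function.update σ.rarr a (Function.update (σ.rarr a) (i.eval σ) (e.eval σ)) }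
        (i.cost + e.cost + 1) []
  | seq {c₁ c₂ : Cmd} {σ σ₁ σ₂ : State} {k₁ k₂ : ℕ} {l₁ l₂ : List Network}
      (h₁ : Exec R c₁ σ σ₁ k₁ l₁) (h₂ : Exec R c₂ σ₁ σ₂ k₂ l₂) :
      Exec R (.seq c₁ c₂) σ σ₂ (k₁ + k₂) (l₁ ++ l₂)
  | condTrue {b : BExp} {c₁ c₂ : Cmd} {σ σ' : State} {k : ℕ} {l : List Network}
      (hb : b.Holds σ) (h : Exec R c₁ σ σ' k l) :
      Exec R (.cond b c₁ c₂) σ σ' (b.cost + k) l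
  | condFalse {b : BExp} {c₁ c₂ : Cmd} {σ σ' : State} {k : ℕ} {l : List Network}
      (hb : ¬ b.Holds σ) (h : Exec R c₂ σ σ' k l) :
      Exec R (.cond b c₁ c₂) σ σ' (b.cost + k) l
  | loopDone {b : BExp} {c : Cmd} {σ : State} (hb : ¬ b.Holds σ) :
      Exec R (.loop b c) σ σ b.cost []
  | loopStep {b : BExp} {c : Cmd} {σ σ₁ σ₂ : State} {k₁ k₂ : ℕ} {l₁ l₂ : List Network}
      (hb : b.Holds σ) (h₁ : Exec R c σ σ₁ k₁ l₁) (h₂ : Exec R (.loop b c) σ₁ σ₂ k₂ l₂) :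
      Exec R (.loop b c) σ σ₂ (b.cost + k₁ + k₂) (l₁ ++ l₂)
  | maxflow {L : Layout} {a b : ℕ} {σ : State} (I : Network) (h : Stored L I σ) :
      Exec R (.maxflow L a b) σ (σ.writeFlow I (R.flow I) a b) 1 [I]

/-- Where the input of the vitality problem is stored. -/
def inputLayout : Layout where
  n := 0
  m := 1
  s := 2
  t := 3
  tail := 0
  head := 1
  cap := 0

/-- The real array that receives the vitalities: entry `i` is the vitality of arc `i`. -/
def outputArray : ℕ := 1

end MaxFlowVitality

open MaxFlowVitality

/-! By max-flow min-cut, deleting `e` leaves the smaller of the old maximum `F` and `x - c(e)`,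
where `x` is the least capacity of an s-t cut that separates the two ends of `e`. Hence the vitality
of `e` is `F - min F (x - c(e))` (`Network.flowVit_eq`), and it suffices to know, for pairs `u`,
`v`, the least capacity of an s-t cut with `u` and `v` on different sides (`sepVal`,
`Network.sepCap`).

For any family of weighted bipartitions these values satisfy the ultrametric inequality
`min_le_sepVal`, so they fit into a tree with `n - 1` weighted arcs, the value of a pair being the
least weight on its path. No uncrossing of cuts is used. The nodes are treated in order: node `k` is
separated from its current parent by a cheapest cut `C`, and a later node on the side of `k` moves
to `k` if its representative stays joined to the parent after deletion of the tree arcs of weight at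
most `w C`. The delicate part of the invariant `TreeInv` is that every pair of tree nodes has a
cheapest cut that respects the attachments of all nodes joined more strongly to one node of the
pair; `TreeInv.step` preserves it.

A cut separating two nodes has one of two orientations. For each of them one node is merged into `s`
and the other into `t`, and one call of the routine, followed by a search of the residual graph,
gives the cheapest cut of that orientation (`cutBetween_runs`). This makes at most two calls in each
of `n - 1` rounds. The other work of a round is linear in `n + m`, and each arc then needs one path
query of cost linear in `n`. Since `n ≤ m + 1` by connectivity, the total is of order `m * n`.

The program itself is verified in a small Hoare logic with time bounds (`Runs`, `Does`) and a
syntactic frame property (`Exec.frame`). -/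

namespace MaxFlowVitality

open Finset Relation

/-! ### Cuts, residual graphs and the vitality formula. -/

namespace Network

variable (I : Network)

/-- The capacity of the cut that separates the nodes by the value of `D`. -/
noncomputable def cutCap (D : ℕ → Bool) : ℝ :=
  ∑ i, if D (I.tail i) = D (I.head i) then 0 else I.cap i

/-- `D` is the indicator of a node set that contains `s` and misses `t`. -/
def IsCut (D : ℕ → Bool) : Prop := D I.s = true ∧ D I.t = false

/-- The net flow of `f` along arc `i`, from its tail to its head. -/
def net {I : Network} (f : I.DArc → ℝ) (i : Fin I.m) : ℝ := f (i, false) - f (i, true)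

/-- The arcs of the residual graph of `f`. -/
def Residual {I : Network} (f : I.DArc → ℝ) (x y : ℕ) : Prop :=
  ∃ i, (x = I.tail i ∧ y = I.head i ∧ net f i < I.cap i) ∨
    (x = I.head i ∧ y = I.tail i ∧ -I.cap i < net f i)

variable {I}

theorem outflow_sub_inflow (f : I.DArc → ℝ) (v : Fin I.n) :
    I.outflow univ f v - I.inflow univ f v =
      ∑ i, net f i * ((if I.tail i = v then 1 else 0) - (if I.head i = v then 1 else 0)) := by
  unfold outflow inflow
  rw [Finset.sum_filter, Finset.sum_filter, Fintype.sum_prod_type, Fintype.sum_prod_type,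
    ← Finset.sum_sub_distrib]
  refine Finset.sum_congr rfl fun i _ => ?_
  simp only [Fintype.sum_bool, src, dst, net, mem_univ, true_and]
  simp only [if_true, Bool.false_eq_true, if_false]
  split_ifs <;> ring

/-- Summing the net outflow over the side of `s` leaves only the term of `s`, by conservation.
Exchanging the sums regroups the total by arcs, and arcs with both ends on one side cancel. -/
theorem Feasible.value_eq {f : I.DArc → ℝ} (hf : I.Feasible univ f) {D : ℕ → Bool}
    (hD : I.IsCut D) :
    I.value univ f =
      ∑ i, net f i * ((if D (I.tail i) then 1 else 0) - (if D (I.head i) then 1 else 0)) := by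
  have h1 : I.value univ f =
      ∑ v : Fin I.n, (if D v then 1 else 0) * (I.outflow univ f v - I.inflow univ f v) := by
    rw [Finset.sum_eq_single I.s]
    · simp [hD.1, value]
    · intro v _ hv
      by_cases ht : v = I.t
      · simp [ht, hD.2]
      · rw [hf.2 v hv ht]; simp
    · simp
  rw [h1]
  simp only [outflow_sub_inflow, Finset.mul_sum]
  rw [Finset.sum_comm]
  refine Finset.sum_congr rfl fun i _ => ?_
  have h2 : ∀ w : Fin I.n, ∑ v : Fin I.n, (if D v then (1 : ℝ) else 0) * (if w = v then 1 else 0)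
      = if D w then 1 else 0 := fun w => by simp
  rw [← h2 (I.tail i), ← h2 (I.head i), ← Finset.sum_sub_distrib, Finset.mul_sum]
  exact Finset.sum_congr rfl fun v _ => by ring

theorem Feasible.net_le {f : I.DArc → ℝ} (hf : I.Feasible univ f) (i : Fin I.m) :
    -I.cap i ≤ net f i ∧ net f i ≤ I.cap i := by
  have h1 := hf.1 (i, false) (mem_univ _)
  have h2 := hf.1 (i, true) (mem_univ _)
  simp only [net]
  constructor <;> linarith

/-- Weak duality. The graph is undirected, so a crossing arc contributes at most its capacity
whichever way it is listed. -/
theorem Feasible.value_le_cutCap {f : I.DArc → ℝ} (hf : I.Feasible univ f) {D : ℕ → Bool}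
    (hD : I.IsCut D) : I.value univ f ≤ I.cutCap D := by
  rw [hf.value_eq hD]
  refine Finset.sum_le_sum fun i _ => ?_
  have := hf.net_le i
  cases D (I.tail i) <;> cases D (I.head i) <;> simp <;> linarith

/-- If no residual arc leaves the side of `s`, every crossing arc carries its full capacity outward,
and weak duality is tight arc by arc. -/
theorem Feasible.value_eq_cutCap {f : I.DArc → ℝ} (hf : I.Feasible univ f) {D : ℕ → Bool}
    (hD : I.IsCut D) (hcl : ∀ x y, Residual f x y → D x = true → D y = true) :
    I.value univ f = I.cutCap D := by
  rw [hf.value_eq hD]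
  refine Finset.sum_congr rfl fun i _ => ?_
  have h := hf.net_le i
  have h1 := hcl (I.tail i) (I.head i)
  have h2 := hcl (I.head i) (I.tail i)
  cases ht : D (I.tail i) <;> cases hh : D (I.head i) <;> simp only [ht, hh] at h1 h2 <;> simp
  · by_contra hne
    exact absurd (h2 ⟨i, Or.inr ⟨rfl, rfl, lt_of_le_of_ne h.1 fun h => hne (by linarith)⟩⟩ trivial)
      (by simp)
  · by_contra hne
    exact absurd (h1 ⟨i, Or.inl ⟨rfl, rfl, lt_of_le_of_ne h.2 hne⟩⟩ trivial) (by simp)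

/-- A node reachable in the residual graph is reached by a unit flow that the residual capacities
allow in small multiples. -/
theorem exists_direction {f : I.DArc → ℝ} {x : ℕ} (h : ReflTransGen (Residual f) I.s x) :
    ∃ g : Fin I.m → ℝ, (∀ i, 0 < g i → net f i < I.cap i) ∧ (∀ i, g i < 0 → -I.cap i < net f i) ∧
      ∀ v : Fin I.n,
        ∑ i, g i * ((if I.tail i = v then 1 else 0) - (if I.head i = v then 1 else 0)) =
          (if I.s = v then 1 else 0) - (if x = v then 1 else 0) := by
  induction h with
  | refl => exact ⟨0, by simp, by simp, by simp [Fin.ext_iff]⟩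
  | @tail y z _ hyz ih =>
    obtain ⟨g, g1, g2, g3⟩ := ih
    obtain ⟨j, ⟨rfl, rfl, hj⟩ | ⟨rfl, rfl, hj⟩⟩ := hyz
    -- The walk may use arc `j` repeatedly. The new unit only needs room in its own direction, which
    -- `hj` supplies; a total that is still negative was negative before.
    · refine ⟨g + Pi.single j 1, fun i hi => ?_, fun i hi => ?_, fun v => ?_⟩
      · by_cases hij : i = j
        · exact hij ▸ hj
        · exact g1 i (by simpa [hij] using hi)
      · refine g2 i ?_
        by_cases hij : i = j
        · subst hij; simp at hi; linarith
        · simpa [hij] using hi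
      · simp only [Pi.add_apply, add_mul, Finset.sum_add_distrib, g3, Pi.single_apply]
        simp [← Fin.ext_iff]
    · refine ⟨g - Pi.single j 1, fun i hi => ?_, fun i hi => ?_, fun v => ?_⟩
      · refine g1 i ?_
        by_cases hij : i = j
        · subst hij; simp at hi; linarith
        · simpa [hij] using hi
      · by_cases hij : i = j
        · exact hij ▸ hj
        · exact g2 i (by simpa [hij] using hi)
      · simp only [Pi.sub_apply, sub_mul, Finset.sum_sub_distrib, g3, Pi.single_apply]
        simp [← Fin.ext_iff]

/-- A bound towards which `g` moves is strict, so by continuity it survives for all small positive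
`ε`; a bound from which `g` does not approach holds by feasibility. There are finitely many arcs. -/
theorem exists_pos_scaling {f : I.DArc → ℝ} (hf : I.Feasible univ f) {g : Fin I.m → ℝ}
    (g1 : ∀ i, 0 < g i → net f i < I.cap i) (g2 : ∀ i, g i < 0 → -I.cap i < net f i) :
    ∃ ε : ℝ, 0 < ε ∧ ∀ i, -I.cap i ≤ net f i + ε * g i ∧ net f i + ε * g i ≤ I.cap i := by
  have key : ∀ i, ∀ᶠ ε : ℝ in nhdsWithin 0 (Set.Ioi 0),
      -I.cap i ≤ net f i + ε * g i ∧ net f i + ε * g i ≤ I.cap i := by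
    intro i
    have hc : Filter.Tendsto (fun ε : ℝ => net f i + ε * g i) (nhdsWithin 0 (Set.Ioi 0))
        (nhds (net f i)) := by
      have : ContinuousAt (fun ε : ℝ => net f i + ε * g i) 0 := by fun_prop
      simpa [ContinuousAt] using this.tendsto.mono_left nhdsWithin_le_nhds
    have hb := hf.net_le i
    refine Filter.Eventually.and ?_ ?_
    · rcases lt_or_ge (g i) 0 with h | h
      · exact (hc.eventually (lt_mem_nhds (g2 i h))).mono fun _ h => h.le
      · filter_upwards [self_mem_nhdsWithin] with ε hε
        have : 0 ≤ ε * g i := mul_nonneg (le_of_lt hε) h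
        linarith
    · rcases lt_or_ge 0 (g i) with h | h
      · exact (hc.eventually (gt_mem_nhds (g1 i h))).mono fun _ h => h.le
      · filter_upwards [self_mem_nhdsWithin] with ε hε
        have : ε * g i ≤ 0 := mul_nonpos_of_nonneg_of_nonpos (le_of_lt hε) h
        linarith
  obtain ⟨ε, h, hε⟩ := ((Filter.eventually_all.2 key).and self_mem_nhdsWithin).exists
  exact ⟨ε, hε, h⟩

/-- The residual graph of a maximum flow has no path from `s` to `t`. -/
theorem IsMaxFlowAssignment.not_reachable {f : I.DArc → ℝ} (hf : I.IsMaxFlowAssignment f) :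
    ¬ ReflTransGen (Residual f) I.s I.t := by
  intro h
  obtain ⟨g, g1, g2, g3⟩ := exists_direction h
  obtain ⟨ε, hε, hb⟩ := exists_pos_scaling hf.1 g1 g2
  -- Only the net flow matters. Its positive and negative parts are put on the two opposite directed
  -- arcs, which keeps both entries between `0` and the capacity.
  let f' : I.DArc → ℝ := fun d =>
    if d.2 then max (-(net f d.1 + ε * g d.1)) 0 else max (net f d.1 + ε * g d.1) 0
  have hnet : ∀ i, net f' i = net f i + ε * g i := by
    intro i
    simp only [net, f', if_true, Bool.false_eq_true, if_false]
    rcases le_total 0 (f (i, false) - f (i, true) + ε * g i) with h | h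
    · rw [max_eq_left h, max_eq_right (by linarith)]; ring
    · rw [max_eq_right h, max_eq_left (by linarith)]; ring
  have hex : ∀ v, I.outflow univ f' v - I.inflow univ f' v =
      I.outflow univ f v - I.inflow univ f v +
        ε * ((if I.s = v then 1 else 0) - (if (I.t : ℕ) = v then 1 else 0)) := by
    intro v
    rw [outflow_sub_inflow, outflow_sub_inflow, ← g3 v, Finset.mul_sum, ← Finset.sum_add_distrib]
    exact Finset.sum_congr rfl fun i _ => by rw [hnet]; ring
  have hfeas : I.Feasible univ f' := by
    refine ⟨fun d _ => ?_, fun v hs ht => ?_⟩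
    · have := hb d.1
      have := I.cap_nonneg d.1
      simp only [f']
      split_ifs
      · exact ⟨le_max_right _ _, max_le (by linarith) this⟩
      · exact ⟨le_max_right _ _, max_le (by linarith) this⟩
    · have h1 := hex v
      have h2 := hf.1.2 v hs ht
      rw [if_neg (Ne.symm hs), if_neg (fun h => ht (Fin.ext h).symm)] at h1
      linarith
  have h1 := hf.2 f' hfeas
  have h2 := hex I.s
  rw [if_pos rfl, if_neg (fun h => I.s_ne_t (Fin.ext h).symm)] at h2
  unfold value at h1
  linarith

theorem IsMaxFlowAssignment.maxFlow_eq {f : I.DArc → ℝ} (hf : I.IsMaxFlowAssignment f) :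
    I.maxFlow univ = I.value univ f := by
  refine IsGreatest.csSup_eq ⟨⟨f, hf.1, rfl⟩, ?_⟩
  rintro _ ⟨g, hg, rfl⟩
  exact hf.2 g hg

/-- The set found by searching the residual graph of a maximum flow is a minimum cut. -/
theorem IsMaxFlowAssignment.isCut_of_search {f : I.DArc → ℝ} (hf : I.IsMaxFlowAssignment f)
    {D : ℕ → Bool} (hs : D I.s = true) (hcl : ∀ x y, Residual f x y → D x = true → D y = true)
    (hr : ∀ x, D x = true → ReflTransGen (Residual f) I.s x) :
    I.IsCut D ∧ I.cutCap D = I.value univ f := by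
  have hD : I.IsCut D := ⟨hs, by
    by_contra h
    exact hf.not_reachable (hr _ (by simpa using h))⟩
  exact ⟨hD, (hf.1.value_eq_cutCap hD hcl).symm⟩

theorem IsMaxFlowAssignment.exists_cut {f : I.DArc → ℝ} (hf : I.IsMaxFlowAssignment f) :
    ∃ D, I.IsCut D ∧ I.cutCap D = I.value univ f := by
  classical
  refine ⟨fun x => decide (ReflTransGen (Residual f) I.s x), hf.isCut_of_search ?_ ?_ ?_⟩
  · simp
    rfl
  · intro x y hxy hx
    simp only [decide_eq_true_eq] at hx ⊢
    exact hx.tail hxy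
  · intro x hx
    simpa using hx

/-- The network in which the capacity of `e` is replaced by `0`. -/
noncomputable abbrev zeroCap (I : Network) (e : Fin I.m) : Network :=
  { I with
    cap := Function.update I.cap e 0
    cap_nonneg := fun i => by
      by_cases h : i = e
      · simp [h]
      · simpa [h] using I.cap_nonneg i }

/-- The graph without `e` may be disconnected and then is not a `Network`, whereas keeping `e` with
capacity `0` gives one. Feasible flows there vanish on `e`, so both problems have the same values.
-/
theorem maxFlow_erase (e : Fin I.m) :
    I.maxFlow (univ.erase e) = (I.zeroCap e).maxFlow univ := by
  have hout : ∀ (f : I.DArc → ℝ) v, (I.zeroCap e).outflow univ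
      (fun d : I.DArc => if d.1 = e then 0 else f d) v = I.outflow (univ.erase e) f v := by
    intro f v
    unfold outflow
    rw [Finset.sum_filter, Finset.sum_filter]
    refine Finset.sum_congr rfl fun (d : I.DArc) _ => ?_
    by_cases h : d.1 = e
    · simp [h]
    · simp [h]; rfl
  have hin : ∀ (f : I.DArc → ℝ) v, (I.zeroCap e).inflow univ
      (fun d : I.DArc => if d.1 = e then 0 else f d) v = I.inflow (univ.erase e) f v := by
    intro f v
    unfold inflow
    rw [Finset.sum_filter, Finset.sum_filter]
    refine Finset.sum_congr rfl fun (d : I.DArc) _ => ?_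
    by_cases h : d.1 = e
    · simp [h]
    · simp [h]; rfl
  unfold maxFlow
  congr 1
  ext x
  constructor
  · rintro ⟨f, hf, rfl⟩
    refine ⟨fun d : I.DArc => if d.1 = e then 0 else f d, ⟨fun (d : I.DArc) _ => ?_, fun v hs ht => ?_⟩, ?_⟩
    · by_cases h : d.1 = e
      · simp [h, zeroCap]
      · simpa [h, zeroCap] using hf.1 d (by simpa using h)
    · exact (hin f v).trans ((hf.2 v hs ht).trans (hout f v).symm)
    · exact congrArg₂ (· - ·) (hout f I.s) (hin f I.s)
  · rintro ⟨f, hf, rfl⟩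
    have h0 : (fun d : I.DArc => if d.1 = e then 0 else f d) = f := by
      funext d
      by_cases h : d.1 = e
      · have := hf.1 d (mem_univ _)
        simp only [zeroCap, h, Function.update_self] at this
        simpa [h] using le_antisymm this.1 this.2
      · simp [h]
    have hout' : ∀ v, (I.zeroCap e).outflow univ f v = I.outflow (univ.erase e) f v := fun v => by
      rw [← hout f v]; exact congrArg (fun g => (I.zeroCap e).outflow univ g v) h0.symm
    have hin' : ∀ v, (I.zeroCap e).inflow univ f v = I.inflow (univ.erase e) f v := fun v => by
      rw [← hin f v]; exact congrArg (fun g => (I.zeroCap e).inflow univ g v) h0.symm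
    refine ⟨f, ⟨fun d hd => ?_, fun v hs ht => ?_⟩, ?_⟩
    · have := hf.1 d (mem_univ _)
      have hne : d.1 ≠ e := by simpa using hd
      simpa [zeroCap, hne] using this
    · exact (hin' v).symm.trans ((hf.2 v hs ht).trans (hout' v))
    · exact (congrArg₂ (· - ·) (hout' I.s) (hin' I.s)).symm

theorem cutCap_zeroCap (e : Fin I.m) (D : ℕ → Bool) :
    (I.zeroCap e).cutCap D =
      I.cutCap D - if D (I.tail e) = D (I.head e) then 0 else I.cap e := by
  have : (I.zeroCap e).cutCap D = ∑ i, ((if D (I.tail i) = D (I.head i) then 0 else I.cap i) -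
      if i = e then (if D (I.tail e) = D (I.head e) then 0 else I.cap e) else 0) := by
    refine Finset.sum_congr rfl fun (i : Fin I.m) _ => ?_
    by_cases h : i = e
    · subst h; simp [zeroCap]
    · simp [zeroCap, h]
  rw [this, Finset.sum_sub_distrib]
  simp [cutCap]

/-- The vitality of `e` in terms of the minimum cuts and the minimum cuts through `e`. -/
theorem flowVit_eq (R : MaxFlowRoutine) (e : Fin I.m) {F x : ℝ}
    (hF : IsGLB (I.cutCap '' {D | I.IsCut D}) F)
    (hx : IsGLB (I.cutCap '' {D | I.IsCut D ∧ D (I.tail e) ≠ D (I.head e)}) x) :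
    I.flowVit e = F - min F (x - I.cap e) := by
  have h1 : I.maxFlow univ = F := by
    -- The routine serves here only as a proof that the maximum is attained, on `I` and below on the
    -- network with `e` at capacity `0`.
    have hR := R.correct I
    obtain ⟨D, hD, hv⟩ := hR.exists_cut
    rw [hR.maxFlow_eq]
    refine le_antisymm (hF.2 ?_) (hv ▸ hF.1 ⟨D, hD, rfl⟩)
    rintro _ ⟨D', hD', rfl⟩
    exact hR.1.value_le_cutCap hD'
  have h2 : I.maxFlow (univ.erase e) = min F (x - I.cap e) := by
    have hR := R.correct (I.zeroCap e)
    obtain ⟨D, hD, hv⟩ := hR.exists_cut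
    rw [maxFlow_erase, hR.maxFlow_eq]
    refine le_antisymm (le_min (hF.2 ?_) (le_sub_iff_add_le.2 (hx.2 ?_))) ?_
    · rintro _ ⟨D', hD', rfl⟩
      refine (hR.1.value_le_cutCap (D := D') hD').trans ?_
      rw [cutCap_zeroCap]
      have := I.cap_nonneg e
      split_ifs <;> linarith
    · rintro _ ⟨D', hD', rfl⟩
      have := hR.1.value_le_cutCap (D := D') hD'.1
      rw [cutCap_zeroCap, if_neg hD'.2] at this
      linarith
    -- A minimum cut after the deletion either does not separate the ends of `e` and costs at least
    -- `F`, or separates them and costs at least `x - I.cap e`.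
    · rw [← hv, cutCap_zeroCap]
      split_ifs with h
      · exact (min_le_left _ _).trans (by simpa using hF.1 ⟨D, hD, rfl⟩)
      · exact (min_le_right _ _).trans (sub_le_sub_right (hx.1 ⟨D, ⟨hD, h⟩, rfl⟩) _)
  rw [flowVit, h1, h2]

end Network

end MaxFlowVitality

/-! ### Trees that represent separation values. -/

namespace MaxFlowVitality

/-- The least weight of a bipartition in `F` that separates `u` from `v`. -/
noncomputable def sepVal (F : Set (ℕ → Bool)) (w : (ℕ → Bool) → EReal) (u v : ℕ) : EReal :=
  ⨅ D, ⨅ (_ : D ∈ F ∧ D u ≠ D v), w D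

section SepVal

variable {F : Set (ℕ → Bool)} {w : (ℕ → Bool) → EReal}

theorem sepVal_le {D : ℕ → Bool} {u v : ℕ} (hD : D ∈ F) (h : D u ≠ D v) :
    sepVal F w u v ≤ w D := iInf₂_le D ⟨hD, h⟩

theorem le_sepVal {u v : ℕ} {x : EReal} (h : ∀ D ∈ F, D u ≠ D v → x ≤ w D) :
    x ≤ sepVal F w u v := le_iInf₂ fun D hD => h D hD.1 hD.2

/-- An infimum over the empty family. Having the value `⊤`, neutral for `min`, is the reason for
weights in `EReal`. -/
theorem sepVal_self (u : ℕ) : sepVal F w u u = ⊤ :=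
  top_le_iff.1 (le_sepVal fun _ _ h => absurd rfl h)

theorem sepVal_comm (u v : ℕ) : sepVal F w u v = sepVal F w v u :=
  le_antisymm (le_sepVal fun _ hD h => sepVal_le hD h.symm)
    (le_sepVal fun _ hD h => sepVal_le hD h.symm)

/-- A bipartition that separates `u` from `x` has `v` on one of its sides, so it separates `u` from
`v` or `v` from `x`. This ultrametric inequality holds for any family of bipartitions. -/
theorem min_le_sepVal (u v x : ℕ) :
    min (sepVal F w u v) (sepVal F w v x) ≤ sepVal F w u x := by
  refine le_sepVal fun D hD h => ?_
  by_cases huv : D u = D v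
  · exact (min_le_right _ _).trans (sepVal_le hD (huv ▸ h))
  · exact (min_le_left _ _).trans (sepVal_le hD huv)

theorem lt_sepVal_trans {u v x : ℕ} {y : EReal} (h₁ : y < sepVal F w u v)
    (h₂ : y < sepVal F w v x) : y < sepVal F w u x :=
  (lt_min h₁ h₂).trans_le (min_le_sepVal u v x)

theorem eq_of_lt_sepVal {D : ℕ → Bool} {u v : ℕ} (hD : D ∈ F) (h : w D < sepVal F w u v) :
    D u = D v := by
  by_contra hne
  exact absurd (sepVal_le hD hne) (not_le.2 h)

/-- After `k` rounds: the nodes below `k` form a tree with parents `par` whose arcs `(a, par a)` of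
weight `val a` represent `sepVal`, and every other node `x < n` is attached to the tree node
`par x`. -/
structure TreeInv (F : Set (ℕ → Bool)) (w : (ℕ → Bool) → EReal) (n k : ℕ) (par : ℕ → ℕ)
    (val : ℕ → EReal) : Prop where
  par_lt : ∀ x < n, 0 < x → par x < x
  par_lt' : ∀ x < n, k ≤ x → par x < k
  sep : ∀ a < k, ∀ b < a, sepVal F w a b = min (val a) (sepVal F w (par a) b)
  -- A cheapest bipartition for `q` and `r` that splits no node from `q`, or from `r`, to which its
  -- representative is joined by a value above that of the pair. It lets a later node inherit values
  -- from its representative.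
  cut : ∀ q < k, ∀ r < k, q ≠ r → ∃ D ∈ F, w D ≤ sepVal F w q r ∧
    (∀ x < n, sepVal F w q r < sepVal F w (if x < k then x else par x) q → D x = D q) ∧
    (∀ x < n, sepVal F w q r < sepVal F w (if x < k then x else par x) r → D x = D r) ∧
    D q ≠ D r

variable {n k : ℕ} {par par' : ℕ → ℕ} {val val' : ℕ → EReal}

theorem TreeInv.init (hpar : ∀ x < n, par x = 0) : TreeInv F w n 1 par val where
  par_lt x hx h0 := by rw [hpar x hx]; exact h0
  par_lt' x hx _ := by rw [hpar x hx]; exact one_pos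
  sep a ha b hb := by omega
  cut q hq r hr hne := by omega

/-- One inequality is the ultrametric one. For the other, the cut that the invariant keeps for `par
k` and `q` has `k` on the side of its representative `par k`, so it separates `k` from `q`. If
moreover `w C` is below the value of `par k` and `q`, then `C` does not separate those two, hence it
separates `k` from `q`. -/
theorem TreeInv.sepVal_new (h : TreeInv F w n k par val) (hkn : k < n) {C : ℕ → Bool}
    (hCF : C ∈ F) (hCk : C k ≠ C (par k)) (hCw : w C = sepVal F w k (par k)) {q : ℕ} (hq : q < k) :
    sepVal F w k q = min (w C) (sepVal F w (par k) q) := by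
  refine le_antisymm ?_ (hCw ▸ min_le_sepVal _ _ _)
  have hp := h.par_lt' k hkn le_rfl
  have h1 : sepVal F w k q ≤ sepVal F w (par k) q := by
    by_cases hpq : par k = q
    · rw [hpq, sepVal_self]; exact le_top
    rcases eq_or_lt_of_le (le_top : sepVal F w (par k) q ≤ ⊤) with ht | ht
    · rw [ht]; exact le_top
    obtain ⟨D, hDF, hDw, hD1, -, hD3⟩ := h.cut _ hp q hq hpq
    have := hD1 k hkn (by simpa [sepVal_self] using ht)
    exact (sepVal_le hDF (this ▸ hD3)).trans hDw
  refine le_min ?_ h1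
  rcases le_or_gt (sepVal F w (par k) q) (w C) with hle | hlt
  · exact h1.trans hle
  · exact sepVal_le hCF (eq_of_lt_sepVal hCF hlt ▸ hCk)

/-- One round: a cheapest cut `C` between `k` and `par k` makes `k` a tree node. -/
theorem TreeInv.step (h : TreeInv F w n k par val) (hkn : k < n) {C : ℕ → Bool}
    (hCF : C ∈ F) (hCk : C k ≠ C (par k)) (hCw : w C = sepVal F w k (par k)) (hCt : w C < ⊤)
    (hpar : ∀ x < n, x ≤ k → par' x = par x)
    (hpar' : ∀ x < n, k < x → par' x = if C x = C k ∧ w C < sepVal F w (par x) (par k) then k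
      else par x)
    (hval : ∀ a < k, val' a = val a) (hval' : val' k = w C) :
    TreeInv F w n (k + 1) par' val' := by
  have hp := h.par_lt' k hkn le_rfl
  have hnew := fun q hq => h.sepVal_new hkn hCF hCk hCw (q := q) hq
  -- The representative of `x` becomes `k` or stays. If it stays and is joined to `par k` above `w
  -- C`, then `x` is not on the side of `k`; for tree nodes this is automatic, because `C` cannot
  -- separate them from `par k`.
  have hrep : ∀ x < n, ((if x < k + 1 then x else par' x) = k ∧ C x = C k ∧
        w C < sepVal F w (if x < k then x else par x) (par k)) ∨
      ((if x < k + 1 then x else par' x) = (if x < k then x else par x) ∧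
        (if x < k then x else par x) < k ∧
        (w C < sepVal F w (if x < k then x else par x) (par k) → C x ≠ C k)) := by
    intro x hx
    rcases lt_trichotomy x k with hxk | rfl | hxk
    · refine Or.inr ⟨by simp [hxk, hxk.trans (Nat.lt_succ_self k)], by simp [hxk], fun hlt => ?_⟩
      rw [if_pos hxk] at hlt
      rw [eq_of_lt_sepVal hCF hlt]
      exact hCk.symm
    · exact Or.inl ⟨by simp, rfl, by simpa [sepVal_self] using hCt⟩
    · rw [if_neg (by omega), if_neg (by omega), hpar' x hx hxk]
      have := h.par_lt' x hx hxk.le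
      split_ifs with hc
      · exact Or.inl ⟨rfl, hc⟩
      · exact Or.inr ⟨rfl, this, fun h1 h2 => hc ⟨h2, h1⟩⟩
  have hbool : ∀ x, C x ≠ C k → C x = C (par k) := by
    intro x hx
    cases hx' : C x <;> cases hk' : C k <;> cases hp' : C (par k) <;> simp_all
  have hcut : ∀ r < k, ∃ D ∈ F, w D ≤ sepVal F w k r ∧
      (∀ x < n, sepVal F w k r < sepVal F w (if x < k + 1 then x else par' x) k → D x = D k) ∧
      (∀ x < n, sepVal F w k r < sepVal F w (if x < k + 1 then x else par' x) r → D x = D r) ∧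
      D k ≠ D r := by
    intro r hr
    -- If `w C` is strictly below the value of `par k` and `r`, then `C` is the required cut for `k`
    -- and `r`. Otherwise the cut kept for `par k` and `r` serves, since it has `k` on the side of
    -- `par k`.
    rcases lt_or_ge (w C) (sepVal F w (par k) r) with hlt | hle
    · have hkr : sepVal F w k r = w C := by rw [hnew r hr, min_eq_left hlt.le]
      have hCr : C (par k) = C r := eq_of_lt_sepVal hCF hlt
      refine ⟨C, hCF, hkr.ge, fun x hx hxlt => ?_, fun x hx hxlt => ?_, hCr ▸ hCk⟩
      · rcases hrep x hx with ⟨-, h2, -⟩ | ⟨h1, h2, -⟩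
        · exact h2
        · rw [h1, hkr, sepVal_comm _ k, hnew _ h2] at hxlt
          exact absurd (min_le_left _ _) (not_le.2 hxlt)
      · rcases hrep x hx with ⟨h1, -, -⟩ | ⟨h1, -, h3⟩
        · rw [h1] at hxlt
          exact absurd hxlt (lt_irrefl _)
        · rw [h1, hkr] at hxlt
          rw [← hCr]
          exact hbool x (h3 (lt_sepVal_trans hxlt (sepVal_comm (par k) r ▸ hlt)))
    · have hpr : par k ≠ r := by
        rintro rfl
        rw [sepVal_self] at hle
        exact absurd hle (not_le.2 hCt)
      have hkr : sepVal F w k r = sepVal F w (par k) r := by rw [hnew r hr, min_eq_right hle]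
      obtain ⟨D, hDF, hDw, hD1, hD2, hD3⟩ := h.cut _ hp r hr hpr
      have hDk : D k = D (par k) := by
        refine hD1 k hkn ?_
        simpa [sepVal_self] using hle.trans_lt hCt
      refine ⟨D, hDF, hkr ▸ hDw, fun x hx hxlt => ?_, fun x hx hxlt => ?_, hDk ▸ hD3⟩
      · rw [hDk]
        refine hD1 x hx ?_
        rcases hrep x hx with ⟨-, -, h3⟩ | ⟨h1, h2, -⟩
        · exact hle.trans_lt h3
        · rw [h1, hkr, sepVal_comm _ k, hnew _ h2] at hxlt
          rw [sepVal_comm _ (par k)]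
          exact hxlt.trans_le (min_le_right _ _)
      · rcases hrep x hx with ⟨h1, -, -⟩ | ⟨h1, -, -⟩
        · rw [h1] at hxlt
          exact absurd hxlt (lt_irrefl _)
        · rw [h1, hkr] at hxlt
          exact hD2 x hx hxlt
  refine ⟨fun x hx h0 => ?_, fun x hx hkx => ?_, fun a ha b hb => ?_, fun q hq r hr hqr => ?_⟩
  · rcases lt_or_ge k x with hxk | hxk
    · rw [hpar' x hx hxk]
      split_ifs
      · exact hxk
      · exact h.par_lt x hx h0
    · rw [hpar x hx hxk]
      exact h.par_lt x hx h0
  · rw [hpar' x hx hkx]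
    split_ifs
    · exact Nat.lt_succ_self k
    · exact (h.par_lt' x hx (by omega)).trans (Nat.lt_succ_self k)
  · rcases Nat.lt_succ_iff_lt_or_eq.1 ha with hak | rfl
    · rw [hval a hak, hpar a (by omega) hak.le]
      exact h.sep a hak b hb
    · rw [hval', hpar a hkn le_rfl]
      exact hnew b hb
  · rcases Nat.lt_succ_iff_lt_or_eq.1 hq with hqk | rfl
    · rcases Nat.lt_succ_iff_lt_or_eq.1 hr with hrk | rfl
      · obtain ⟨D, hDF, hDw, hD1, hD2, hD3⟩ := h.cut q hqk r hrk hqr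
        -- A node that moves to `k` gains no connection: if `k` is joined to `y` above the
        -- threshold, so was the old representative, through `par k`. Old pairs therefore keep their
        -- cuts.
        have key : ∀ y < k, ∀ x < n,
            sepVal F w q r < sepVal F w (if x < k + 1 then x else par' x) y →
            sepVal F w q r < sepVal F w (if x < k then x else par x) y := by
          intro y hy x hx hxlt
          rcases hrep x hx with ⟨h1, -, h3⟩ | ⟨h1, -, -⟩
          · rw [h1, hnew y hy] at hxlt
            exact lt_sepVal_trans ((hxlt.trans_le (min_le_left _ _)).trans h3)
              (hxlt.trans_le (min_le_right _ _))
          · rwa [h1] at hxlt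
        exact ⟨D, hDF, hDw, fun x hx hlt => hD1 x hx (key q hqk x hx hlt),
          fun x hx hlt => hD2 x hx (key r hrk x hx hlt), hD3⟩
      · obtain ⟨D, hDF, hDw, hD1, hD2, hD3⟩ := hcut q hqk
        rw [sepVal_comm] at hDw hD1 hD2
        exact ⟨D, hDF, hDw, hD2, hD1, hD3.symm⟩
    · exact hcut r (by omega)

/-- The components of the tree after deleting the arcs of weight at most `y`. -/
theorem TreeInv.lt_sepVal_iff (h : TreeInv F w n k par val) (hkn : k ≤ n) {y : EReal}
    (hy : y < ⊤) {comp : ℕ → ℕ}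
    (hcomp : ∀ a < k, comp a = if 0 < a ∧ y < val a then comp (par a) else a) {a b : ℕ}
    (ha : a < k) (hb : b < k) : comp a = comp b ↔ y < sepVal F w a b := by
  -- Parents have smaller numbers, so a component is labelled by its root. If the arc above `a` is
  -- deleted, no `b < a` can have the label `a`.
  have hle : ∀ a < k, comp a ≤ a := by
    intro a
    induction a using Nat.strong_induction_on with
    | _ a ih =>
      intro ha
      rw [hcomp a ha]
      split_ifs with hc
      · have := h.par_lt a (by omega) hc.1
        exact (ih _ this (by omega)).trans this.le
      · exact le_rfl
  have key : ∀ a < k, ∀ b < a, comp a = comp b ↔ y < sepVal F w a b := by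
    intro a
    induction a using Nat.strong_induction_on with
    | _ a ih =>
      intro ha b hb
      have hp := h.par_lt a (by omega) (by omega)
      rw [hcomp a ha, h.sep a ha b hb, lt_min_iff]
      split_ifs with hc
      · rw [and_iff_right hc.2]
        rcases lt_trichotomy (par a) b with hlt | rfl | hlt
        · rw [eq_comm, ih b hb (by omega) _ hlt, sepVal_comm]
        · simp [sepVal_self, hy]
        · exact ih _ hp (by omega) b hlt
      · constructor
        · intro h1
          have := hle b (by omega)
          omega
        · exact fun h1 => absurd ⟨by omega, h1.1⟩ hc
  rcases lt_trichotomy a b with hlt | rfl | hlt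
  · rw [eq_comm, key b hb a hlt, sepVal_comm]
  · simp [sepVal_self, hy]
  · exact key a ha b hlt

end SepVal

end MaxFlowVitality

/-! ### Execution costs, frames and Hoare rules for programs. -/

namespace MaxFlowVitality

infixr:60 ";;" => Cmd.seq

/-- `c.rate * X` bounds the number of steps of `c` if each of its loops makes at most `8 * X`
iterations and no loop contains another one. -/
def Cmd.rate : Cmd → ℕ
  | .skip => 1
  | .setI _ e => e.cost + 1
  | .setR _ e => e.cost + 1
  | .storeI _ i e => i.cost + e.cost + 1
  | .storeR _ i e => i.cost + e.cost + 1
  | .seq c₁ c₂ => c₁.rate + c₂.rate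
  | .cond b c₁ c₂ => b.cost + c₁.rate + c₂.rate
  | .loop b c => 8 * (b.cost + c.rate) + b.cost
  | .maxflow _ _ _ => 1

/-- Programs without loops and without calls of the routine. -/
def Cmd.Straight : Cmd → Prop
  | .seq c₁ c₂ => c₁.Straight ∧ c₂.Straight
  | .cond _ c₁ c₂ => c₁.Straight ∧ c₂.Straight
  | .loop _ _ => False
  | .maxflow _ _ _ => False
  | _ => True

open Classical in
/-- The effect of a straight program on the memory. -/
noncomputable def Cmd.sem : Cmd → State → State
  | .skip, σ => σ
  | .setI x e, σ => { σ with ivar := Function.update σ.ivar x (e.eval σ) }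
  | .setR x e, σ => { σ with rvar := Function.update σ.rvar x (e.eval σ) }
  | .storeI a i e, σ =>
    { σ with iarr := Function.update σ.iarr a (Function.update (σ.iarr a) (i.eval σ) (e.eval σ)) }
  | .storeR a i e, σ =>
    { σ with rarr := Function.update σ.rarr a (Function.update (σ.rarr a) (i.eval σ) (e.eval σ)) }
  | .seq c₁ c₂, σ => c₂.sem (c₁.sem σ)
  | .cond b c₁ c₂, σ => if b.Holds σ then c₁.sem σ else c₂.sem σ
  | .loop _ _, σ => σ
  | .maxflow _ _ _, σ => σ

/-- The integer variables that a program may change. -/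
def Cmd.writesIvar : Cmd → List ℕ
  | .setI x _ => [x]
  | .seq c₁ c₂ => c₁.writesIvar ++ c₂.writesIvar
  | .cond _ c₁ c₂ => c₁.writesIvar ++ c₂.writesIvar
  | .loop _ c => c.writesIvar
  | _ => []

/-- The integer arrays that a program may change. -/
def Cmd.writesIarr : Cmd → List ℕ
  | .storeI a _ _ => [a]
  | .seq c₁ c₂ => c₁.writesIarr ++ c₂.writesIarr
  | .cond _ c₁ c₂ => c₁.writesIarr ++ c₂.writesIarr
  | .loop _ c => c.writesIarr
  | _ => []

/-- The real variables that a program may change. -/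
def Cmd.writesRvar : Cmd → List ℕ
  | .setR x _ => [x]
  | .seq c₁ c₂ => c₁.writesRvar ++ c₂.writesRvar
  | .cond _ c₁ c₂ => c₁.writesRvar ++ c₂.writesRvar
  | .loop _ c => c.writesRvar
  | _ => []

/-- The real arrays that a program may change. -/
def Cmd.writesRarr : Cmd → List ℕ
  | .storeR a _ _ => [a]
  | .seq c₁ c₂ => c₁.writesRarr ++ c₂.writesRarr
  | .cond _ c₁ c₂ => c₁.writesRarr ++ c₂.writesRarr
  | .loop _ c => c.writesRarr
  | .maxflow _ a b => [a, b]
  | _ => []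

/-- The memories `σ` and `τ` agree wherever `c` does not write. -/
structure Frame (c : Cmd) (σ τ : State) : Prop where
  ivar : ∀ x, x ∉ c.writesIvar → τ.ivar x = σ.ivar x
  iarr : ∀ x, x ∉ c.writesIarr → τ.iarr x = σ.iarr x
  rvar : ∀ x, x ∉ c.writesRvar → τ.rvar x = σ.rvar x
  rarr : ∀ x, x ∉ c.writesRarr → τ.rarr x = σ.rarr x

theorem Frame.refl (c : Cmd) (σ : State) : Frame c σ σ :=
  ⟨fun _ _ => rfl, fun _ _ => rfl, fun _ _ => rfl, fun _ _ => rfl⟩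

theorem Frame.trans {c : Cmd} {σ τ υ : State} (h₁ : Frame c σ τ) (h₂ : Frame c τ υ) :
    Frame c σ υ :=
  ⟨fun x hx => (h₂.ivar x hx).trans (h₁.ivar x hx), fun x hx => (h₂.iarr x hx).trans (h₁.iarr x hx),
    fun x hx => (h₂.rvar x hx).trans (h₁.rvar x hx),
    fun x hx => (h₂.rarr x hx).trans (h₁.rarr x hx)⟩

theorem Frame.mono {c c' : Cmd} {σ τ : State} (h : Frame c σ τ)
    (h₁ : c.writesIvar ⊆ c'.writesIvar) (h₂ : c.writesIarr ⊆ c'.writesIarr)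
    (h₃ : c.writesRvar ⊆ c'.writesRvar) (h₄ : c.writesRarr ⊆ c'.writesRarr) : Frame c' σ τ :=
  ⟨fun x hx => h.ivar x fun hh => hx (h₁ hh), fun x hx => h.iarr x fun hh => hx (h₂ hh),
    fun x hx => h.rvar x fun hh => hx (h₃ hh), fun x hx => h.rarr x fun hh => hx (h₄ hh)⟩

theorem Frame.seq_left {c c' : Cmd} {σ τ : State} (h : Frame c σ τ) : Frame (c ;; c') σ τ :=
  h.mono (List.subset_append_left _ _) (List.subset_append_left _ _)
    (List.subset_append_left _ _) (List.subset_append_left _ _)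

theorem Frame.seq_right {c c' : Cmd} {σ τ : State} (h : Frame c' σ τ) : Frame (c ;; c') σ τ :=
  h.mono (List.subset_append_right _ _) (List.subset_append_right _ _)
    (List.subset_append_right _ _) (List.subset_append_right _ _)

theorem Frame.cond_left {b : BExp} {c c' : Cmd} {σ τ : State} (h : Frame c σ τ) :
    Frame (.cond b c c') σ τ :=
  h.mono (List.subset_append_left _ _) (List.subset_append_left _ _)
    (List.subset_append_left _ _) (List.subset_append_left _ _)

theorem Frame.cond_right {b : BExp} {c c' : Cmd} {σ τ : State} (h : Frame c' σ τ) :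
    Frame (.cond b c c') σ τ :=
  h.mono (List.subset_append_right _ _) (List.subset_append_right _ _)
    (List.subset_append_right _ _) (List.subset_append_right _ _)

theorem Frame.of_loop {b : BExp} {c : Cmd} {σ τ : State} (h : Frame (.loop b c) σ τ) :
    Frame c σ τ := h.mono (fun _ h => h) (fun _ h => h) (fun _ h => h) (fun _ h => h)

theorem Frame.loop {b : BExp} {c : Cmd} {σ τ : State} (h : Frame c σ τ) :
    Frame (.loop b c) σ τ := h.mono (fun _ h => h) (fun _ h => h) (fun _ h => h) (fun _ h => h)

/-- An execution changes only what the program text writes. The write sets are computable lists, so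
later proofs settle what a subprogram preserves by `decide`. -/
theorem Exec.frame {R : MaxFlowRoutine} {c : Cmd} {σ τ : State} {k : ℕ} {l : List Network}
    (h : Exec R c σ τ k l) : Frame c σ τ := by
  induction h with
  | skip => exact Frame.refl _ _
  | setI => exact ⟨fun x hx => Function.update_of_ne (by simpa [Cmd.writesIvar] using hx) _ _,
      fun _ _ => rfl, fun _ _ => rfl, fun _ _ => rfl⟩
  | setR => exact ⟨fun _ _ => rfl, fun _ _ => rfl,
      fun x hx => Function.update_of_ne (by simpa [Cmd.writesRvar] using hx) _ _, fun _ _ => rfl⟩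
  | storeI => exact ⟨fun _ _ => rfl,
      fun x hx => Function.update_of_ne (by simpa [Cmd.writesIarr] using hx) _ _,
      fun _ _ => rfl, fun _ _ => rfl⟩
  | storeR => exact ⟨fun _ _ => rfl, fun _ _ => rfl, fun _ _ => rfl,
      fun x hx => Function.update_of_ne (by simpa [Cmd.writesRarr] using hx) _ _⟩
  | seq _ _ ih₁ ih₂ => exact ih₁.seq_left.trans ih₂.seq_right
  | condTrue _ _ ih => exact ih.cond_left
  | condFalse _ _ ih => exact ih.cond_right
  | loopDone => exact Frame.refl _ _
  | loopStep _ _ _ ih₁ ih₂ => exact ih₁.loop.trans ih₂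
  | maxflow I h =>
    refine ⟨fun _ _ => rfl, fun _ _ => rfl, fun _ _ => rfl, fun x hx => ?_⟩
    simp only [Cmd.writesRarr, List.mem_cons, List.not_mem_nil, or_false, not_or] at hx
    simp [State.writeFlow, hx.1, hx.2]

/-- Total correctness: `c` started in `σ` halts after at most `B` steps, and the final memory and
the list of calls satisfy `Q`. -/
def Runs (R : MaxFlowRoutine) (c : Cmd) (σ : State) (B : ℕ) (Q : State → List Network → Prop) :
    Prop :=
  ∃ τ k l, Exec R c σ τ k l ∧ k ≤ B ∧ Q τ l

section Runs

variable {R : MaxFlowRoutine} {c c₁ c₂ : Cmd} {b : BExp} {σ : State} {B B₁ B₂ X : ℕ}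
  {Q Q₁ : State → List Network → Prop}

theorem Runs.mono (h : Runs R c σ B₁ Q₁) (hB : B₁ ≤ B) (hQ : ∀ τ l, Frame c σ τ → Q₁ τ l → Q τ l) :
    Runs R c σ B Q := by
  obtain ⟨τ, k, l, he, hk, hq⟩ := h
  exact ⟨τ, k, l, he, hk.trans hB, hQ τ l he.frame hq⟩

theorem Runs.seq (h₁ : Runs R c₁ σ B₁ Q₁)
    (h₂ : ∀ τ l, Frame c₁ σ τ → Q₁ τ l → Runs R c₂ τ B₂ (fun υ l' => Q υ (l ++ l'))) :
    Runs R (c₁ ;; c₂) σ (B₁ + B₂) Q := by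
  obtain ⟨τ, k, l, he, hk, hq⟩ := h₁
  obtain ⟨υ, k', l', he', hk', hq'⟩ := h₂ τ l he.frame hq
  exact ⟨υ, _, _, .seq he he', add_le_add hk hk', hq'⟩

theorem Runs.cond (h₁ : b.Holds σ → Runs R c₁ σ B₁ Q) (h₂ : ¬ b.Holds σ → Runs R c₂ σ B₂ Q) :
    Runs R (.cond b c₁ c₂) σ (b.cost + B₁ + B₂) Q := by
  by_cases hb : b.Holds σ
  · obtain ⟨τ, k, l, he, hk, hq⟩ := h₁ hb
    exact ⟨τ, _, _, .condTrue hb he, by omega, hq⟩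
  · obtain ⟨τ, k, l, he, hk, hq⟩ := h₂ hb
    exact ⟨τ, _, _, .condFalse hb he, by omega, hq⟩

/-- Loops: the number `f` bounds the number of remaining iterations. -/
theorem Runs.loop {Inv : ℕ → State → List Network → Prop}
    (step : ∀ f τ l, Inv f τ l → b.Holds τ →
      Runs R c τ B (fun υ l' => ∃ f' < f, Inv f' υ (l ++ l')))
    (f : ℕ) (l₀ : List Network) (h₀ : Inv f σ l₀) :
    Runs R (.loop b c) σ (f * (b.cost + B) + b.cost)
      (fun τ l => ¬ b.Holds τ ∧ ∃ f', Inv f' τ (l₀ ++ l)) := by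
  induction f using Nat.strong_induction_on generalizing σ l₀ with
  | _ f ih =>
    by_cases hb : b.Holds σ
    · obtain ⟨τ, k, l, he, hk, f', hf', hinv⟩ := step f σ l₀ h₀ hb
      obtain ⟨υ, k', l', he', hk', hb', f'', hinv'⟩ := ih f' hf' _ hinv
      refine ⟨υ, _, _, .loopStep hb he he', ?_, hb', f'', by simpa using hinv'⟩
      have : (f' + 1) * (b.cost + B) ≤ f * (b.cost + B) := Nat.mul_le_mul_right _ hf'
      linarith
    · exact ⟨σ, _, _, .loopDone hb, by omega, hb, f, by simpa using h₀⟩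

theorem Cmd.Straight.exec (hc : c.Straight) (σ : State) : ∃ k ≤ c.rate, Exec R c σ (c.sem σ) k [] := by
  induction c generalizing σ with
  | skip => exact ⟨_, le_rfl, .skip σ⟩
  | setI x e => exact ⟨_, le_rfl, .setI σ x e⟩
  | setR x e => exact ⟨_, le_rfl, .setR σ x e⟩
  | storeI a i e => exact ⟨_, le_rfl, .storeI σ a i e⟩
  | storeR a i e => exact ⟨_, le_rfl, .storeR σ a i e⟩
  | seq c₁ c₂ ih₁ ih₂ =>
    obtain ⟨k, hk, he⟩ := ih₁ hc.1 σ
    obtain ⟨k', hk', he'⟩ := ih₂ hc.2 (c₁.sem σ)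
    exact ⟨_, add_le_add hk hk', .seq he he'⟩
  | cond b c₁ c₂ ih₁ ih₂ =>
    by_cases hb : b.Holds σ
    · obtain ⟨k, hk, he⟩ := ih₁ hc.1 σ
      refine ⟨b.cost + k, by simp only [Cmd.rate]; omega, ?_⟩
      simp only [Cmd.sem, if_pos hb]
      exact .condTrue hb he
    · obtain ⟨k, hk, he⟩ := ih₂ hc.2 σ
      refine ⟨b.cost + k, by simp only [Cmd.rate]; omega, ?_⟩
      simp only [Cmd.sem, if_neg hb]
      exact .condFalse hb he
  | loop => exact hc.elim
  | maxflow => exact hc.elim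

/-- `c` halts in a memory that satisfies `Q`, without calls, within the time given by its rate. -/
def Does (R : MaxFlowRoutine) (X : ℕ) (c : Cmd) (σ : State) (Q : State → Prop) : Prop :=
  Runs R c σ (c.rate * X) (fun τ l => l = [] ∧ Q τ)

variable {P P₁ : State → Prop}

theorem Does.mono (h : Does R X c σ P₁) (hP : ∀ τ, Frame c σ τ → P₁ τ → P τ) : Does R X c σ P :=
  Runs.mono h le_rfl fun τ _ hf h => ⟨h.1, hP τ hf h.2⟩

/-- For a straight program only the denotation `Cmd.sem` remains to be evaluated; `1 ≤ X` absorbs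
the factor in the time bound. -/
theorem Does.straight (hX : 1 ≤ X) (hc : c.Straight) (h : P (c.sem σ)) : Does R X c σ P := by
  obtain ⟨k, hk, he⟩ := hc.exec (R := R) σ
  exact ⟨_, k, _, he, hk.trans (Nat.le_mul_of_pos_right _ hX), rfl, h⟩

theorem Does.seq (h₁ : Does R X c₁ σ P₁) (h₂ : ∀ τ, Frame c₁ σ τ → P₁ τ → Does R X c₂ τ P) :
    Does R X (c₁ ;; c₂) σ P := by
  have := Runs.seq (Q := fun τ l => l = [] ∧ P τ) h₁ (B₂ := c₂.rate * X) fun τ l hf h => by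
    obtain ⟨rfl, h⟩ := h
    simpa [Does] using h₂ τ hf h
  simpa [Does, Cmd.rate, add_mul] using this

theorem Does.runs_seq (h₁ : Does R X c₁ σ P₁)
    (h₂ : ∀ τ, Frame c₁ σ τ → P₁ τ → Runs R c₂ τ (c₂.rate * X) Q) :
    Runs R (c₁ ;; c₂) σ ((c₁ ;; c₂).rate * X) Q := by
  have := Runs.seq (Q := Q) h₁ (B₂ := c₂.rate * X) fun τ l hf h => by
    obtain ⟨rfl, h⟩ := h
    simpa using h₂ τ hf h
  simpa [Cmd.rate, add_mul] using this

theorem Runs.seq_does (h₁ : Runs R c₁ σ (c₁.rate * X) Q₁)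
    (h₂ : ∀ τ l, Frame c₁ σ τ → Q₁ τ l → Does R X c₂ τ (fun υ => Q υ l)) :
    Runs R (c₁ ;; c₂) σ ((c₁ ;; c₂).rate * X) Q := by
  have := Runs.seq (Q := Q) h₁ (B₂ := c₂.rate * X) fun τ l hf h =>
    Runs.mono (h₂ τ l hf h) le_rfl fun υ l' _ hl => by simpa [hl.1] using hl.2
  simpa [Cmd.rate, add_mul] using this

theorem Runs.seq_rate (h₁ : Runs R c₁ σ (c₁.rate * X) Q₁)
    (h₂ : ∀ τ l, Frame c₁ σ τ → Q₁ τ l → Runs R c₂ τ (c₂.rate * X) (fun υ l' => Q υ (l ++ l'))) :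
    Runs R (c₁ ;; c₂) σ ((c₁ ;; c₂).rate * X) Q := by
  simpa [Cmd.rate, add_mul] using Runs.seq h₁ h₂

theorem Runs.cond_rate (hX : 1 ≤ X) (h₁ : b.Holds σ → Runs R c₁ σ (c₁.rate * X) Q)
    (h₂ : ¬ b.Holds σ → Runs R c₂ σ (c₂.rate * X) Q) :
    Runs R (.cond b c₁ c₂) σ ((Cmd.cond b c₁ c₂).rate * X) Q := by
  refine (Runs.cond h₁ h₂).mono ?_ fun _ _ _ h => h
  have : b.cost ≤ b.cost * X := Nat.le_mul_of_pos_right _ hX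
  simp only [Cmd.rate, add_mul]
  omega

theorem Does.cond (hX : 1 ≤ X) (h₁ : b.Holds σ → Does R X c₁ σ P)
    (h₂ : ¬ b.Holds σ → Does R X c₂ σ P) : Does R X (.cond b c₁ c₂) σ P :=
  Runs.cond_rate hX h₁ h₂

/-- A loop with a straight body; `f` bounds the number of remaining iterations. -/
theorem Does.loop (hX : 1 ≤ X) (hc : c.Straight) (Inv : ℕ → State → Prop) {f : ℕ} (hf : f ≤ 8 * X)
    (h₀ : Inv f σ)
    (step : ∀ f τ, Frame c σ τ → Inv f τ → b.Holds τ → ∃ f' < f, Inv f' (c.sem τ)) :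
    Does R X (.loop b c) σ (fun τ => ¬ b.Holds τ ∧ ∃ f', Inv f' τ) := by
  have := Runs.loop (R := R) (b := b) (c := c) (σ := σ) (B := c.rate)
    (Inv := fun f τ l => l = [] ∧ Frame c σ τ ∧ Inv f τ) (fun f τ l h hb => by
      obtain ⟨k, hk, he⟩ := hc.exec (R := R) τ
      obtain ⟨f', hf', h'⟩ := step f τ h.2.1 h.2.2 hb
      exact ⟨_, k, _, he, hk, f', hf', by simp [h.1], h.2.1.trans he.frame, h'⟩) f []
      ⟨rfl, Frame.refl _ _, h₀⟩
  refine this.mono ?_ fun τ l _ h => ?_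
  · simp only [Cmd.rate]
    have h1 := Nat.mul_le_mul_right (b.cost + c.rate) hf
    have h2 : b.cost ≤ b.cost * X := Nat.le_mul_of_pos_right _ hX
    calc _ ≤ 8 * X * (b.cost + c.rate) + b.cost * X := by omega
      _ = _ := by ring
  · obtain ⟨hb, f', hl, -, hi⟩ := h
    exact ⟨by simpa using hl, hb, _, hi⟩

/-- `for x from e while x < y do c`, where `x` and `y` are integer variables. -/
def Cmd.upto (x : ℕ) (e : IExp) (y : ℕ) (c : Cmd) : Cmd :=
  .setI x e ;; .loop (.ltI (.var x) (.var y)) (c ;; .setI x (.succ (.var x)))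

/-- The invariant is indexed by the counter, and the number of values still to be counted is the
termination measure. The body writes neither the counter nor the bound, so the counter ends exactly
at `N`. -/
theorem Does.upto {x y : ℕ} {e : IExp} (hX : 1 ≤ X) (hc : c.Straight) (Inv : ℕ → State → Prop)
    {j₀ N : ℕ} (he : e.eval σ = j₀) (hN : σ.ivar y = N) (hjN : j₀ ≤ N) (hNX : N ≤ 8 * X)
    (hx : x ∉ c.writesIvar) (hy : y ∉ c.writesIvar) (hxy : y ≠ x)
    (h₀ : Inv j₀ { σ with ivar := Function.update σ.ivar x j₀ })
    (step : ∀ j τ, Frame (Cmd.upto x e y c) σ τ → τ.ivar x = j → j₀ ≤ j → j < N → Inv j τ →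
      Inv (j + 1) ((c ;; .setI x (.succ (.var x))).sem τ)) :
    Does R X (Cmd.upto x e y c) σ (fun τ => τ.ivar x = N ∧ Inv N τ) := by
  set σ₁ : State := { σ with ivar := Function.update σ.ivar x j₀ } with hσ₁
  have hfr : ∀ τ, Frame (c ;; .setI x (.succ (.var x))) σ₁ τ → Frame (Cmd.upto x e y c) σ τ := by
    intro τ h
    have h1 : Frame (.setI x e) σ σ₁ := by
      have := (Exec.setI (R := R) σ x e).frame
      rwa [he] at this
    exact h1.seq_left.trans (Frame.seq_right h.loop)
  refine Does.seq (P₁ := fun τ => τ = σ₁) (Does.straight hX trivial (by simp [Cmd.sem, he, hσ₁])) ?_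
  rintro _ - rfl
  refine Does.mono (Does.loop hX (c := c ;; .setI x (.succ (.var x))) ⟨hc, trivial⟩
    (fun f τ => ∃ j, f = N - j ∧ j₀ ≤ j ∧ j ≤ N ∧ τ.ivar x = j ∧ Inv j τ) (f := N - j₀) (by omega)
    ⟨j₀, rfl, le_rfl, hjN, by simp [hσ₁], h₀⟩ ?_) ?_
  · rintro f τ hf ⟨j, rfl, hj0, hjN', hxj, hinv⟩ hb
    have hyN : τ.ivar y = N := by
      rw [hf.ivar y (by simp [Cmd.writesIvar, hy, hxy])]
      simp [hσ₁, hxy, hN]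
    have hlt : j < N := by
      simpa [BExp.Holds, IExp.eval, hxj, hyN] using hb
    refine ⟨N - (j + 1), by omega, j + 1, rfl, by omega, hlt, ?_,
      step j τ (hfr τ hf) hxj hj0 hlt hinv⟩
    obtain ⟨k, hk, he⟩ := hc.exec (R := R) τ
    have := he.frame.ivar x hx
    simp [Cmd.sem, IExp.eval, this, hxj]
  · rintro τ hf ⟨hb, f, j, rfl, hj0, hjN', hxj, hinv⟩
    have hyN : τ.ivar y = N := by
      rw [hf.of_loop.ivar y (by simp [Cmd.writesIvar, hy, hxy])]
      simp [hσ₁, hxy, hN]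
    have hlt : ¬ j < N := by
      simpa [BExp.Holds, IExp.eval, hxj, hyN] using hb
    obtain rfl : j = N := by omega
    exact ⟨hxj, hinv⟩

end Runs

end MaxFlowVitality

/-! ### Networks in memory and merging of parallel arcs. -/

namespace MaxFlowVitality

open Finset

/-- Connectivity in terms of two-valued functions that are constant along arcs. This form passes to
contractions by composition with the node map. -/
theorem Network.apply_eq_of_forall_arc (I : Network) {D : ℕ → Bool}
    (h : ∀ i, D (I.tail i) = D (I.head i)) (x y : Fin I.n) : D x = D y := by
  obtain ⟨p⟩ := I.connected.preconnected x y
  induction p with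
  | nil => rfl
  | cons hadj _ ih =>
    rw [← ih]
    rw [SimpleGraph.fromEdgeSet_adj] at hadj
    obtain ⟨⟨i, hi⟩, -⟩ := hadj
    rcases Sym2.eq_iff.1 hi with ⟨rfl, rfl⟩ | ⟨rfl, rfl⟩
    · exact h i
    · exact (h i).symm

section Stored

variable {L : Layout} {I : Network} {σ τ : State}

theorem Stored.tail_lt (h : Stored L I σ) {i : ℕ} (hi : i < I.m) : σ.iarr L.tail i < I.n := by
  rw [h.tail ⟨i, hi⟩]; exact Fin.is_lt _

theorem Stored.head_lt (h : Stored L I σ) {i : ℕ} (hi : i < I.m) : σ.iarr L.head i < I.n := by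
  rw [h.head ⟨i, hi⟩]; exact Fin.is_lt _

theorem Stored.loopless (h : Stored L I σ) {i : ℕ} (hi : i < I.m) :
    σ.iarr L.tail i ≠ σ.iarr L.head i := by
  rw [h.tail ⟨i, hi⟩, h.head ⟨i, hi⟩]
  exact fun hh => I.loopless ⟨i, hi⟩ (Fin.ext hh)

theorem Stored.simple (h : Stored L I σ) {i j : ℕ} (hi : i < I.m) (hj : j < I.m)
    (hij : s(σ.iarr L.tail i, σ.iarr L.head i) = s(σ.iarr L.tail j, σ.iarr L.head j)) : i = j := by
  rw [h.tail ⟨i, hi⟩, h.head ⟨i, hi⟩, h.tail ⟨j, hj⟩, h.head ⟨j, hj⟩] at hij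
  have : (⟨i, hi⟩ : Fin I.m) = ⟨j, hj⟩ := by
    refine I.simple ?_
    simpa [Sym2.eq_iff, Fin.ext_iff] using hij
  simpa using this

theorem Stored.cap_nonneg (h : Stored L I σ) {i : ℕ} (hi : i < I.m) : 0 ≤ σ.rarr L.cap i := by
  rw [h.cap ⟨i, hi⟩]; exact I.cap_nonneg _

theorem Stored.cutCap (h : Stored L I σ) (D : ℕ → Bool) :
    I.cutCap D = ∑ i ∈ range I.m,
      if D (σ.iarr L.tail i) = D (σ.iarr L.head i) then 0 else σ.rarr L.cap i := by
  rw [Finset.sum_range]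
  exact Finset.sum_congr rfl fun i _ => by rw [h.tail, h.head, h.cap]

theorem Stored.of_eq (h : Stored L I σ) (h₁ : ∀ x ∈ [L.n, L.m, L.s, L.t], τ.ivar x = σ.ivar x)
    (h₂ : ∀ x ∈ [L.tail, L.head], τ.iarr x = σ.iarr x) (h₃ : τ.rarr L.cap = σ.rarr L.cap) :
    Stored L I τ := by
  simp only [List.mem_cons, List.not_mem_nil, or_false, forall_eq_or_imp, forall_eq] at h₁ h₂
  exact ⟨h₁.1.trans h.n, h₁.2.1.trans h.m, h₁.2.2.1.trans h.s, h₁.2.2.2.trans h.t,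
    fun i => (congrFun h₂.1 i).trans (h.tail i), fun i => (congrFun h₂.2 i).trans (h.head i),
    fun i => (congrFun h₃ i).trans (h.cap i)⟩

theorem Stored.frame {c : Cmd} (h : Stored L I σ) (hf : Frame c σ τ)
    (h₁ : ∀ x ∈ [L.n, L.m, L.s, L.t], x ∉ c.writesIvar)
    (h₂ : ∀ x ∈ [L.tail, L.head], x ∉ c.writesIarr) (h₃ : L.cap ∉ c.writesRarr) : Stored L I τ :=
  h.of_eq (fun x hx => hf.ivar x (h₁ x hx)) (fun x hx => hf.iarr x (h₂ x hx)) (hf.rarr _ h₃)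

/-- Memory that satisfies the requirements on a network stores one. -/
theorem exists_stored (L : Layout) (σ : State)
    (htail : ∀ i < σ.ivar L.m, σ.iarr L.tail i < σ.ivar L.n)
    (hhead : ∀ i < σ.ivar L.m, σ.iarr L.head i < σ.ivar L.n)
    (hcap : ∀ i < σ.ivar L.m, 0 ≤ σ.rarr L.cap i)
    (hs : σ.ivar L.s < σ.ivar L.n) (ht : σ.ivar L.t < σ.ivar L.n) (hst : σ.ivar L.s ≠ σ.ivar L.t)
    (hloop : ∀ i < σ.ivar L.m, σ.iarr L.tail i ≠ σ.iarr L.head i)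
    (hsimple : ∀ i < σ.ivar L.m, ∀ j < σ.ivar L.m,
      s(σ.iarr L.tail i, σ.iarr L.head i) = s(σ.iarr L.tail j, σ.iarr L.head j) → i = j)
    (hconn : ∀ D : ℕ → Bool, (∀ i < σ.ivar L.m, D (σ.iarr L.tail i) = D (σ.iarr L.head i)) →
      ∀ x < σ.ivar L.n, ∀ y < σ.ivar L.n, D x = D y) :
    ∃ J : Network, Stored L J σ := by
  classical
  refine ⟨{ n := σ.ivar L.n, m := σ.ivar L.m,
            tail := fun i => ⟨_, htail i i.2⟩, head := fun i => ⟨_, hhead i i.2⟩,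
            cap := fun i => σ.rarr L.cap i, s := ⟨_, hs⟩, t := ⟨_, ht⟩,
            cap_nonneg := fun i => hcap i i.2,
            s_ne_t := fun h => hst (congrArg Fin.val h),
            loopless := fun i h => hloop i i.2 (congrArg Fin.val h),
            simple := fun i j hij => Fin.ext (hsimple i i.2 j j.2 ?_),
            connected := ?_ },
          ⟨rfl, rfl, rfl, rfl, fun _ => rfl, fun _ => rfl, fun _ => rfl⟩⟩
  · simpa [Sym2.eq_iff] using hij
  · have : Nonempty (Fin (σ.ivar L.n)) := ⟨⟨_, hs⟩⟩
    refine ⟨fun x y => ?_⟩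
    set G := SimpleGraph.fromEdgeSet (Set.range fun i : Fin (σ.ivar L.m) =>
      s((⟨_, htail i i.2⟩ : Fin (σ.ivar L.n)), ⟨_, hhead i i.2⟩)) with hG
    have hadj : ∀ i (hi : i < σ.ivar L.m), G.Adj ⟨_, htail i hi⟩ ⟨_, hhead i hi⟩ := by
      intro i hi
      rw [hG, SimpleGraph.fromEdgeSet_adj]
      exact ⟨⟨⟨i, hi⟩, rfl⟩, fun h => hloop i hi (congrArg Fin.val h)⟩
    -- The hypothesis is tested on the indicator of the nodes reachable from `x`, which is constant
    -- along arcs.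
    have := hconn (fun z => decide (∃ hz : z < σ.ivar L.n, G.Reachable x ⟨z, hz⟩)) (fun i hi => by
      rw [decide_eq_decide]
      constructor
      · rintro ⟨hz, h⟩
        exact ⟨hhead i hi, h.trans (hadj i hi).reachable⟩
      · rintro ⟨hz, h⟩
        exact ⟨htail i hi, h.trans (hadj i hi).symm.reachable⟩) x x.2 y y.2
    rw [decide_eq_decide] at this
    exact (this.1 ⟨x.2, SimpleGraph.Reachable.refl _⟩).2

end Stored

/-- The node map that identifies `lo` with `hi` and closes the gap in the numbering; it is the
identity below `n` if `hi = n`. -/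
def squash (lo hi x : ℕ) : ℕ := if x = hi then lo else if hi < x then x - 1 else x

/-- The arcs `0, …, j - 1` of a graph with ends `T`, `H` and capacities `c`, mapped by `ρ`, without
loops and with arcs at `lo` merged, are the arcs `0, …, k - 1` of `tl`, `hd`, `cp`; `pos` tells the
arc from `lo` to each node, shifted by one. The arcs from `j` on are still in place. -/
structure MergeInv (n n' m lo : ℕ) (ρ T H : ℕ → ℕ) (c : ℕ → ℝ) (j k : ℕ) (tl hd pos : ℕ → ℕ)
    (cp : ℕ → ℝ) : Prop where
  le : k ≤ j
  rest : ∀ i, j ≤ i → i < m → tl i = T i ∧ hd i = H i ∧ cp i = c i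
  arc : ∀ i < k, tl i < n' ∧ hd i < n' ∧ tl i ≠ hd i ∧ 0 ≤ cp i
  simple : ∀ i < k, ∀ i' < k, s(tl i, hd i) = s(tl i', hd i') → i = i'
  cut : ∀ D : ℕ → Bool, (∑ i ∈ range k, if D (tl i) = D (hd i) then 0 else cp i) =
    ∑ i ∈ range j, if D (ρ (T i)) = D (ρ (H i)) then 0 else c i
  conn : ∀ D : ℕ → Bool, (∀ i < k, D (tl i) = D (hd i)) → ∀ i < j, D (ρ (T i)) = D (ρ (H i))
  pos_le : ∀ x < n, pos x ≤ k
  pos_arc : ∀ x < n, pos x ≠ 0 → s(tl (pos x - 1), hd (pos x - 1)) = s(lo, x)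
  pos_ne : ∀ x < n, ∀ i < k, s(tl i, hd i) = s(lo, x) → pos x ≠ 0
  source : ∀ i < k, lo ∉ s(tl i, hd i) → ∃ i' < j, tl i = ρ (T i') ∧ hd i = ρ (H i')

section MergeInv

variable {n n' m lo j k : ℕ} {ρ T H tl hd pos : ℕ → ℕ} {c cp : ℕ → ℝ}

theorem MergeInv.init (hpos : ∀ x < n, pos x = 0) :
    MergeInv n n' m lo ρ T H c 0 0 T H pos c where
  le := le_rfl
  rest := fun _ _ _ => ⟨rfl, rfl, rfl⟩
  arc := by simp
  simple := by simp
  cut := by simp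
  conn := by simp
  pos_le := fun x hx => (hpos x hx).le
  pos_arc := fun x hx h => absurd (hpos x hx) h
  pos_ne := by simp
  source := by simp

/-- An arc whose ends are identified crosses no cut, so it can be dropped. -/
theorem MergeInv.skip (h : MergeInv n n' m lo ρ T H c j k tl hd pos cp)
    (hj : ρ (T j) = ρ (H j)) : MergeInv n n' m lo ρ T H c (j + 1) k tl hd pos cp where
  le := h.le.trans (Nat.le_succ j)
  rest := fun i hi => h.rest i (by omega)
  arc := h.arc
  simple := h.simple
  cut := fun D => by rw [h.cut D, Finset.sum_range_succ]; simp [hj]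
  conn := fun D hD i hi => by
    rcases Nat.lt_succ_iff_lt_or_eq.1 hi with hi | rfl
    · exact h.conn D hD i hi
    · rw [hj]
  pos_le := h.pos_le
  pos_arc := h.pos_arc
  pos_ne := h.pos_ne
  source := fun i hi hlo => by
    obtain ⟨i', hi', h'⟩ := h.source i hi hlo
    exact ⟨i', by omega, h'⟩

/-- Parallel arcs are separated by the same cuts, so adding their capacities preserves every cut
capacity. -/
theorem MergeInv.merge (h : MergeInv n n' m lo ρ T H c j k tl hd pos cp) {x : ℕ} (hx : x < n)
    (hpos : pos x ≠ 0) (hj : s(ρ (T j), ρ (H j)) = s(lo, x)) (hc : 0 ≤ c j) :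
    MergeInv n n' m lo ρ T H c (j + 1) k tl hd pos
      (Function.update cp (pos x - 1) (cp (pos x - 1) + c j)) := by
  have hk := h.pos_le x hx
  have hkj := h.le
  have hq : pos x - 1 < k := by omega
  have hedge := (h.pos_arc x hx hpos).trans hj.symm
  have hD : ∀ D : ℕ → Bool, D (tl (pos x - 1)) = D (hd (pos x - 1)) ↔ D (ρ (T j)) = D (ρ (H j)) := by
    intro D
    rcases Sym2.eq_iff.1 hedge with ⟨h1, h2⟩ | ⟨h1, h2⟩
    · rw [h1, h2]
    · rw [h1, h2, eq_comm]
  refine ⟨h.le.trans (Nat.le_succ j), fun i hi him => ?_, fun i hi => ?_, h.simple, fun D => ?_,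
    fun D hD' i hi => ?_, h.pos_le, h.pos_arc, h.pos_ne, fun i hi hlo => ?_⟩
  · rw [Function.update_of_ne (by omega)]
    exact h.rest i (by omega) him
  · obtain ⟨h1, h2, h3, h4⟩ := h.arc i hi
    refine ⟨h1, h2, h3, ?_⟩
    by_cases hi' : i = pos x - 1
    · subst hi'; rw [Function.update_self]; exact add_nonneg h4 hc
    · rwa [Function.update_of_ne hi']
  · rw [Finset.sum_range_succ, ← h.cut D]
    have : ∀ i ∈ range k, (if D (tl i) = D (hd i) then 0 else
        Function.update cp (pos x - 1) (cp (pos x - 1) + c j) i) =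
        (if D (tl i) = D (hd i) then 0 else cp i) +
          if i = pos x - 1 then (if D (ρ (T j)) = D (ρ (H j)) then 0 else c j) else 0 := by
      intro i _
      by_cases hi : i = pos x - 1
      · subst hi
        simp only [hD D, Function.update_self, if_true]
        split_ifs <;> simp
      · simp [hi]
    rw [Finset.sum_congr rfl this, Finset.sum_add_distrib, Finset.sum_ite_eq' (range k)]
    simp [hq]
  · rcases Nat.lt_succ_iff_lt_or_eq.1 hi with hi | rfl
    · exact h.conn D hD' i hi
    · exact (hD D).1 (hD' _ hq)
  · obtain ⟨i', hi', h'⟩ := h.source i hi hlo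
    exact ⟨i', by omega, h'⟩

/-- For an arc at `lo`, `x` is its other end and `pos x` records the new arc. For an arc away from
`lo`, `x` is at least `n` and the entry written is a dummy: no lookup is needed, because by `hinj`
such an arc is not parallel to an earlier one. -/
theorem MergeInv.append (h : MergeInv n n' m lo ρ T H c j k tl hd pos cp) {x : ℕ}
    (hTn : ρ (T j) < n') (hHn : ρ (H j) < n')
    (hne : ρ (T j) ≠ ρ (H j)) (hc : 0 ≤ c j)
    (hx : (x < n ∧ pos x = 0 ∧ s(ρ (T j), ρ (H j)) = s(lo, x)) ∨
      (n ≤ x ∧ lo ∉ s(ρ (T j), ρ (H j))))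
    (hinj : ∀ i < j, lo ∉ s(ρ (T j), ρ (H j)) → s(ρ (T i), ρ (H i)) ≠ s(ρ (T j), ρ (H j))) :
    MergeInv n n' m lo ρ T H c (j + 1) (k + 1) (Function.update tl k (ρ (T j)))
      (Function.update hd k (ρ (H j))) (Function.update pos x (k + 1))
      (Function.update cp k (c j)) := by
  have hkj := h.le
  have hup : ∀ i < k, Function.update tl k (ρ (T j)) i = tl i ∧
      Function.update hd k (ρ (H j)) i = hd i ∧ Function.update cp k (c j) i = cp i := fun i hi => by
    simp [hi.ne]
  have hnew : ∀ i < k, s(tl i, hd i) ≠ s(ρ (T j), ρ (H j)) := by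
    intro i hi he
    rcases hx with ⟨hxn, hp, hs⟩ | ⟨-, hlo⟩
    · exact h.pos_ne x hxn i hi (he.trans hs) hp
    · obtain ⟨i', hi', h1, h2⟩ := h.source i hi (by rwa [he])
      exact hinj i' hi' hlo (by rw [← h1, ← h2, he])
  refine ⟨by omega, fun i hi him => ?_, fun i hi => ?_, fun i hi i' hi' he => ?_, fun D => ?_,
    fun D hD i hi => ?_, fun y hy => ?_, fun y hy hp => ?_, fun y hy i hi he => ?_,
    fun i hi hlo => ?_⟩
  · rw [Function.update_of_ne (by omega), Function.update_of_ne (by omega),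
      Function.update_of_ne (by omega)]
    exact h.rest i (by omega) him
  · rcases Nat.lt_succ_iff_lt_or_eq.1 hi with hi | rfl
    · obtain ⟨h1, h2, h3⟩ := hup i hi
      rw [h1, h2, h3]
      exact h.arc i hi
    · simpa using ⟨hTn, hHn, hne, hc⟩
  · rcases Nat.lt_succ_iff_lt_or_eq.1 hi with hi | rfl <;>
      rcases Nat.lt_succ_iff_lt_or_eq.1 hi' with hi' | rfl
    · rw [(hup i hi).1, (hup i hi).2.1, (hup i' hi').1, (hup i' hi').2.1] at he
      exact h.simple i hi i' hi' he
    · rw [(hup i hi).1, (hup i hi).2.1, Function.update_self, Function.update_self] at he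
      exact absurd he (hnew i hi)
    · rw [(hup i' hi').1, (hup i' hi').2.1, Function.update_self, Function.update_self] at he
      exact absurd he.symm (hnew i' hi')
    · rfl
  · rw [Finset.sum_range_succ, Finset.sum_range_succ, ← h.cut D]
    congr 1
    · refine Finset.sum_congr rfl fun i hi => ?_
      obtain ⟨h1, h2, h3⟩ := hup i (by simpa using hi)
      rw [h1, h2, h3]
    · simp
  · rcases Nat.lt_succ_iff_lt_or_eq.1 hi with hi | rfl
    · refine h.conn D (fun i hi => ?_) i hi
      obtain ⟨h1, h2, -⟩ := hup i hi
      rw [← h1, ← h2]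
      exact hD i (by omega)
    · simpa using hD k (by omega)
  · by_cases hyx : y = x
    · subst hyx; simp
    · rw [Function.update_of_ne hyx]
      exact (h.pos_le y hy).trans (Nat.le_succ k)
  · by_cases hyx : y = x
    · subst hyx
      rcases hx with ⟨-, -, hs⟩ | ⟨hle, -⟩
      · simpa using hs
      · omega
    · rw [Function.update_of_ne hyx] at hp ⊢
      have := h.pos_le y hy
      rw [(hup _ (by omega)).1, (hup _ (by omega)).2.1]
      exact h.pos_arc y hy hp
  · by_cases hyx : y = x
    · subst hyx; simp
    · rw [Function.update_of_ne hyx]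
      rcases Nat.lt_succ_iff_lt_or_eq.1 hi with hi | rfl
      · rw [(hup i hi).1, (hup i hi).2.1] at he
        exact h.pos_ne y hy i hi he
      · rw [Function.update_self, Function.update_self] at he
        rcases hx with ⟨-, -, hs⟩ | ⟨-, hlo⟩
        · rw [hs] at he
          simp only [Sym2.eq_iff, true_and] at he
          omega
        · rw [he] at hlo
          simp at hlo
  · rcases Nat.lt_succ_iff_lt_or_eq.1 hi with hi | rfl
    · rw [(hup i hi).1, (hup i hi).2.1] at hlo ⊢
      obtain ⟨i', hi', h'⟩ := h.source i hi hlo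
      exact ⟨i', by omega, h'⟩
    · exact ⟨j, Nat.lt_succ_self j, by simp⟩

end MergeInv

end MaxFlowVitality

/-! ### Contraction of a node into a terminal. -/

namespace MaxFlowVitality

open Finset

theorem squash_lt {n lo hi x : ℕ} (hlo : lo < hi) (hhi : hi ≤ n) (hx : x < n) :
    squash lo hi x < if hi = n then n else n - 1 := by
  unfold squash; split_ifs <;> omega

theorem squash_lo {lo hi : ℕ} (hlo : lo < hi) : squash lo hi lo = lo := by
  unfold squash; split_ifs <;> omega

theorem squash_hi {lo hi : ℕ} : squash lo hi hi = lo := by simp [squash]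

theorem squash_inj {lo hi x y : ℕ} (hlo : lo < hi) (h : squash lo hi x = squash lo hi y) :
    x = y ∨ (x = lo ∧ y = hi) ∨ (x = hi ∧ y = lo) := by
  unfold squash at h; split_ifs at h <;> omega

theorem exists_squash {n lo hi y : ℕ} (hhi : hi ≤ n)
    (hy : y < if hi = n then n else n - 1) : ∃ x < n, squash lo hi x = y := by
  unfold squash
  rcases lt_or_ge y hi with h | h
  · exact ⟨y, by split_ifs at hy <;> omega, by split_ifs <;> omega⟩
  · exact ⟨y + 1, by split_ifs at hy <;> omega, by split_ifs <;> omega⟩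

/-- `J` is obtained from `I` by merging the node `u` into `s` and exchanging the terminals; the
nodes are renamed by `ρ`. -/
structure Contracts (I J : Network) (ρ : ℕ → ℕ) (u : ℕ) : Prop where
  n_le : J.n ≤ I.n
  m_le : J.m ≤ I.m
  lt : ∀ x < I.n, ρ x < J.n
  cut : ∀ D : ℕ → Bool, J.cutCap D = I.cutCap fun x => D (ρ x)
  factor : ∀ D : ℕ → Bool, D u = D I.s → ∃ E : ℕ → Bool, ∀ x < I.n, E (ρ x) = D x
  s_eq : (J.s : ℕ) = ρ I.t
  t_eq : (J.t : ℕ) = ρ I.s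
  map_u : ρ u = ρ I.s

/-- Where the network under contraction is stored. -/
def workLayout : Layout where
  n := 4
  m := 5
  s := 6
  t := 7
  tail := 2
  head := 3
  cap := 2

/-- Choose the pair `lo < hi` (variables `9`, `10`) to be identified and the new number of nodes
(variable `11`); nothing is identified if the node in variable `8` is `s`. -/
def choosePair : Cmd :=
  .cond (.eqI (.var 8) (.var 6))
    (.setI 9 (.var 6) ;; .setI 10 (.var 4) ;; .setI 11 (.var 4))
    (.setI 11 (.pred (.var 4)) ;;
      .cond (.ltI (.var 8) (.var 6)) (.setI 9 (.var 8) ;; .setI 10 (.var 6))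
        (.setI 9 (.var 6) ;; .setI 10 (.var 8)))

/-- Tabulate the node map in array `4` and clear array `5`. -/
def tabulateSquash : Cmd :=
  .upto 12 (.lit 0) 4
    (.cond (.eqI (.var 12) (.var 10)) (.storeI 4 (.var 12) (.var 9))
      (.cond (.ltI (.var 10) (.var 12)) (.storeI 4 (.var 12) (.pred (.var 12)))
        (.storeI 4 (.var 12) (.var 12))) ;;
    .storeI 5 (.var 12) (.lit 0))

/-- Map the arcs in place and merge parallel ones; variable `13` counts the new arcs. -/
def mergeArcs : Cmd :=
  .upto 12 (.lit 0) 5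
    (.setI 14 (.read 4 (.read 2 (.var 12))) ;; .setI 15 (.read 4 (.read 3 (.var 12))) ;;
    .cond (.eqI (.var 14) (.var 15)) .skip
      (.cond (.eqI (.var 14) (.var 9)) (.setI 16 (.var 15))
        (.cond (.eqI (.var 15) (.var 9)) (.setI 16 (.var 14)) (.setI 16 (.var 4))) ;;
      .cond (.and (.ltI (.var 16) (.var 4)) (.not (.eqI (.read 5 (.var 16)) (.lit 0))))
        (.storeR 2 (.pred (.read 5 (.var 16)))
          (.add (.read 2 (.pred (.read 5 (.var 16)))) (.read 2 (.var 12))))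
        (.storeI 2 (.var 13) (.var 14) ;; .storeI 3 (.var 13) (.var 15) ;;
          .storeR 2 (.var 13) (.read 2 (.var 12)) ;; .setI 13 (.succ (.var 13)) ;;
          .storeI 5 (.var 16) (.var 13))))

/-- Compose the table `6` of all contractions so far with the current one. -/
def composeMap : Cmd :=
  .upto 12 (.lit 0) 0 (.storeI 6 (.var 12) (.read 4 (.read 6 (.var 12))))

/-- Store the new counts and terminals. -/
def finishContract : Cmd :=
  .setI 4 (.var 11) ;; .setI 5 (.var 13) ;; .setI 14 (.read 4 (.var 7)) ;;
  .setI 7 (.read 4 (.var 6)) ;; .setI 6 (.var 14)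

/-- Merge the node in variable `8` into `s` and exchange the terminals. -/
def contract : Cmd :=
  choosePair ;; tabulateSquash ;; .setI 13 (.lit 0) ;; mergeArcs ;; composeMap ;; finishContract

variable {R : MaxFlowRoutine} {X : ℕ} {σ : State} {I : Network}

theorem choosePair_does (hX : 1 ≤ X) (h : Stored workLayout I σ) (hu : σ.ivar 8 < I.n) :
    Does R X choosePair σ fun τ => τ.ivar 9 < τ.ivar 10 ∧ τ.ivar 10 ≤ I.n ∧
      τ.ivar 11 = (if τ.ivar 10 = I.n then I.n else I.n - 1) ∧
      ((σ.ivar 8 = I.s ∧ τ.ivar 9 = I.s ∧ τ.ivar 10 = I.n) ∨ (τ.ivar 9 = I.s ∧ τ.ivar 10 = σ.ivar 8)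
        ∨ (τ.ivar 9 = σ.ivar 8 ∧ τ.ivar 10 = I.s)) := by
  refine Does.straight hX (by simp [choosePair, Cmd.Straight]) ?_
  have hn : σ.ivar 4 = I.n := h.n
  have hs : σ.ivar 6 = I.s := h.s
  have hsn := I.s.2
  simp only [choosePair, Cmd.sem, BExp.Holds, IExp.eval]
  split_ifs <;> simp [hn, hs] <;> split_ifs <;> simp_all <;> omega

theorem tabulateSquash_does (hX : 1 ≤ X) (hn : σ.ivar 4 ≤ 8 * X) :
    Does R X tabulateSquash σ fun τ => ∀ x < σ.ivar 4,
      τ.iarr 4 x = squash (σ.ivar 9) (σ.ivar 10) x ∧ τ.iarr 5 x = 0 := by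
  refine Does.mono (Does.upto (j₀ := 0) hX (by simp [Cmd.Straight])
    (fun j τ => ∀ x < j, τ.iarr 4 x = squash (σ.ivar 9) (σ.ivar 10) x ∧ τ.iarr 5 x = 0)
    rfl rfl (Nat.zero_le _) hn (by decide) (by decide) (by decide) (by simp) ?_) ?_
  · intro j τ hf hj _ hjn hinv x hx
    have h9 := hf.ivar 9 (by decide)
    have h10 := hf.ivar 10 (by decide)
    simp only [Cmd.sem, BExp.Holds, IExp.eval, hj, h9, h10, squash]
    have := hinv x
    simp only [squash] at this
    by_cases hxj : x = j
    · subst hxj; split_ifs <;> simp [hj]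
    · have := this (by omega)
      split_ifs <;> simp_all
  · exact fun τ _ h => h.2

theorem composeMap_does (hX : 1 ≤ X) (hn : σ.ivar 0 ≤ 8 * X) :
    Does R X composeMap σ fun τ => ∀ x < σ.ivar 0, τ.iarr 6 x = σ.iarr 4 (σ.iarr 6 x) := by
  refine Does.mono (Does.upto (j₀ := 0) hX (by simp [Cmd.Straight])
    (fun j τ => (∀ x < j, τ.iarr 6 x = σ.iarr 4 (σ.iarr 6 x)) ∧ ∀ x, j ≤ x → τ.iarr 6 x = σ.iarr 6 x)
    rfl rfl (Nat.zero_le _) hn (by decide) (by decide) (by decide) (by simp) ?_) ?_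
  · intro j τ hf hj _ hjn hinv
    have h4 := hf.iarr 4 (by decide)
    simp only [Cmd.sem, IExp.eval, hj, h4, Function.update_self]
    refine ⟨fun x hx => ?_, fun x hx => ?_⟩
    · by_cases hxj : x = j
      · subst hxj; simp [hinv.2]
      · simp [hxj, hinv.1 x (by omega)]
    · rw [Function.update_of_ne (by omega)]
      exact hinv.2 x (by omega)
  · exact fun τ _ h => h.2.1

/-- One pass in place: the write index never overtakes the read index (`MergeInv.le`), so arc `j` is
intact when it is read. The branches of the body are `MergeInv.skip`, `MergeInv.merge` and
`MergeInv.append`. -/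
theorem mergeArcs_does (hX : 1 ≤ X) (h : Stored workLayout I σ) (hm : I.m ≤ 8 * X)
    {lo hi n' : ℕ} (hlo : σ.ivar 9 = lo) (hlohi : lo < hi) (hhi : hi ≤ I.n)
    (hn' : n' = if hi = I.n then I.n else I.n - 1)
    (hρ : ∀ x < I.n, σ.iarr 4 x = squash lo hi x) (hpos : ∀ x < I.n, σ.iarr 5 x = 0)
    (h13 : σ.ivar 13 = 0) :
    Does R X mergeArcs σ fun τ => MergeInv I.n n' I.m lo (squash lo hi) (σ.iarr 2) (σ.iarr 3)
      (σ.rarr 2) I.m (τ.ivar 13) (τ.iarr 2) (τ.iarr 3) (τ.iarr 5) (τ.rarr 2) := by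
  have hn4 : σ.ivar 4 = I.n := h.n
  have hm5 : σ.ivar 5 = I.m := h.m
  refine Does.mono (Does.upto (j₀ := 0) hX (by simp [Cmd.Straight])
    (fun j τ => MergeInv I.n n' I.m lo (squash lo hi) (σ.iarr 2) (σ.iarr 3)
      (σ.rarr 2) j (τ.ivar 13) (τ.iarr 2) (τ.iarr 3) (τ.iarr 5) (τ.rarr 2))
    rfl hm5 (Nat.zero_le _) hm (by decide) (by decide) (by decide) ?_ ?_) ?_
  · simpa [h13] using MergeInv.init hpos
  · intro j τ hf hj _ hjm hinv
    have h9 := hf.ivar 9 (by decide)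
    have h4 := hf.ivar 4 (by decide)
    have ha4 := hf.iarr 4 (by decide)
    rw [hlo] at h9
    rw [hn4] at h4
    obtain ⟨r1, r2, r3⟩ := hinv.rest j le_rfl hjm
    have hT : σ.iarr 2 j < I.n := h.tail_lt hjm
    have hH : σ.iarr 3 j < I.n := h.head_lt hjm
    have hc : 0 ≤ σ.rarr 2 j := h.cap_nonneg hjm
    have hTn := hn' ▸ squash_lt hlohi hhi hT
    have hHn := hn' ▸ squash_lt hlohi hhi hH
    have hn'n : n' ≤ I.n := by rw [hn']; split_ifs <;> omega
    -- Away from the fibre of `lo` the node map is injective, so arcs with equal images there would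
    -- already be parallel in `I`. Only arcs at `lo` can become parallel.
    have hinj : ∀ i < j, lo ∉ s(squash lo hi (σ.iarr 2 j), squash lo hi (σ.iarr 3 j)) →
        s(squash lo hi (σ.iarr 2 i), squash lo hi (σ.iarr 3 i)) ≠
          s(squash lo hi (σ.iarr 2 j), squash lo hi (σ.iarr 3 j)) := by
      intro i hij hnot he
      have hinj' : ∀ x y, squash lo hi y ≠ lo → squash lo hi x = squash lo hi y → x = y := by
        intro x y hy hxy
        rcases squash_inj hlohi hxy with h1 | ⟨h1, h2⟩ | ⟨h1, h2⟩
        · exact h1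
        · rw [h2, squash_hi] at hy; exact absurd rfl hy
        · rw [h2, squash_lo hlohi] at hy; exact absurd rfl hy
      simp only [Sym2.mem_iff, not_or] at hnot
      have : i = j := by
        refine h.simple (hij.trans hjm) hjm ?_
        rcases Sym2.eq_iff.1 he with ⟨e1, e2⟩ | ⟨e1, e2⟩
        · exact Sym2.eq_iff.2 (Or.inl ⟨hinj' _ _ (Ne.symm hnot.1) e1, hinj' _ _ (Ne.symm hnot.2) e2⟩)
        · exact Sym2.eq_iff.2 (Or.inr ⟨hinj' _ _ (Ne.symm hnot.2) e1, hinj' _ _ (Ne.symm hnot.1) e2⟩)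
      omega
    have hA := hρ _ hT
    have hB := hρ _ hH
    by_cases hAB : squash lo hi (σ.iarr 2 j) = squash lo hi (σ.iarr 3 j)
    · simpa [Cmd.sem, BExp.Holds, IExp.eval, hj, r1, r2, ha4, hA, hB, hAB] using hinv.skip hAB
    -- The value of variable `16`: the end other than `lo`, or `I.n`, which is no node, if the arc
    -- avoids `lo`.
    obtain ⟨x, hxw, hx⟩ : ∃ x, x = (if squash lo hi (σ.iarr 2 j) = lo then
        squash lo hi (σ.iarr 3 j) else if squash lo hi (σ.iarr 3 j) = lo then
        squash lo hi (σ.iarr 2 j) else I.n) ∧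
        ((x < I.n ∧ s(squash lo hi (σ.iarr 2 j), squash lo hi (σ.iarr 3 j)) = s(lo, x)) ∨
          (I.n ≤ x ∧ lo ∉ s(squash lo hi (σ.iarr 2 j), squash lo hi (σ.iarr 3 j)))) := by
      refine ⟨_, rfl, ?_⟩
      split_ifs with h1 h2
      · exact Or.inl ⟨by omega, by rw [h1]⟩
      · exact Or.inl ⟨by omega, by rw [h2, Sym2.eq_swap]⟩
      · exact Or.inr ⟨le_rfl, by simp [Ne.symm h1, Ne.symm h2]⟩
    by_cases hp : x < I.n ∧ τ.iarr 5 x ≠ 0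
    · have := hinv.merge hp.1 hp.2 (by rcases hx with hx | hx; exacts [hx.2, by omega]) hc
      rw [← r3] at this
      split_ifs at hxw with h1 h2 <;> rw [hxw] at this hp
      · rw [h1] at hAB
        simpa [Cmd.sem, BExp.Holds, IExp.eval, RExp.eval, hj, r1, r2, h4, h9, ha4, hA, hB, h1, hAB,
          hp] using this
      · simpa [Cmd.sem, BExp.Holds, IExp.eval, RExp.eval, hj, r1, r2, h4, h9, ha4, hA, hB, h1, h2, hp]
          using this
      · exact absurd hp.1 (lt_irrefl _)
    · have := hinv.append (x := x) hTn hHn hAB hc (by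
        rcases hx with hx | hx
        · exact Or.inl ⟨hx.1, by by_contra h0; exact hp ⟨hx.1, h0⟩, hx.2⟩
        · exact Or.inr hx) hinj
      rw [← r3] at this
      split_ifs at hxw with h1 h2 <;> rw [hxw] at this hp
      · rw [h1] at hAB
        simpa [Cmd.sem, BExp.Holds, IExp.eval, RExp.eval, hj, r1, r2, h4, h9, ha4, hA, hB, h1, hAB,
          hp] using this
      · simpa [Cmd.sem, BExp.Holds, IExp.eval, RExp.eval, hj, r1, r2, h4, h9, ha4, hA, hB, h1, h2, hp]
          using this
      · simpa [Cmd.sem, BExp.Holds, IExp.eval, RExp.eval, hj, r1, r2, h4, h9, ha4, hA, hB, h1, h2,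
          hAB, hp] using this
  · exact fun τ _ h => h.2

/-- Since the contracted node is not `t`, the terminals stay distinct. Connectivity is inherited by
pulling two-valued functions back along the surjective node map. Array `6` accumulates the
composition of the node maps. -/
theorem contract_does (hX : 1 ≤ X) (h : Stored workLayout I σ) (hn : I.n ≤ 8 * X) (hm : I.m ≤ 8 * X)
    (hN : σ.ivar 0 ≤ 8 * X) (hu : σ.ivar 8 < I.n) (hut : σ.ivar 8 ≠ I.t)
    (htot : ∀ x < σ.ivar 0, σ.iarr 6 x < I.n) :
    Does R X contract σ fun τ => ∃ J ρ, Stored workLayout J τ ∧ Contracts I J ρ (σ.ivar 8) ∧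
      ∀ x < σ.ivar 0, τ.iarr 6 x = ρ (σ.iarr 6 x) := by
  classical
  refine Does.seq (choosePair_does hX h hu) fun τ₁ f₁ ⟨hlohi, hhi, hn', hcase⟩ => ?_
  have s₁ := h.frame f₁ (by decide) (by decide) (by decide)
  have e4 : τ₁.ivar 4 = I.n := s₁.n
  refine Does.seq (tabulateSquash_does hX (e4.trans_le hn)) fun τ₂ f₂ h₂ => ?_
  have s₂ := s₁.frame f₂ (by decide) (by decide) (by decide)
  refine Does.seq (Does.straight (P := fun τ => τ.ivar 13 = 0) hX trivial
    (by simp [Cmd.sem, IExp.eval])) fun τ₃ f₃ h₃ => ?_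
  have s₃ := s₂.frame f₃ (by decide) (by decide) (by decide)
  rw [e4] at h₂
  obtain ⟨lo, hlo⟩ : ∃ lo, lo = τ₁.ivar 9 := ⟨_, rfl⟩
  obtain ⟨hi, hhi'⟩ : ∃ hi, hi = τ₁.ivar 10 := ⟨_, rfl⟩
  obtain ⟨n', hnn⟩ : ∃ n', n' = τ₁.ivar 11 := ⟨_, rfl⟩
  rw [← hlo, ← hhi'] at hlohi hcase h₂
  rw [← hhi'] at hhi hn'
  rw [← hnn] at hn'
  refine Does.seq (mergeArcs_does hX s₃ hm (lo := lo) (hi := hi) (n' := n') ?_ hlohi hhi hn'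
    (fun x hx => ?_) (fun x hx => ?_) h₃) fun τ₄ f₄ h₄ => ?_
  · rw [f₃.ivar 9 (by decide), f₂.ivar 9 (by decide), hlo]
  · rw [f₃.iarr 4 (by decide), (h₂ x hx).1]
  · rw [f₃.iarr 5 (by decide), (h₂ x hx).2]
  have e0 : τ₄.ivar 0 = σ.ivar 0 := by
    rw [f₄.ivar 0 (by decide), f₃.ivar 0 (by decide), f₂.ivar 0 (by decide), f₁.ivar 0 (by decide)]
  refine Does.seq (composeMap_does hX (e0.trans_le hN)) fun τ₅ f₅ h₅ => ?_
  refine Does.straight hX (by simp [finishContract, Cmd.Straight]) ?_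
  have a4 : ∀ x < I.n, τ₅.iarr 4 x = squash lo hi x := fun x hx => by
    rw [f₅.iarr 4 (by decide), f₄.iarr 4 (by decide), f₃.iarr 4 (by decide), (h₂ x hx).1]
  have e11 : τ₅.ivar 11 = n' := by
    rw [f₅.ivar 11 (by decide), f₄.ivar 11 (by decide), f₃.ivar 11 (by decide),
      f₂.ivar 11 (by decide), hnn]
  have e13 : τ₅.ivar 13 = τ₄.ivar 13 := f₅.ivar 13 (by decide)
  have e6 : τ₅.ivar 6 = I.s := by
    rw [f₅.ivar 6 (by decide), f₄.ivar 6 (by decide)]; exact s₃.s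
  have e7 : τ₅.ivar 7 = I.t := by
    rw [f₅.ivar 7 (by decide), f₄.ivar 7 (by decide)]; exact s₃.t
  set τ₆ := finishContract.sem τ₅ with hτ₆
  have d4 : τ₆.ivar 4 = n' := by simp [hτ₆, finishContract, Cmd.sem, IExp.eval, e11]
  have d5 : τ₆.ivar 5 = τ₄.ivar 13 := by simp [hτ₆, finishContract, Cmd.sem, IExp.eval, e13]
  have d6 : τ₆.ivar 6 = squash lo hi I.t := by
    simp [hτ₆, finishContract, Cmd.sem, IExp.eval, e7, a4]
  have d7 : τ₆.ivar 7 = squash lo hi I.s := by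
    simp [hτ₆, finishContract, Cmd.sem, IExp.eval, e6, a4]
  have b2 : τ₆.iarr 2 = τ₄.iarr 2 := f₅.iarr 2 (by decide)
  have b3 : τ₆.iarr 3 = τ₄.iarr 3 := f₅.iarr 3 (by decide)
  have b6 : τ₆.iarr 6 = τ₅.iarr 6 := rfl
  have r2 : τ₆.rarr 2 = τ₄.rarr 2 := f₅.rarr 2 (by decide)
  -- The fibre over the image of `s` consists of `s` and the contracted node. The last alternative
  -- belongs to the artificial choice `hi = I.n`, where nothing is merged and `I.n` is not a node.
  have hst : ∀ x, squash lo hi x = squash lo hi I.s ↔ x = I.s ∨ x = σ.ivar 8 ∨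
      (σ.ivar 8 = I.s ∧ x = I.n) := by
    intro x
    have := I.s.2
    unfold squash
    split_ifs <;> omega
  have hlt : ∀ x < I.n, squash lo hi x < n' := fun x hx => hn' ▸ squash_lt hlohi hhi hx
  have hst' : squash lo hi I.t ≠ squash lo hi I.s := by
    rw [Ne, hst]
    have := I.t.2
    have : (I.t : ℕ) ≠ I.s := fun h => I.s_ne_t (Fin.ext h).symm
    omega
  obtain ⟨J, hJ⟩ := exists_stored workLayout τ₆
    (fun i hi => by
      change i < τ₆.ivar 5 at hi
      change τ₆.iarr 2 i < τ₆.ivar 4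
      rw [d5] at hi; rw [b2, d4]; exact (h₄.arc i hi).1)
    (fun i hi => by
      change i < τ₆.ivar 5 at hi
      change τ₆.iarr 3 i < τ₆.ivar 4
      rw [d5] at hi; rw [b3, d4]; exact (h₄.arc i hi).2.1)
    (fun i hi => by
      change i < τ₆.ivar 5 at hi
      change 0 ≤ τ₆.rarr 2 i
      rw [d5] at hi; rw [r2]; exact (h₄.arc i hi).2.2.2)
    (by
      change τ₆.ivar 6 < τ₆.ivar 4
      rw [d6, d4]; exact hlt _ I.t.2)
    (by
      change τ₆.ivar 7 < τ₆.ivar 4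
      rw [d7, d4]; exact hlt _ I.s.2)
    (by
      change τ₆.ivar 6 ≠ τ₆.ivar 7
      rw [d6, d7]; exact hst')
    (fun i hi => by
      change i < τ₆.ivar 5 at hi
      change τ₆.iarr 2 i ≠ τ₆.iarr 3 i
      rw [d5] at hi; rw [b2, b3]; exact (h₄.arc i hi).2.2.1)
    (fun i hi j hj => by
      change i < τ₆.ivar 5 at hi
      change j < τ₆.ivar 5 at hj
      change s(τ₆.iarr 2 i, τ₆.iarr 3 i) = s(τ₆.iarr 2 j, τ₆.iarr 3 j) → _
      rw [d5] at hi hj; rw [b2, b3]; exact h₄.simple i hi j hj)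
    (fun D hD x hx y hy => by
      change ∀ i < τ₆.ivar 5, D (τ₆.iarr 2 i) = D (τ₆.iarr 3 i) at hD
      change x < τ₆.ivar 4 at hx
      change y < τ₆.ivar 4 at hy
      rw [d5, b2, b3] at hD
      rw [d4, hn'] at hx hy
      obtain ⟨x', hx', rfl⟩ := exists_squash (lo := lo) hhi hx
      obtain ⟨y', hy', rfl⟩ := exists_squash (lo := lo) hhi hy
      refine I.apply_eq_of_forall_arc (D := fun x => D (squash lo hi x)) (fun i => ?_)
        ⟨x', hx'⟩ ⟨y', hy'⟩
      have := h₄.conn D hD i i.2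
      have t1 : τ₃.iarr 2 i = I.tail i := s₃.tail i
      have t2 : τ₃.iarr 3 i = I.head i := s₃.head i
      rwa [t1, t2] at this)
  have jn : J.n = n' := hJ.n.symm.trans d4
  have jm : J.m = τ₄.ivar 13 := hJ.m.symm.trans d5
  refine ⟨J, squash lo hi, hJ, ⟨?_, ?_, fun x hx => jn ▸ hlt x hx, fun D => ?_, fun D hD => ?_,
    hJ.s.symm.trans d6, hJ.t.symm.trans d7, ?_⟩, fun x hx => ?_⟩
  · rw [jn, hn']; split_ifs <;> omega
  · rw [jm]; exact h₄.le
  · rw [hJ.cutCap, s₃.cutCap, jm]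
    change ∑ i ∈ _, (if D (τ₆.iarr 2 i) = D (τ₆.iarr 3 i) then 0 else τ₆.rarr 2 i) = _
    rw [b2, b3, r2]
    exact h₄.cut D
  -- `D` is composed with a section of the node map; on the only fibre that may contain two nodes it
  -- is constant by `hD`.
  · refine ⟨fun y => D (if y = squash lo hi I.s then I.s else
      if h : ∃ x < I.n, squash lo hi x = y then h.choose else 0), fun x hx => ?_⟩
    dsimp only
    split_ifs with h1 h2
    · rw [hst] at h1
      rcases h1 with rfl | rfl | ⟨-, h1⟩
      · rfl
      · exact hD.symm
      · omega
    · have h3 := h2.choose_spec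
      generalize h2.choose = y at h3
      rcases squash_inj hlohi h3.2 with rfl | h4 | h4
      · rfl
      · exact absurd ((hst x).2 (by omega)) h1
      · exact absurd ((hst x).2 (by omega)) h1
    · exact absurd ⟨x, hx, rfl⟩ h2
  · exact (hst _).2 (Or.inr (Or.inl rfl))
  · rw [b6, h₅ x (e0 ▸ hx), f₄.iarr 4 (by decide), f₃.iarr 4 (by decide),
      f₄.iarr 6 (by decide), f₃.iarr 6 (by decide), f₂.iarr 6 (by decide), f₁.iarr 6 (by decide)]
    exact (h₂ _ (htot x hx)).1

end MaxFlowVitality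

/-! ### Minimum cuts from the routine by graph search. -/

namespace MaxFlowVitality

open Finset Relation

theorem sum_range_update {β : Type*} {n x : ℕ} (hx : x < n) (h : ℕ → β) (b : β) (g : β → ℕ) :
    ∑ y ∈ range n, g (Function.update h x b y) + g (h x) = ∑ y ∈ range n, g (h y) + g b := by
  have hm : x ∈ range n := mem_range.2 hx
  rw [← Finset.sum_erase_add _ _ hm, ← Finset.sum_erase_add (range n) (fun y => g (h y)) hm,
    Function.update_self]
  have : ∑ y ∈ (range n).erase x, g (Function.update h x b y) = ∑ y ∈ (range n).erase x, g (h y) :=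
    Finset.sum_congr rfl fun y hy => by rw [Function.update_of_ne (Finset.ne_of_mem_erase hy)]
  omega

/-- `Chain nxt dst d l`: the linked list that starts at cell `d` holds the entries `l`. -/
inductive Chain (nxt dst : ℕ → ℕ) : ℕ → List ℕ → Prop
  | nil : Chain nxt dst 0 []
  | cons {d : ℕ} {l : List ℕ} (h0 : d ≠ 0) (hlt : nxt d < d) (h : Chain nxt dst (nxt d) l) :
      Chain nxt dst d (dst d :: l)

/-- Links point to strictly smaller cells, so a list that starts at `d` uses only cells up to `d`.
Filling a fresh cell above them leaves it intact. -/
theorem Chain.congr {nxt dst nxt' dst' : ℕ → ℕ} {d : ℕ} {l : List ℕ} (h : Chain nxt dst d l)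
    (heq : ∀ i ≤ d, nxt' i = nxt i ∧ dst' i = dst i) : Chain nxt' dst' d l := by
  induction h with
  | nil => exact .nil
  | @cons d l h0 hlt _ ih =>
    obtain ⟨h1, h2⟩ := heq d le_rfl
    rw [← h2]
    refine .cons h0 (by rwa [h1]) ?_
    rw [h1]
    exact ih fun i hi => heq i (by omega)

/-- Linked lists with `cnt` cells in total that hold the lists `A`. -/
structure AdjLists (n cnt : ℕ) (fst nxt dst : ℕ → ℕ) (A : ℕ → List ℕ) : Prop where
  chain : ∀ x < n, Chain nxt dst (fst x) (A x)
  le : ∀ x < n, fst x ≤ cnt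
  len : ∑ x ∈ range n, (A x).length = cnt

theorem AdjLists.insert {n cnt : ℕ} {fst nxt dst : ℕ → ℕ} {A : ℕ → List ℕ}
    (h : AdjLists n cnt fst nxt dst A) {x : ℕ} (hx : x < n) (y : ℕ) :
    AdjLists n (cnt + 1) (Function.update fst x (cnt + 1)) (Function.update nxt (cnt + 1) (fst x))
      (Function.update dst (cnt + 1) y) (Function.update A x (y :: A x)) := by
  have hc : ∀ z < n, Chain (Function.update nxt (cnt + 1) (fst x))
      (Function.update dst (cnt + 1) y) (fst z) (A z) := fun z hz => by
    refine (h.chain z hz).congr fun i hi => ?_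
    have := h.le z hz
    rw [Function.update_of_ne (by omega), Function.update_of_ne (by omega)]
    exact ⟨rfl, rfl⟩
  refine ⟨fun z hz => ?_, fun z hz => ?_, ?_⟩
  · by_cases hzx : z = x
    · subst hzx
      rw [Function.update_self, Function.update_self]
      have := Chain.cons (nxt := Function.update nxt (cnt + 1) (fst z))
        (dst := Function.update dst (cnt + 1) y) (d := cnt + 1) (l := A z) (by omega)
        (by rw [Function.update_self]; exact Nat.lt_succ_of_le (h.le z hz))
        (by rw [Function.update_self]; exact hc z hz)
      rwa [Function.update_self] at this
    · rw [Function.update_of_ne hzx, Function.update_of_ne hzx]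
      exact hc z hz
  · by_cases hzx : z = x
    · subst hzx; rw [Function.update_self]
    · rw [Function.update_of_ne hzx]; exact (h.le z hz).trans (Nat.le_succ _)
  · have := sum_range_update hx A (y :: A x) List.length
    have := h.len
    simp only [List.length_cons] at *
    omega

/-- Invariant of the graph search: the lists `A` hold the arcs that are still to be followed. -/
structure SearchInv (n s : ℕ) (Rel : ℕ → ℕ → Prop) (nxt dst fst vis stack : ℕ → ℕ) (sp : ℕ)
    (A : ℕ → List ℕ) : Prop where
  chain : ∀ x < n, Chain nxt dst (fst x) (A x)
  rel : ∀ x < n, ∀ y ∈ A x, Rel x y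
  start : vis s ≠ 0
  reach : ∀ x < n, vis x ≠ 0 → ReflTransGen Rel s x
  mem : ∀ i < sp, stack i < n ∧ vis (stack i) ≠ 0
  done : ∀ x < n, vis x ≠ 0 → (∃ i < sp, stack i = x) ∨ A x = []
  closed : ∀ x < n, ∀ y, Rel x y → y ∈ A x ∨ vis y ≠ 0

/-- The number of remaining iterations of the search. -/
def searchFuel (n : ℕ) (vis : ℕ → ℕ) (sp : ℕ) (A : ℕ → List ℕ) : ℕ :=
  ∑ x ∈ range n, (A x).length + ∑ x ∈ range n, (if vis x = 0 then 2 else 0) + sp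

section Search

variable {n s sp : ℕ} {Rel : ℕ → ℕ → Prop} {nxt dst fst vis stack : ℕ → ℕ} {A : ℕ → List ℕ}

/-- The top node has exhausted its list, which is the other alternative in `done`. -/
theorem SearchInv.pop (h : SearchInv n s Rel nxt dst fst vis stack sp A)
    (hf : fst (stack (sp - 1)) = 0) (hsp : 0 < sp) :
    SearchInv n s Rel nxt dst fst vis stack (sp - 1) A where
  chain := h.chain
  rel := h.rel
  start := h.start
  reach := h.reach
  mem i hi := h.mem i (by omega)
  done x hx hv := by
    rcases h.done x hx hv with ⟨i, hi, rfl⟩ | h1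
    · rcases Nat.lt_or_ge i (sp - 1) with h2 | h2
      · exact Or.inl ⟨i, h2, rfl⟩
      · obtain rfl : i = sp - 1 := by omega
        have := h.chain _ hx
        rw [hf] at this
        right
        generalize A (stack (sp - 1)) = L at this ⊢
        cases this with
        | nil => rfl
        | cons h0 => exact absurd rfl h0
    · exact Or.inr h1
  closed := h.closed

/-- Follow an arc to a node that was visited before. -/
theorem SearchInv.advance (h : SearchInv n s Rel nxt dst fst vis stack sp A) {x : ℕ} (hx : x < n)
    (hf : fst x ≠ 0) (hst : ∃ i < sp, stack i = x) :
    ∃ l, A x = dst (fst x) :: l ∧ (vis (dst (fst x)) ≠ 0 →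
      SearchInv n s Rel nxt dst (Function.update fst x (nxt (fst x))) vis stack sp
        (Function.update A x l)) := by
  have hc := h.chain x hx
  obtain ⟨l, hl, hcl⟩ : ∃ l, A x = dst (fst x) :: l ∧ Chain nxt dst (nxt (fst x)) l := by
    generalize A x = L at hc
    generalize fst x = d at hc hf
    cases hc with
    | nil => exact absurd rfl hf
    | @cons _ l h0 hlt h => exact ⟨l, rfl, h⟩
  refine ⟨l, hl, fun hv => ⟨fun z hz => ?_, fun z hz y hy => ?_, h.start, h.reach, h.mem,
    fun z hz hvz => ?_, fun z hz y hr => ?_⟩⟩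
  · by_cases hzx : z = x
    · subst hzx; simpa using hcl
    · simpa [hzx] using h.chain z hz
  · by_cases hzx : z = x
    · subst hzx
      rw [Function.update_self] at hy
      exact h.rel z hz y (by rw [hl]; exact List.mem_cons_of_mem _ hy)
    · rw [Function.update_of_ne hzx] at hy
      exact h.rel z hz y hy
  · by_cases hzx : z = x
    · subst hzx; exact Or.inl hst
    · simpa [hzx] using h.done z hz hvz
  · rcases h.closed z hz y hr with h1 | h1
    · by_cases hzx : z = x
      · subst hzx
        rw [hl, List.mem_cons] at h1
        rcases h1 with rfl | h1
        · exact Or.inr hv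
        · exact Or.inl (by simpa using h1)
      · exact Or.inl (by simpa [hzx] using h1)
    · exact Or.inr h1

/-- Mark a node and push it. -/
theorem SearchInv.push (h : SearchInv n s Rel nxt dst fst vis stack sp A) {x y : ℕ} (hx : x < n)
    (hvx : vis x ≠ 0) (hy : y < n) (hxy : Rel x y) :
    SearchInv n s Rel nxt dst fst (Function.update vis y 1) (Function.update stack sp y) (sp + 1)
      A := by
  have hv : ∀ z, vis z ≠ 0 → Function.update vis y 1 z ≠ 0 := fun z hz => by
    by_cases hzy : z = y
    · subst hzy; simp
    · simpa [hzy] using hz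
  refine ⟨h.chain, h.rel, hv _ h.start, fun z hz hvz => ?_, fun i hi => ?_, fun z hz hvz => ?_,
    fun z hz w hr => (h.closed z hz w hr).imp_right (hv w)⟩
  · by_cases hzy : z = y
    · subst hzy; exact (h.reach x hx hvx).tail hxy
    · exact h.reach z hz (by simpa [hzy] using hvz)
  · by_cases hi' : i = sp
    · subst hi'; simpa using hy
    · rw [Function.update_of_ne hi']
      obtain ⟨h1, h2⟩ := h.mem i (by omega)
      exact ⟨h1, hv _ h2⟩
  · by_cases hzy : z = y
    · subst hzy; exact Or.inl ⟨sp, Nat.lt_succ_self sp, by simp⟩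
    · refine (h.done z hz (by simpa [hzy] using hvz)).imp_left ?_
      rintro ⟨i, hi, hiz⟩
      exact ⟨i, by omega, by rw [Function.update_of_ne hi.ne, hiz]⟩

end Search

/-- Sum up the net flow out of `s` in the real variable `0`. -/
def flowValue : Cmd :=
  .setR 0 .zero ;; .upto 12 (.lit 0) 5
    (.cond (.eqI (.read 2 (.var 12)) (.var 6))
      (.setR 0 (.add (.var 0) (.sub (.read 3 (.var 12)) (.read 4 (.var 12)))))
      (.cond (.eqI (.read 3 (.var 12)) (.var 6))
        (.setR 0 (.sub (.var 0) (.sub (.read 3 (.var 12)) (.read 4 (.var 12))))) .skip))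

/-- Empty adjacency lists, no node visited. -/
def clearLists : Cmd :=
  .upto 12 (.lit 0) 4 (.storeI 7 (.var 12) (.lit 0) ;; .storeI 10 (.var 12) (.lit 0))

/-- Insert the node in variable `y` into the list of the node in variable `x`. -/
def insertArc (x y : ℕ) : Cmd :=
  .setI 13 (.succ (.var 13)) ;; .storeI 9 (.var 13) (.var y) ;;
  .storeI 8 (.var 13) (.read 7 (.var x)) ;; .storeI 7 (.var x) (.var 13)

/-- Insert the residual arcs that belong to the arc in variable `12`. -/
def insertResidual : Cmd :=
  .setI 14 (.read 2 (.var 12)) ;; .setI 15 (.read 3 (.var 12)) ;;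
  .cond (.ltR (.sub (.read 3 (.var 12)) (.read 4 (.var 12))) (.read 2 (.var 12)))
    (insertArc 14 15) .skip ;;
  .cond (.ltR (.sub (.read 4 (.var 12)) (.read 3 (.var 12))) (.read 2 (.var 12)))
    (insertArc 15 14) .skip

/-- Build the adjacency lists of the residual graph. -/
def residualLists : Cmd :=
  .setI 13 (.lit 0) ;; .upto 12 (.lit 0) 5 insertResidual

/-- Search the residual graph from `s`; array `10` marks the nodes that are found. -/
def searchLists : Cmd :=
  .storeI 10 (.var 6) (.lit 1) ;; .storeI 11 (.lit 0) (.var 6) ;; .setI 17 (.lit 1) ;;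
  .loop (.ltI (.lit 0) (.var 17))
    (.setI 18 (.read 11 (.pred (.var 17))) ;; .setI 19 (.read 7 (.var 18)) ;;
    .cond (.eqI (.var 19) (.lit 0)) (.setI 17 (.pred (.var 17)))
      (.storeI 7 (.var 18) (.read 8 (.var 19)) ;; .setI 20 (.read 9 (.var 19)) ;;
      .cond (.eqI (.read 10 (.var 20)) (.lit 0))
        (.storeI 10 (.var 20) (.lit 1) ;; .storeI 11 (.var 17) (.var 20) ;;
          .setI 17 (.succ (.var 17)))
        .skip))

variable {R : MaxFlowRoutine} {X : ℕ} {σ : State} {J : Network}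

theorem flowValue_does (hX : 1 ≤ X) (h : Stored workLayout J σ) (hm : J.m ≤ 8 * X)
    {f : J.DArc → ℝ} (hf₁ : ∀ i : Fin J.m, σ.rarr 3 i = f (i, false))
    (hf₂ : ∀ i : Fin J.m, σ.rarr 4 i = f (i, true)) :
    Does R X flowValue σ fun τ => τ.rvar 0 = J.value univ f := by
  refine Does.seq (Does.straight (P := fun τ => τ.rvar 0 = 0) hX trivial
    (by simp [Cmd.sem, RExp.eval])) fun τ₁ f₁ h₁ => ?_
  have s₁ := h.frame f₁ (by decide) (by decide) (by decide)
  have e3 : τ₁.rarr 3 = σ.rarr 3 := f₁.rarr 3 (by decide)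
  have e4 : τ₁.rarr 4 = σ.rarr 4 := f₁.rarr 4 (by decide)
  have hs : τ₁.ivar 6 = J.s := s₁.s
  refine Does.mono (Does.upto (j₀ := 0) hX (by simp [Cmd.Straight])
    (fun j τ => τ.rvar 0 = ∑ i ∈ range j, (τ₁.rarr 3 i - τ₁.rarr 4 i) *
      ((if τ₁.iarr 2 i = J.s then 1 else 0) - (if τ₁.iarr 3 i = J.s then 1 else 0)))
    rfl s₁.m (Nat.zero_le _) hm (by decide) (by decide) (by decide) (by simpa using h₁) ?_) ?_
  · intro j τ hf hj _ hjm hinv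
    have a2 := hf.iarr 2 (by decide)
    have a3 := hf.iarr 3 (by decide)
    have r3 := hf.rarr 3 (by decide)
    have r4 := hf.rarr 4 (by decide)
    have v6 := hf.ivar 6 (by decide)
    have hne : τ₁.iarr 2 j ≠ τ₁.iarr 3 j := s₁.loopless hjm
    rw [Finset.sum_range_succ, ← hinv]
    by_cases h2 : τ₁.iarr 2 j = J.s
    · have h3 : τ₁.iarr 3 j ≠ J.s := fun h => hne (h2.trans h.symm)
      simp [Cmd.sem, BExp.Holds, IExp.eval, RExp.eval, hj, a2, r3, r4, v6, hs, h2, h3]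
    · by_cases h3 : τ₁.iarr 3 j = J.s
      · simp [Cmd.sem, BExp.Holds, IExp.eval, RExp.eval, hj, a2, a3, r3, r4, v6, hs, h2, h3]
        ring
      · simp [Cmd.sem, BExp.Holds, IExp.eval, hj, a2, a3, v6, hs, h2, h3]
  · intro τ _ hτ
    rw [hτ.2, Network.value, Network.outflow_sub_inflow, Finset.sum_range]
    refine Finset.sum_congr rfl fun i _ => ?_
    have t1 : τ₁.iarr 2 i = J.tail i := s₁.tail i
    have t2 : τ₁.iarr 3 i = J.head i := s₁.head i
    rw [e3, e4, hf₁, hf₂, t1, t2]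
    simp [Network.net, Fin.ext_iff]

theorem clearLists_does (hX : 1 ≤ X) (hn : σ.ivar 4 ≤ 8 * X) :
    Does R X clearLists σ fun τ => ∀ x < σ.ivar 4, τ.iarr 7 x = 0 ∧ τ.iarr 10 x = 0 := by
  refine Does.mono (Does.upto (j₀ := 0) hX (by simp [Cmd.Straight])
    (fun j τ => ∀ x < j, τ.iarr 7 x = 0 ∧ τ.iarr 10 x = 0)
    rfl rfl (Nat.zero_le _) hn (by decide) (by decide) (by decide) (by simp) ?_) ?_
  · intro j τ hf hj _ hjn hinv x hx
    by_cases hxj : x = j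
    · subst hxj; simp [Cmd.sem, IExp.eval, hj]
    · simpa [Cmd.sem, IExp.eval, hj, hxj] using hinv x (by omega)
  · exact fun τ _ h => h.2

/-- The arc `i` contributes the arc from `x` to `y` to the residual graph. -/
def ResidualArc (σ : State) (i x y : ℕ) : Prop :=
  (x = σ.iarr 2 i ∧ y = σ.iarr 3 i ∧ σ.rarr 3 i - σ.rarr 4 i < σ.rarr 2 i) ∨
    (x = σ.iarr 3 i ∧ y = σ.iarr 2 i ∧ σ.rarr 4 i - σ.rarr 3 i < σ.rarr 2 i)

/-- The adjacency lists in memory hold `A`. -/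
abbrev HoldsLists (n : ℕ) (σ : State) (A : ℕ → List ℕ) : Prop :=
  AdjLists n (σ.ivar 13) (σ.iarr 7) (σ.iarr 8) (σ.iarr 9) A

theorem cond_insertArc_sem {n x y : ℕ} {A : ℕ → List ℕ} {b : BExp} (h : HoldsLists n σ A)
    (hx : x ≠ 13) (hy : y ≠ 13) (hxn : σ.ivar x < n) {τ : State}
    (hτ : τ = (Cmd.cond b (insertArc x y) .skip).sem σ) :
    (∃ A', HoldsLists n τ A' ∧
      (∀ z w, w ∈ A' z ↔ w ∈ A z ∨ (b.Holds σ ∧ z = σ.ivar x ∧ w = σ.ivar y)) ∧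
      τ.ivar 13 ≤ σ.ivar 13 + 1) ∧
    (∀ z, z ≠ 13 → τ.ivar z = σ.ivar z) ∧ τ.rarr = σ.rarr := by
  subst hτ
  by_cases hb : b.Holds σ
  · simp only [Cmd.sem, if_pos hb]
    refine ⟨⟨Function.update A (σ.ivar x) (σ.ivar y :: A (σ.ivar x)), ?_, fun z w => ?_, ?_⟩,
      fun z hz => ?_, ?_⟩
    · simpa [HoldsLists, insertArc, Cmd.sem, IExp.eval, hx, hy] using h.insert hxn (σ.ivar y)
    · by_cases hz : z = σ.ivar x
      · subst hz; simp [hb, or_comm]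
      · simp [hz]
    · simp [insertArc, Cmd.sem, IExp.eval]
    · simp [insertArc, Cmd.sem, IExp.eval, hz]
    · simp [insertArc, Cmd.sem]
  · simp only [Cmd.sem, if_neg hb]
    exact ⟨⟨A, h, fun z w => by simp [hb], Nat.le_succ _⟩, by simp⟩

/-- Each arc yields at most one residual arc in either direction; the resulting bound on the number
of cells enters the running time of the search. -/
theorem residualLists_does (hX : 1 ≤ X) (h : Stored workLayout J σ) (hm : J.m ≤ 8 * X)
    (h7 : ∀ x < J.n, σ.iarr 7 x = 0) :
    Does R X residualLists σ fun τ => ∃ A, HoldsLists J.n τ A ∧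
      (∀ z w, w ∈ A z ↔ ∃ i < J.m, ResidualArc σ i z w) ∧ τ.ivar 13 ≤ 2 * J.m := by
  refine Does.seq (Does.straight (P := fun τ => τ.ivar 13 = 0) hX trivial
    (by simp [Cmd.sem, IExp.eval])) fun τ₁ f₁ h₁ => ?_
  have s₁ := h.frame f₁ (by decide) (by decide) (by decide)
  have a7 := f₁.iarr 7 (by decide)
  refine Does.mono (Does.upto (j₀ := 0) hX (by simp [insertResidual, insertArc, Cmd.Straight])
    (fun j τ => ∃ A, HoldsLists J.n τ A ∧
      (∀ z w, w ∈ A z ↔ ∃ i < j, ResidualArc σ i z w) ∧ τ.ivar 13 ≤ 2 * j)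
    rfl s₁.m (Nat.zero_le _) hm (by decide) (by decide) (by decide) ?_ ?_) (fun τ _ h => h.2)
  · refine ⟨fun _ => [], ⟨fun x hx => ?_, fun x hx => ?_, ?_⟩, by simp, by simp [h₁]⟩
    · simp only [a7, h7 x hx]; exact .nil
    · simp [a7, h7 x hx]
    · simp [h₁]
  · rintro j τ hf hj - hjm ⟨A, hA, hmem, hcnt⟩
    have a2 : τ.iarr 2 = σ.iarr 2 := (hf.iarr 2 (by decide)).trans (f₁.iarr 2 (by decide))
    have a3 : τ.iarr 3 = σ.iarr 3 := (hf.iarr 3 (by decide)).trans (f₁.iarr 3 (by decide))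
    have r2 : τ.rarr 2 = σ.rarr 2 := (hf.rarr 2 (by decide)).trans (f₁.rarr 2 (by decide))
    have r3 : τ.rarr 3 = σ.rarr 3 := (hf.rarr 3 (by decide)).trans (f₁.rarr 3 (by decide))
    have r4 : τ.rarr 4 = σ.rarr 4 := (hf.rarr 4 (by decide)).trans (f₁.rarr 4 (by decide))
    have hT : σ.iarr 2 j < J.n := h.tail_lt hjm
    have hH : σ.iarr 3 j < J.n := h.head_lt hjm
    obtain ⟨τ₂, hτ₂⟩ : ∃ τ₂, τ₂ = (Cmd.setI 14 (.read 2 (.var 12)) ;;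
      .setI 15 (.read 3 (.var 12))).sem τ := ⟨_, rfl⟩
    have e12 : τ₂.ivar 12 = j := by simp [hτ₂, Cmd.sem, hj]
    have e13 : τ₂.ivar 13 = τ.ivar 13 := by simp [hτ₂, Cmd.sem]
    have e14 : τ₂.ivar 14 = σ.iarr 2 j := by simp [hτ₂, Cmd.sem, IExp.eval, hj, a2]
    have e15 : τ₂.ivar 15 = σ.iarr 3 j := by simp [hτ₂, Cmd.sem, IExp.eval, hj, a3]
    have ra : τ₂.rarr = τ.rarr := by simp [hτ₂, Cmd.sem]
    have hA₂ : HoldsLists J.n τ₂ A := by simpa [hτ₂, HoldsLists, Cmd.sem] using hA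
    obtain ⟨τ₃, hτ₃⟩ : ∃ τ₃, τ₃ = (Cmd.cond
      (.ltR (.sub (.read 3 (.var 12)) (.read 4 (.var 12))) (.read 2 (.var 12)))
      (insertArc 14 15) .skip).sem τ₂ := ⟨_, rfl⟩
    obtain ⟨⟨A₃, hA₃, hm₃, hc₃⟩, hv₃, hr₃⟩ :=
      cond_insertArc_sem hA₂ (by decide) (by decide) (e14 ▸ hT) hτ₃
    obtain ⟨τ₄, hτ₄⟩ : ∃ τ₄, τ₄ = (Cmd.cond
      (.ltR (.sub (.read 4 (.var 12)) (.read 3 (.var 12))) (.read 2 (.var 12)))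
      (insertArc 15 14) .skip).sem τ₃ := ⟨_, rfl⟩
    obtain ⟨⟨A₄, hA₄, hm₄, hc₄⟩, -, -⟩ :=
      cond_insertArc_sem hA₃ (by decide) (by decide)
        (by rw [hv₃ 15 (by decide), e15]; exact hH) hτ₄
    have hfin : (insertResidual ;; .setI 12 (.succ (.var 12))).sem τ =
        (Cmd.setI 12 (.succ (.var 12))).sem τ₄ := by rw [hτ₄, hτ₃, hτ₂]; rfl
    rw [hfin]
    refine ⟨A₄, ?_, fun z w => ?_, ?_⟩
    · simpa [HoldsLists, Cmd.sem] using hA₄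
    · rw [hm₄, hm₃, hmem, hv₃ 15 (by decide), hv₃ 14 (by decide), e14, e15]
      simp only [BExp.Holds, RExp.eval, IExp.eval, hr₃, hv₃ 12 (by decide), e12, ra, r2, r3, r4]
      constructor
      · rintro ((⟨i, hi, hr⟩ | ⟨h1, h2, h3⟩) | ⟨h1, h2, h3⟩)
        · exact ⟨i, by omega, hr⟩
        · exact ⟨j, by omega, Or.inl ⟨h2, h3, h1⟩⟩
        · exact ⟨j, by omega, Or.inr ⟨h2, h3, h1⟩⟩
      · rintro ⟨i, hi, hr⟩
        rcases Nat.lt_succ_iff_lt_or_eq.1 hi with hi | rfl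
        · exact Or.inl (Or.inl ⟨i, hi, hr⟩)
        · rcases hr with ⟨h1, h2, h3⟩ | ⟨h1, h2, h3⟩
          · exact Or.inl (Or.inr ⟨h3, h1, h2⟩)
          · exact Or.inr ⟨h3, h1, h2⟩
    · simp [Cmd.sem]
      omega

/-- When the stack is empty, every visited node has an empty list, so by `SearchInv.closed` all its
successors are visited. The conclusions are what `Network.IsMaxFlowAssignment.isCut_of_search`
needs. -/
theorem searchLists_does (hX : 1 ≤ X) {n cnt : ℕ} (hn : n ≤ X) (hcnt : cnt ≤ 2 * X)
    {Rel : ℕ → ℕ → Prop} {A : ℕ → List ℕ}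
    (hA : AdjLists n cnt (σ.iarr 7) (σ.iarr 8) (σ.iarr 9) A)
    (hrel : ∀ x < n, ∀ y, y ∈ A x ↔ Rel x y) (hreln : ∀ x y, Rel x y → y < n)
    (hs : σ.ivar 6 < n) (hvis : ∀ x < n, σ.iarr 10 x = 0) :
    Does R X searchLists σ fun τ => τ.iarr 10 (σ.ivar 6) ≠ 0 ∧
      (∀ x < n, τ.iarr 10 x ≠ 0 → ReflTransGen Rel (σ.ivar 6) x) ∧
      ∀ x < n, τ.iarr 10 x ≠ 0 → ∀ y, Rel x y → τ.iarr 10 y ≠ 0 := by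
  -- At most `2 * X` list entries, weight `2` for each of at most `X` nodes, and one stack entry: at
  -- most `5 * X`, within the allowance `8 * X`.
  have hfuel : searchFuel n (Function.update (σ.iarr 10) (σ.ivar 6) 1) 1 A ≤ 8 * X := by
    have h1 : ∑ x ∈ range n, (if Function.update (σ.iarr 10) (σ.ivar 6) 1 x = 0 then 2 else 0) ≤
        ∑ x ∈ range n, 2 := Finset.sum_le_sum fun x _ => by split_ifs <;> omega
    simp only [Finset.sum_const, card_range, smul_eq_mul] at h1
    have h2 := hA.len
    simp only [searchFuel]
    omega
  refine Does.seq (P₁ := fun τ => τ.iarr 10 = Function.update (σ.iarr 10) (σ.ivar 6) 1)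
    (Does.straight hX trivial (by simp [Cmd.sem, IExp.eval])) fun τ₁ f₁ h₁ => ?_
  refine Does.seq (P₁ := fun τ => τ.iarr 11 0 = σ.ivar 6)
    (Does.straight hX trivial (by
      simp [Cmd.sem, IExp.eval, f₁.ivar 6 (by decide)])) fun τ₂ f₂ h₂ => ?_
  refine Does.seq (P₁ := fun τ => τ.ivar 17 = 1)
    (Does.straight hX trivial (by simp [Cmd.sem, IExp.eval])) fun τ₃ f₃ h₃ => ?_
  have a7 : τ₃.iarr 7 = σ.iarr 7 := (f₃.iarr 7 (by decide)).trans
    ((f₂.iarr 7 (by decide)).trans (f₁.iarr 7 (by decide)))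
  have a8 : τ₃.iarr 8 = σ.iarr 8 := (f₃.iarr 8 (by decide)).trans
    ((f₂.iarr 8 (by decide)).trans (f₁.iarr 8 (by decide)))
  have a9 : τ₃.iarr 9 = σ.iarr 9 := (f₃.iarr 9 (by decide)).trans
    ((f₂.iarr 9 (by decide)).trans (f₁.iarr 9 (by decide)))
  have a10 : τ₃.iarr 10 = Function.update (σ.iarr 10) (σ.ivar 6) 1 := (f₃.iarr 10 (by decide)).trans
    ((f₂.iarr 10 (by decide)).trans h₁)
  have a11 : τ₃.iarr 11 0 = σ.ivar 6 := (congrFun (f₃.iarr 11 (by decide)) 0).trans h₂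
  refine Does.mono (Does.loop hX (by simp [Cmd.Straight]) (fun f τ => ∃ A,
    f = searchFuel n (τ.iarr 10) (τ.ivar 17) A ∧
    SearchInv n (σ.ivar 6) Rel (σ.iarr 8) (σ.iarr 9) (τ.iarr 7) (τ.iarr 10) (τ.iarr 11) (τ.ivar 17) A)
    hfuel ?_ ?_) ?_
  · refine ⟨A, by rw [a10, h₃], ?_, fun x hx y hy => (hrel x hx y).1 hy, ?_, fun x hx hv => ?_,
      fun i hi => ?_, fun x hx hv => ?_, fun x hx y hr => Or.inl ((hrel x hx y).2 hr)⟩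
    · rw [a7]; exact hA.chain
    · simp [a10]
    · by_cases hxs : x = σ.ivar 6
      · subst hxs; exact .refl
      · exact absurd (by simpa [a10, hxs] using hvis x hx) hv
    · obtain rfl : i = 0 := by omega
      rw [a11, a10]
      simpa using hs
    · by_cases hxs : x = σ.ivar 6
      · exact Or.inl ⟨0, by omega, a11.trans hxs.symm⟩
      · exact absurd (by simpa [a10, hxs] using hvis x hx) hv
  · rintro _ τ hf ⟨A, rfl, hinv⟩ hb
    have b8 : τ.iarr 8 = σ.iarr 8 := (hf.iarr 8 (by decide)).trans a8
    have b9 : τ.iarr 9 = σ.iarr 9 := (hf.iarr 9 (by decide)).trans a9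
    have hsp : 0 < τ.ivar 17 := by simpa [BExp.Holds, IExp.eval] using hb
    have hx := hinv.mem (τ.ivar 17 - 1) (by omega)
    by_cases h0 : τ.iarr 7 (τ.iarr 11 (τ.ivar 17 - 1)) = 0
    · refine ⟨searchFuel n (τ.iarr 10) (τ.ivar 17 - 1) A, by simp only [searchFuel]; omega, A, ?_, ?_⟩
      · simp [Cmd.sem, BExp.Holds, IExp.eval, h0]
      · simpa [Cmd.sem, BExp.Holds, IExp.eval, h0] using hinv.pop h0 hsp
    · have hst : ∃ i < τ.ivar 17, τ.iarr 11 i = τ.iarr 11 (τ.ivar 17 - 1) :=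
        ⟨_, by omega, rfl⟩
      generalize hxx : τ.iarr 11 (τ.ivar 17 - 1) = x at *
      obtain ⟨l, hl, hadv⟩ := hinv.advance hx.1 h0 hst
      have hy : Rel x (σ.iarr 9 (τ.iarr 7 x)) := hinv.rel x hx.1 _ (by rw [hl]; simp)
      have hlen := sum_range_update hx.1 A l List.length
      rw [hl, List.length_cons] at hlen
      generalize hyy : σ.iarr 9 (τ.iarr 7 x) = y at *
      by_cases hv : τ.iarr 10 y = 0
      -- In the proof the node is pushed before the arc is consumed, because consuming an arc
      -- requires a visited target. In total one list entry and a weight of `2` disappear, while the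
      -- stack grows by one.
      · have hpush := hinv.push hx.1 hx.2 (hreln x y hy) hy
        obtain ⟨l', hl', hadv'⟩ := hpush.advance hx.1 h0 (by
          obtain ⟨i, hi, hix⟩ := hst
          exact ⟨i, by omega, by rw [Function.update_of_ne hi.ne, hix]⟩)
        rw [hyy] at hl' hadv'
        obtain rfl : l = l' := by
          rw [hl] at hl'
          exact (List.cons.inj hl').2
        have hsum := sum_range_update (hreln x y hy) (τ.iarr 10) 1 (fun v => if v = 0 then 2 else 0)
        simp only [hv, if_true, one_ne_zero, if_false] at hsum
        refine ⟨searchFuel n (Function.update (τ.iarr 10) y 1) (τ.ivar 17 + 1)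
          (Function.update A x l), by simp only [searchFuel]; omega, Function.update A x l, ?_, ?_⟩
        · simp [Cmd.sem, BExp.Holds, IExp.eval, hxx, h0, b9, hyy, hv]
        · simpa [Cmd.sem, BExp.Holds, IExp.eval, hxx, h0, b8, b9, hyy, hv] using hadv' (by simp)
      · refine ⟨searchFuel n (τ.iarr 10) (τ.ivar 17) (Function.update A x l),
          by simp only [searchFuel]; omega, Function.update A x l, ?_, ?_⟩
        · simp [Cmd.sem, BExp.Holds, IExp.eval, hxx, h0, b9, hyy, hv]
        · simpa [Cmd.sem, BExp.Holds, IExp.eval, hxx, h0, b8, b9, hyy, hv] using hadv hv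
  · rintro τ - ⟨hb, -, A, -, hinv⟩
    have hsp : τ.ivar 17 = 0 := by simpa [BExp.Holds, IExp.eval] using hb
    refine ⟨hinv.start, hinv.reach, fun x hx hv y hr => ?_⟩
    rcases hinv.done x hx hv with ⟨i, hi, -⟩ | h1
    · omega
    · rcases hinv.closed x hx y hr with h2 | h2
      · rw [h1] at h2; simp at h2
      · exact h2

/-- Call the routine and find the value (real variable `0`) and the side of `s` in a minimum cut
(array `10`). -/
def flowCut : Cmd :=
  .maxflow workLayout 3 4 ;; flowValue ;; clearLists ;; residualLists ;; searchLists

/-- The visited nodes are exactly the side of `s` in a cut that the maximum flow saturates. The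
guard `x < J.n` discards array cells that belong to no node. -/
theorem flowCut_runs (hX : 1 ≤ X) (h : Stored workLayout J σ) (hn : J.n ≤ X) (hm : J.m ≤ X) :
    Runs R flowCut σ (flowCut.rate * X) fun τ l => l = [J] ∧
      (J.IsCut fun x => decide (x < J.n ∧ τ.iarr 10 x ≠ 0)) ∧
      (J.cutCap fun x => decide (x < J.n ∧ τ.iarr 10 x ≠ 0)) = τ.rvar 0 ∧
      ∀ D, J.IsCut D → τ.rvar 0 ≤ J.cutCap D := by
  have hcall : Runs R (.maxflow workLayout 3 4) σ ((Cmd.maxflow workLayout 3 4).rate * X)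
      fun τ l => l = [J] ∧ (∀ i : Fin J.m, τ.rarr 3 i = R.flow J (i, false)) ∧
        ∀ i : Fin J.m, τ.rarr 4 i = R.flow J (i, true) :=
    ⟨_, _, _, .maxflow J h, by simpa [Cmd.rate] using hX, rfl,
      fun i => by simp [State.writeFlow, overwrite], fun i => by simp [State.writeFlow, overwrite]⟩
  refine Runs.seq_does hcall fun τ₁ l f₁ h₁ => ?_
  obtain ⟨rfl, hr3, hr4⟩ := h₁
  have s₁ := h.frame f₁ (by decide) (by decide) (by decide)
  refine Does.seq (flowValue_does hX s₁ (by omega) hr3 hr4) fun τ₂ f₂ h₂ => ?_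
  have s₂ := s₁.frame f₂ (by decide) (by decide) (by decide)
  have e4 : τ₂.ivar 4 = J.n := s₂.n
  refine Does.seq (clearLists_does hX (by omega)) fun τ₃ f₃ h₃ => ?_
  have s₃ := s₂.frame f₃ (by decide) (by decide) (by decide)
  rw [e4] at h₃
  refine Does.seq (residualLists_does hX s₃ (by omega) fun x hx => (h₃ x hx).1) fun τ₄ f₄ h₄ => ?_
  have s₄ := s₃.frame f₄ (by decide) (by decide) (by decide)
  obtain ⟨A, hA, hmem, hcnt⟩ := h₄
  have hrel : ∀ x y, (∃ i < J.m, ResidualArc τ₃ i x y) ↔ Network.Residual (R.flow J) x y := by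
    intro x y
    have key : ∀ i : Fin J.m, ResidualArc τ₃ i x y ↔
        ((x = J.tail i ∧ y = J.head i ∧ Network.net (R.flow J) i < J.cap i) ∨
          (x = J.head i ∧ y = J.tail i ∧ -J.cap i < Network.net (R.flow J) i)) := by
      intro i
      have t1 : τ₃.iarr 2 i = J.tail i := s₃.tail i
      have t2 : τ₃.iarr 3 i = J.head i := s₃.head i
      have t3 : τ₃.rarr 2 i = J.cap i := s₃.cap i
      have t4 : τ₃.rarr 3 i = R.flow J (i, false) := by
        rw [f₃.rarr 3 (by decide), f₂.rarr 3 (by decide), hr3]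
      have t5 : τ₃.rarr 4 i = R.flow J (i, true) := by
        rw [f₃.rarr 4 (by decide), f₂.rarr 4 (by decide), hr4]
      rw [ResidualArc, t1, t2, t3, t4, t5, Network.net, neg_lt, neg_sub]
    constructor
    · rintro ⟨i, hi, h⟩
      exact ⟨⟨i, hi⟩, (key ⟨i, hi⟩).1 h⟩
    · rintro ⟨i, h⟩
      exact ⟨i, i.2, (key i).2 h⟩
  have e6 : τ₄.ivar 6 = J.s := s₄.s
  refine Does.mono (searchLists_does hX hn (by omega) hA
    (fun x _ y => (hmem x y).trans (hrel x y)) ?_ (e6 ▸ J.s.2)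
    fun x hx => ?_) fun τ₅ f₅ h₅ => ?_
  · rintro x y ⟨i, ⟨-, rfl, -⟩ | ⟨-, rfl, -⟩⟩
    exacts [(J.head i).2, (J.tail i).2]
  · rw [f₄.iarr 10 (by decide)]; exact (h₃ x hx).2
  · rw [e6] at h₅
    obtain ⟨h5, h6, h7⟩ := h₅
    have hR := R.correct J
    have hval : τ₅.rvar 0 = J.value univ (R.flow J) := by
      rw [f₅.rvar 0 (by decide), f₄.rvar 0 (by decide), f₃.rvar 0 (by decide), h₂]
    obtain ⟨hc, hv⟩ := hR.isCut_of_search (D := fun x => decide (x < J.n ∧ τ₅.iarr 10 x ≠ 0))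
      (by simpa using h5)
      (fun x y hr hx => by
        simp only [decide_eq_true_eq] at hx ⊢
        refine ⟨?_, h7 x hx.1 hx.2 y hr⟩
        obtain ⟨i, ⟨-, rfl, -⟩ | ⟨-, rfl, -⟩⟩ := hr
        exacts [(J.head i).2, (J.tail i).2])
      (fun x hx => by
        simp only [decide_eq_true_eq] at hx
        exact h6 x hx.1 hx.2)
    exact ⟨rfl, hc, hv.trans hval.symm, fun D hD => hval ▸ hR.1.value_le_cutCap hD⟩

end MaxFlowVitality

/-! ### Minimum cuts with prescribed sides. -/

namespace MaxFlowVitality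

open Finset

theorem Network.cutCap_congr (I : Network) {D D' : ℕ → Bool} (h : ∀ x < I.n, D x = D' x) :
    I.cutCap D = I.cutCap D' :=
  Finset.sum_congr rfl fun i _ => by rw [h _ (I.tail i).2, h _ (I.head i).2]

/-- The indicator of `s` and `u` factors through `ρ`, so no further node shares the image of `s`. -/
theorem Contracts.eq_of_map_eq {I J : Network} {ρ : ℕ → ℕ} {u x : ℕ} (h : Contracts I J ρ u)
    (hx : x < I.n) (hρ : ρ x = ρ I.s) : x = I.s ∨ x = u := by
  obtain ⟨E, hE⟩ := h.factor (fun x => decide (x = I.s ∨ x = u)) (by simp)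
  have h1 := hE x hx
  rw [hρ, hE _ I.s.2] at h1
  simpa using h1.symm

/-- Two contractions force one node to the side of `s` and another one to the side of `t`. -/
theorem Contracts.isLeast {I J K : Network} {ρ ρ' : ℕ → ℕ} {a b : ℕ} (h : Contracts I J ρ a)
    (h' : Contracts J K ρ' (ρ b)) (hb : b < I.n) {E : ℕ → Bool} (hE : K.IsCut E)
    (hmin : ∀ E', K.IsCut E' → K.cutCap E ≤ K.cutCap E') :
    (I.IsCut fun x => E (ρ' (ρ x))) ∧ E (ρ' (ρ a)) = true ∧ E (ρ' (ρ b)) = false ∧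
      (I.cutCap fun x => E (ρ' (ρ x))) = K.cutCap E ∧
      ∀ D, I.IsCut D → D a = true → D b = false → K.cutCap E ≤ I.cutCap D := by
  -- Each contraction exchanges the terminals, so two of them restore the roles of source and sink,
  -- while `a` has been merged into `s` and `b` into `t`.
  have hs : (K.s : ℕ) = ρ' (ρ I.s) := by rw [h'.s_eq, h.t_eq]
  have ht : (K.t : ℕ) = ρ' (ρ I.t) := by rw [h'.t_eq, h.s_eq]
  have h1 : E (ρ' (ρ I.s)) = true := hs ▸ hE.1
  have h2 : E (ρ' (ρ I.t)) = false := ht ▸ hE.2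
  refine ⟨⟨h1, h2⟩, by rw [h.map_u, h1], by rw [h'.map_u, h.s_eq, h2], ?_, fun D hD ha hDb => ?_⟩
  · rw [h'.cut, h.cut]
  -- A cut with the prescribed sides is constant on the fibres of both contractions and descends to
  -- a cut of `K`.
  · obtain ⟨D₁, hD₁⟩ := h.factor D (by rw [ha, hD.1])
    obtain ⟨D₂, hD₂⟩ := h'.factor D₁ (by rw [h.s_eq, hD₁ b hb, hD₁ _ I.t.2, hDb, hD.2])
    have h3 : K.IsCut D₂ := by
      refine ⟨?_, ?_⟩
      · rw [hs, hD₂ _ (h.lt _ I.s.2), hD₁ _ I.s.2, hD.1]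
      · rw [ht, hD₂ _ (h.lt _ I.t.2), hD₁ _ I.t.2, hD.2]
    refine (hmin D₂ h3).trans_eq ?_
    rw [h'.cut, J.cutCap_congr hD₂, h.cut, I.cutCap_congr hD₁]

/-- Copy the input to the work layout and start with the identity map of the nodes. -/
def copyInput : Cmd :=
  .setI 4 (.var 0) ;; .setI 5 (.var 1) ;; .setI 6 (.var 2) ;; .setI 7 (.var 3) ;;
  .upto 12 (.lit 0) 1
    (.storeI 2 (.var 12) (.read 0 (.var 12)) ;; .storeI 3 (.var 12) (.read 1 (.var 12)) ;;
      .storeR 2 (.var 12) (.read 0 (.var 12))) ;;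
  .upto 12 (.lit 0) 0 (.storeI 6 (.var 12) (.var 12))

/-- Find a minimum cut with the node in variable `21` on the side of `s` and the node in variable
`22` on the side of `t`: its capacity in the real variable `0`, the side of `s` in array `12`. -/
def cutBetween : Cmd :=
  copyInput ;; .setI 8 (.var 21) ;; contract ;; .setI 8 (.read 6 (.var 22)) ;; contract ;;
  flowCut ;; .upto 12 (.lit 0) 0 (.storeI 12 (.var 12) (.read 10 (.read 6 (.var 12))))

variable {R : MaxFlowRoutine} {X : ℕ} {σ : State} {I : Network}

theorem copyInput_does (hX : 1 ≤ X) (h : Stored inputLayout I σ) (hn : I.n ≤ X) (hm : I.m ≤ X) :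
    Does R X copyInput σ fun τ => Stored workLayout I τ ∧ ∀ x < I.n, τ.iarr 6 x = x := by
  refine Does.seq (P₁ := fun τ => τ.ivar 4 = I.n)
    (Does.straight hX trivial (by simpa [Cmd.sem, IExp.eval, inputLayout] using h.n)) fun τ₁ f₁ h₁ => ?_
  have s₁ := h.frame f₁ (by decide) (by decide) (by decide)
  refine Does.seq (P₁ := fun τ => τ.ivar 5 = I.m)
    (Does.straight hX trivial (by simpa [Cmd.sem, IExp.eval, inputLayout] using s₁.m)) fun τ₂ f₂ h₂ => ?_
  have s₂ := s₁.frame f₂ (by decide) (by decide) (by decide)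
  refine Does.seq (P₁ := fun τ => τ.ivar 6 = I.s)
    (Does.straight hX trivial (by simpa [Cmd.sem, IExp.eval, inputLayout] using s₂.s)) fun τ₃ f₃ h₃ => ?_
  have s₃ := s₂.frame f₃ (by decide) (by decide) (by decide)
  refine Does.seq (P₁ := fun τ => τ.ivar 7 = I.t)
    (Does.straight hX trivial (by simpa [Cmd.sem, IExp.eval, inputLayout] using s₃.t)) fun τ₄ f₄ h₄ => ?_
  have s₄ := s₃.frame f₄ (by decide) (by decide) (by decide)
  refine Does.seq (P₁ := fun τ => ∀ i < I.m, τ.iarr 2 i = τ₄.iarr 0 i ∧ τ.iarr 3 i = τ₄.iarr 1 i ∧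
      τ.rarr 2 i = τ₄.rarr 0 i) ?_ fun τ₅ f₅ h₅ => ?_
  · refine Does.mono (Does.upto (j₀ := 0) hX (by simp [Cmd.Straight])
      (fun j τ => ∀ i < j, τ.iarr 2 i = τ₄.iarr 0 i ∧ τ.iarr 3 i = τ₄.iarr 1 i ∧
        τ.rarr 2 i = τ₄.rarr 0 i)
      rfl s₄.m (Nat.zero_le _) (by omega) (by decide) (by decide) (by decide) (by simp) ?_)
      (fun τ _ h => h.2)
    intro j τ hf hj _ hjm hinv i hi
    have a0 := hf.iarr 0 (by decide)
    have a1 := hf.iarr 1 (by decide)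
    have r0 := hf.rarr 0 (by decide)
    by_cases hij : i = j
    · subst hij; simp [Cmd.sem, IExp.eval, RExp.eval, hj, a0, a1, r0]
    · simpa [Cmd.sem, IExp.eval, RExp.eval, hj, hij] using hinv i (by omega)
  have s₅ := s₄.frame f₅ (by decide) (by decide) (by decide)
  refine Does.mono (Does.upto (j₀ := 0) hX (by simp [Cmd.Straight])
      (fun j τ => ∀ i < j, τ.iarr 6 i = i)
      rfl s₅.n (Nat.zero_le _) (by omega) (by decide) (by decide) (by decide) (by simp) ?_)
      (fun τ hf h => ⟨⟨?_, ?_, ?_, ?_, fun i => ?_, fun i => ?_, fun i => ?_⟩, h.2⟩)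
  · intro j τ hf hj _ hjm hinv i hi
    by_cases hij : i = j
    · subst hij; simp [Cmd.sem, IExp.eval, hj]
    · simpa [Cmd.sem, IExp.eval, hj, hij] using hinv i (by omega)
  · refine (hf.ivar 4 (by decide)).trans ?_
    rw [f₅.ivar 4 (by decide), f₄.ivar 4 (by decide), f₃.ivar 4 (by decide), f₂.ivar 4 (by decide),
      h₁]
  · refine (hf.ivar 5 (by decide)).trans ?_
    rw [f₅.ivar 5 (by decide), f₄.ivar 5 (by decide), f₃.ivar 5 (by decide), h₂]
  · refine (hf.ivar 6 (by decide)).trans ?_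
    rw [f₅.ivar 6 (by decide), f₄.ivar 6 (by decide), h₃]
  · refine (hf.ivar 7 (by decide)).trans ?_
    rw [f₅.ivar 7 (by decide), h₄]
  · exact (congrFun (hf.iarr 2 (by decide)) i).trans ((h₅ i i.2).1.trans (s₄.tail i))
  · exact (congrFun (hf.iarr 3 (by decide)) i).trans ((h₅ i i.2).2.1.trans (s₄.head i))
  · exact (congrFun (hf.rarr 2 (by decide)) i).trans ((h₅ i i.2).2.2.trans (s₄.cap i))

/-- The array `D` marks the side of `s` in a cut of capacity `v` that is minimum among the cuts
with `a` on the side of `s` and `b` on the side of `t`. -/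
def IsMinCutBetween (I : Network) (a b : ℕ) (v : ℝ) (D : ℕ → ℕ) : Prop :=
  (I.IsCut fun x => decide (D x ≠ 0)) ∧ D a ≠ 0 ∧ D b = 0 ∧
    (I.cutCap fun x => decide (D x ≠ 0)) = v ∧
    ∀ D', I.IsCut D' → D' a = true → D' b = false → v ≤ I.cutCap D'

/-- The two contractions turn the prescribed sides into an ordinary minimum cut problem, solved by
one call on a network that is no larger. The cases `a = s` and `b = t` are allowed; `a ≠ b`, `a ≠ t`
and `b ≠ s` keep the terminals apart. -/
theorem cutBetween_runs (hX : 1 ≤ X) (h : Stored inputLayout I σ) (hn : I.n ≤ X) (hm : I.m ≤ X)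
    (ha : σ.ivar 21 < I.n) (hb : σ.ivar 22 < I.n) (hab : σ.ivar 21 ≠ σ.ivar 22)
    (hat : σ.ivar 21 ≠ I.t) (hbs : σ.ivar 22 ≠ I.s) :
    Runs R cutBetween σ (cutBetween.rate * X) fun τ l => (∃ J, l = [J] ∧ J.n ≤ I.n ∧ J.m ≤ I.m) ∧
      IsMinCutBetween I (σ.ivar 21) (σ.ivar 22) (τ.rvar 0) (τ.iarr 12) := by
  refine Does.runs_seq (copyInput_does hX h hn hm) fun τ₁ f₁ ⟨w₁, h₁⟩ => ?_
  have s₁ := h.frame f₁ (by decide) (by decide) (by decide)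
  refine Does.runs_seq (P₁ := fun τ => τ.ivar 8 = σ.ivar 21) (Does.straight hX trivial (by
    simp [Cmd.sem, IExp.eval, f₁.ivar 21 (by decide)])) fun τ₂ f₂ h₂ => ?_
  have s₂ := s₁.frame f₂ (by decide) (by decide) (by decide)
  have w₂ := w₁.frame f₂ (by decide) (by decide) (by decide)
  have n₂ : τ₂.ivar 0 = I.n := s₂.n
  have t₂ : ∀ x < I.n, τ₂.iarr 6 x = x := fun x hx => by rw [f₂.iarr 6 (by decide), h₁ x hx]
  refine Does.runs_seq (contract_does hX w₂ (by omega) (by omega) (by omega) (h₂ ▸ ha) (h₂ ▸ hat)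
    fun x hx => by rw [t₂ x (n₂ ▸ hx)]; exact n₂ ▸ hx) fun τ₃ f₃ ⟨J, ρ, w₃, c₃, h₃⟩ => ?_
  rw [h₂] at c₃
  rw [n₂] at h₃
  have t₃ : ∀ x < I.n, τ₃.iarr 6 x = ρ x := fun x hx => by rw [h₃ x hx, t₂ x hx]
  have s₃ := s₂.frame f₃ (by decide) (by decide) (by decide)
  have v22 : τ₃.ivar 22 = σ.ivar 22 := by
    rw [f₃.ivar 22 (by decide), f₂.ivar 22 (by decide), f₁.ivar 22 (by decide)]
  refine Does.runs_seq (P₁ := fun τ => τ.ivar 8 = ρ (σ.ivar 22)) (Does.straight hX trivial (by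
    simp [Cmd.sem, IExp.eval, v22, t₃ _ hb])) fun τ₄ f₄ h₄ => ?_
  have s₄ := s₃.frame f₄ (by decide) (by decide) (by decide)
  have w₄ := w₃.frame f₄ (by decide) (by decide) (by decide)
  have n₄ : τ₄.ivar 0 = I.n := s₄.n
  have t₄ : ∀ x < I.n, τ₄.iarr 6 x = ρ x := fun x hx => by rw [f₄.iarr 6 (by decide), t₃ x hx]
  have hJn := c₃.n_le
  have hJm := c₃.m_le
  refine Does.runs_seq (contract_does hX w₄ (by omega) (by omega) (by omega) (h₄ ▸ c₃.lt _ hb) ?_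
    fun x hx => by rw [t₄ x (n₄ ▸ hx)]; exact c₃.lt x (n₄ ▸ hx)) fun τ₅ f₅ ⟨K, ρ', w₅, c₅, h₅⟩ => ?_
  -- After the first contraction the sink is the image of `s`, whose fibre contains only `s` and the
  -- node just merged. So the second node is not the sink and may be merged into the new source.
  · rw [h₄, c₃.t_eq]
    intro hρ
    rcases c₃.eq_of_map_eq hb hρ with h6 | h6
    · exact hbs h6
    · exact hab h6.symm
  rw [h₄] at c₅
  rw [n₄] at h₅
  have s₅ := s₄.frame f₅ (by decide) (by decide) (by decide)
  have hKn := c₅.n_le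
  have hKm := c₅.m_le
  refine Runs.seq_does (flowCut_runs hX w₅ (by omega) (by omega)) fun τ₆ l f₆ h₆ => ?_
  obtain ⟨rfl, hcut, hval, hmin⟩ := h₆
  have s₆ := s₅.frame f₆ (by decide) (by decide) (by decide)
  have t₆ : ∀ x < I.n, τ₆.iarr 6 x = ρ' (ρ x) := fun x hx => by
    rw [f₆.iarr 6 (by decide), h₅ x hx, t₄ x hx]
  refine Does.mono (Does.upto (j₀ := 0) hX (by simp [Cmd.Straight])
      (fun j τ => ∀ i < j, τ.iarr 12 i = τ₆.iarr 10 (ρ' (ρ i)))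
      rfl s₆.n (Nat.zero_le _) (by omega) (by decide) (by decide) (by decide) (by simp) ?_)
      (fun τ hf h => ⟨⟨K, rfl, by omega, by omega⟩, ?_⟩)
  · intro j τ hf hj _ hjm hinv i hi
    have a6 := hf.iarr 6 (by decide)
    have a10 := hf.iarr 10 (by decide)
    by_cases hij : i = j
    · subst hij; simp [Cmd.sem, IExp.eval, hj, a6, a10, t₆ _ hjm]
    · simpa [Cmd.sem, IExp.eval, hj, hij] using hinv i (by omega)
  · obtain ⟨h1, h2, h3, h4, h5⟩ := c₃.isLeast c₅ hb hcut (fun E' hE' => hval.trans_le (hmin E' hE'))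
    have hlt : ∀ x < I.n, ρ' (ρ x) < K.n := fun x hx => c₅.lt _ (c₃.lt x hx)
    have hD : ∀ x < I.n, decide (ρ' (ρ x) < K.n ∧ τ₆.iarr 10 (ρ' (ρ x)) ≠ 0) =
        decide (τ.iarr 12 x ≠ 0) := fun x hx => by
      rw [h.2 x hx]; simp [hlt x hx]
    rw [hval] at h4 h5
    have hr : τ.rvar 0 = τ₆.rvar 0 := hf.rvar 0 (by decide)
    rw [hr]
    rw [hD _ ha] at h2
    rw [hD _ hb] at h3
    refine ⟨⟨?_, ?_⟩, by simpa using h2, by simpa using h3, ?_, h5⟩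
    · exact (hD _ I.s.2).symm.trans h1.1
    · exact (hD _ I.t.2).symm.trans h1.2
    · rw [← h4]
      exact I.cutCap_congr fun x hx => (hD x hx).symm

end MaxFlowVitality

/-! ### Minimum cuts that separate two nodes. -/

namespace MaxFlowVitality

open Finset

/-- Copy the cut found by `cutBetween` to the real variable `1` and the array `13`. -/
def saveCut : Cmd :=
  .setR 1 (.var 0) ;; .upto 12 (.lit 0) 0 (.storeI 13 (.var 12) (.read 12 (.var 12)))

/-- Find a minimum cut that separates the nodes in the variables `23` and `24`. -/
def separate : Cmd :=
  .cond (.and (.not (.eqI (.var 23) (.var 3))) (.not (.eqI (.var 24) (.var 2))))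
    (.setI 21 (.var 23) ;; .setI 22 (.var 24)) (.setI 21 (.var 24) ;; .setI 22 (.var 23)) ;;
  cutBetween ;; saveCut ;;
  .cond (.and (.not (.eqI (.var 22) (.var 3))) (.not (.eqI (.var 21) (.var 2))))
    ((.setI 25 (.var 21) ;; .setI 21 (.var 22) ;; .setI 22 (.var 25)) ;; cutBetween ;;
      .cond (.ltR (.var 0) (.var 1)) saveCut .skip)
    .skip

variable {R : MaxFlowRoutine} {X : ℕ} {σ : State} {I : Network}

theorem saveCut_does (hX : 1 ≤ X) (hn : σ.ivar 0 ≤ X) :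
    Does R X saveCut σ fun τ => τ.rvar 1 = σ.rvar 0 ∧
      ∀ x < σ.ivar 0, τ.iarr 13 x = σ.iarr 12 x := by
  refine Does.seq (P₁ := fun τ => τ.rvar 1 = σ.rvar 0)
    (Does.straight hX trivial (by simp [Cmd.sem, RExp.eval])) fun τ₁ f₁ h₁ => ?_
  refine Does.mono (Does.upto (j₀ := 0) hX (by simp [Cmd.Straight])
      (fun j τ => ∀ i < j, τ.iarr 13 i = σ.iarr 12 i)
      rfl (f₁.ivar 0 (by decide)) (Nat.zero_le _) (by omega) (by decide) (by decide) (by decide)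
      (by simp) ?_)
      (fun τ hf h => ⟨(hf.rvar 1 (by decide)).trans h₁, h.2⟩)
  intro j τ hf hj _ hjm hinv i hi
  have a12 := (hf.iarr 12 (by decide)).trans (f₁.iarr 12 (by decide))
  by_cases hij : i = j
  · subst hij; simp [Cmd.sem, IExp.eval, hj, a12]
  · simpa [Cmd.sem, IExp.eval, hj, hij] using hinv i (by omega)

theorem IsMinCutBetween.congr {a b : ℕ} {v : ℝ} {D D' : ℕ → ℕ} (h : IsMinCutBetween I a b v D)
    (ha : a < I.n) (hb : b < I.n) (hD : ∀ x < I.n, D' x = D x) : IsMinCutBetween I a b v D' := by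
  obtain ⟨h1, h2, h3, h4, h5⟩ := h
  refine ⟨⟨?_, ?_⟩, by rwa [hD a ha], by rwa [hD b hb], ?_, h5⟩
  · have := h1.1; simpa [hD _ I.s.2] using this
  · have := h1.2; simpa [hD _ I.t.2] using this
  · rw [← h4]
    exact I.cutCap_congr fun x hx => by rw [hD x hx]

/-- The array `D` marks a cut of capacity `v` that is minimum among the cuts separating `a`
and `b`. -/
def IsMinCutSep (I : Network) (a b : ℕ) (v : ℝ) (D : ℕ → ℕ) : Prop :=
  (I.IsCut fun x => decide (D x ≠ 0)) ∧ decide (D a ≠ 0) ≠ decide (D b ≠ 0) ∧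
    (I.cutCap fun x => decide (D x ≠ 0)) = v ∧
    ∀ D', I.IsCut D' → D' a ≠ D' b → v ≤ I.cutCap D'

theorem IsMinCutSep.symm {a b : ℕ} {v : ℝ} {D : ℕ → ℕ} (h : IsMinCutSep I a b v D) :
    IsMinCutSep I b a v D :=
  ⟨h.1, h.2.1.symm, h.2.2.1, fun D' hD' hne => h.2.2.2 D' hD' hne.symm⟩

theorem IsMinCutBetween.isMinCutSep {a b : ℕ} {v : ℝ} {D : ℕ → ℕ} (h : IsMinCutBetween I a b v D)
    (h' : ∀ D', I.IsCut D' → D' b = true → D' a = false → v ≤ I.cutCap D') :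
    IsMinCutSep I a b v D := by
  obtain ⟨h1, h2, h3, h4, h5⟩ := h
  refine ⟨h1, by simp [h2, h3], h4, fun D' hD' hne => ?_⟩
  cases ha : D' a <;> cases hb : D' b
  · exact absurd (ha.trans hb.symm) hne
  · exact h' D' hD' hb ha
  · exact h5 D' hD' ha hb
  · exact absurd (ha.trans hb.symm) hne

/-- A separating cut has one of two orientations, so the better of the two oriented minima is the
answer; this accounts for two calls. An orientation that contradicts the position of `s` or `t` is
skipped. -/
theorem separate_runs (hX : 1 ≤ X) (h : Stored inputLayout I σ) (hn : I.n ≤ X) (hm : I.m ≤ X)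
    (hv : σ.ivar 23 < I.n) (hp : σ.ivar 24 < I.n) (hvp : σ.ivar 23 ≠ σ.ivar 24) :
    Runs R separate σ (separate.rate * X) fun τ l =>
      (l.length ≤ 2 ∧ ∀ J ∈ l, J.n ≤ I.n ∧ J.m ≤ I.m) ∧
      IsMinCutSep I (σ.ivar 23) (σ.ivar 24) (τ.rvar 1) (τ.iarr 13) := by
  have e2 : σ.ivar 2 = I.s := h.s
  have e3 : σ.ivar 3 = I.t := h.t
  have hst : (I.s : ℕ) ≠ I.t := fun h => I.s_ne_t (Fin.ext h)
  refine Does.runs_seq (P₁ := fun τ => τ.ivar 21 ≠ I.t ∧ τ.ivar 22 ≠ I.s ∧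
    ((τ.ivar 21 = σ.ivar 23 ∧ τ.ivar 22 = σ.ivar 24) ∨
      (τ.ivar 21 = σ.ivar 24 ∧ τ.ivar 22 = σ.ivar 23)))
    (Does.straight hX (by simp [Cmd.Straight]) ?_) fun τ₁ f₁ ⟨hat, hbs, hab⟩ => ?_
  -- As the two nodes are distinct and `s ≠ t`, at least one orientation is admissible, and the test
  -- picks such a one.
  · by_cases hc : BExp.Holds σ (.and (.not (.eqI (.var 23) (.var 3))) (.not (.eqI (.var 24) (.var 2))))
    · simp only [Cmd.sem, if_pos hc]
      simp only [BExp.Holds, IExp.eval] at hc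
      simp [IExp.eval]
      omega
    · simp only [Cmd.sem, if_neg hc]
      simp only [BExp.Holds, IExp.eval] at hc
      simp [IExp.eval]
      omega
  have s₁ := h.frame f₁ (by decide) (by decide) (by decide)
  obtain ⟨a, ha⟩ : ∃ a, a = τ₁.ivar 21 := ⟨_, rfl⟩
  obtain ⟨b, hb⟩ : ∃ b, b = τ₁.ivar 22 := ⟨_, rfl⟩
  have han : a < I.n := by omega
  have hbn : b < I.n := by omega
  suffices H : Runs R (cutBetween ;; saveCut ;;
      .cond (.and (.not (.eqI (.var 22) (.var 3))) (.not (.eqI (.var 21) (.var 2))))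
        ((.setI 25 (.var 21) ;; .setI 21 (.var 22) ;; .setI 22 (.var 25)) ;; cutBetween ;;
          .cond (.ltR (.var 0) (.var 1)) saveCut .skip)
        .skip) τ₁ (Cmd.rate _ * X) fun τ l => (l.length ≤ 2 ∧ ∀ J ∈ l, J.n ≤ I.n ∧ J.m ≤ I.m) ∧
      IsMinCutSep I a b (τ.rvar 1) (τ.iarr 13) by
    refine H.mono le_rfl fun τ l _ hq => ⟨hq.1, ?_⟩
    rcases hab with ⟨h1, h2⟩ | ⟨h1, h2⟩
    · rw [← h1, ← h2, ← ha, ← hb]; exact hq.2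
    · rw [← h1, ← h2, ← ha, ← hb]; exact hq.2.symm
  rw [← ha] at hat
  rw [← hb] at hbs
  refine Runs.seq_rate (cutBetween_runs hX s₁ hn hm (ha ▸ han) (hb ▸ hbn) (by omega) (ha ▸ hat)
    (hb ▸ hbs)) fun τ₂ l₂ f₂ ⟨⟨J, hl, hJn, hJm⟩, h₂⟩ => ?_
  subst hl
  rw [← ha, ← hb] at h₂
  have s₂ := s₁.frame f₂ (by decide) (by decide) (by decide)
  have n₂ : τ₂.ivar 0 = I.n := s₂.n
  refine Does.runs_seq (saveCut_does hX (by omega)) fun τ₃ f₃ ⟨h₃, h₃'⟩ => ?_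
  have s₃ := s₂.frame f₃ (by decide) (by decide) (by decide)
  rw [n₂] at h₃'
  replace h₂ := h₂.congr han hbn h₃'
  rw [← h₃] at h₂
  have e21 : τ₃.ivar 21 = a := by rw [f₃.ivar 21 (by decide), f₂.ivar 21 (by decide), ha]
  have e22 : τ₃.ivar 22 = b := by rw [f₃.ivar 22 (by decide), f₂.ivar 22 (by decide), hb]
  have e2 : τ₃.ivar 2 = I.s := s₃.s
  have e3 : τ₃.ivar 3 = I.t := s₃.t
  refine Runs.cond_rate hX (fun hc => ?_) fun hc => ?_
  · simp only [BExp.Holds, IExp.eval, e21, e22, e2, e3] at hc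
    refine Does.runs_seq (P₁ := fun τ => τ.ivar 21 = b ∧ τ.ivar 22 = a)
      (Does.straight hX (by simp [Cmd.Straight]) (by simp [Cmd.sem, IExp.eval, e21, e22]))
      fun τ₄ f₄ ⟨h₄, h₄'⟩ => ?_
    have s₄ := s₃.frame f₄ (by decide) (by decide) (by decide)
    refine Runs.seq_does (cutBetween_runs hX s₄ hn hm (by omega) (by omega) (by omega) (by omega)
      (by omega)) fun τ₅ l₅ f₅ ⟨⟨J', hl, hJn', hJm'⟩, h₅⟩ => ?_
    subst hl
    have s₅ := s₄.frame f₅ (by decide) (by decide) (by decide)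
    have n₅ : τ₅.ivar 0 = I.n := s₅.n
    rw [h₄, h₄'] at h₅
    have r1 : τ₅.rvar 1 = τ₃.rvar 1 := by rw [f₅.rvar 1 (by decide), f₄.rvar 1 (by decide)]
    have a13 : τ₅.iarr 13 = τ₃.iarr 13 := by rw [f₅.iarr 13 (by decide), f₄.iarr 13 (by decide)]
    have hcalls : ([J] ++ [J']).length ≤ 2 ∧ ∀ K ∈ [J] ++ [J'], K.n ≤ I.n ∧ K.m ≤ I.m := by
      refine ⟨by simp, fun K hK => ?_⟩
      simp only [List.cons_append, List.nil_append, List.mem_cons, List.not_mem_nil, or_false] at hK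
      rcases hK with rfl | rfl
      exacts [⟨hJn, hJm⟩, ⟨hJn', hJm'⟩]
    refine Does.cond hX (fun hlt => ?_) fun hlt => ?_
    · simp only [BExp.Holds, RExp.eval, r1] at hlt
      refine Does.mono (saveCut_does hX (by omega)) fun τ₆ f₆ ⟨h₆, h₆'⟩ => ⟨hcalls, ?_⟩
      rw [n₅] at h₆'
      replace h₅ := h₅.congr hbn han h₆'
      rw [← h₆] at h₅ hlt
      exact (h₅.isMinCutSep fun D hD h1 h2 => hlt.le.trans (h₂.2.2.2.2 D hD h1 h2)).symm
    · simp only [BExp.Holds, RExp.eval, r1, not_lt] at hlt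
      refine Does.straight hX trivial ⟨hcalls, ?_⟩
      simp only [Cmd.sem, r1, a13]
      exact h₂.isMinCutSep fun D hD h1 h2 => hlt.trans (h₅.2.2.2.2 D hD h1 h2)
  · simp only [BExp.Holds, IExp.eval, e21, e22, e2, e3] at hc
    refine Runs.mono (Does.straight (P := fun τ => τ = τ₃) hX trivial rfl) le_rfl ?_
    rintro _ _ - ⟨rfl, rfl⟩
    refine ⟨⟨by simp, by simpa using ⟨hJn, hJm⟩⟩, h₂.isMinCutSep fun D hD h1 h2 => ?_⟩
    -- The reversed orientation would put `t` on the side of `s` or `s` on the side of `t`, so there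
    -- is no cut to compare with.
    exfalso
    rcases not_and_or.1 hc with hc | hc
    · rw [not_not.1 hc, hD.2] at h1; exact Bool.false_ne_true h1
    · rw [not_not.1 hc, hD.1] at h2; exact Bool.false_ne_true h2.symm

end MaxFlowVitality

/-! ### One round of the tree construction. -/

namespace MaxFlowVitality

open Finset

namespace Network

/-- The least capacity of a cut between `s` and `t` that separates `u` from `v`. -/
noncomputable def sepCap (I : Network) (u v : ℕ) : EReal :=
  sepVal {D | I.IsCut D} (fun D => (I.cutCap D : EReal)) u v

/-- The tree invariant for the cuts of a network. -/
abbrev IsTree (I : Network) (k : ℕ) (σ : State) : Prop :=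
  TreeInv {D | I.IsCut D} (fun D => (I.cutCap D : EReal)) I.n k (σ.iarr 14)
    (fun a => (σ.rarr 5 a : EReal))

theorem isGLB_of_sepCap_eq {I : Network} {u v : ℕ} {x : ℝ} (h : (x : EReal) = I.sepCap u v) :
    IsGLB (I.cutCap '' {D | I.IsCut D ∧ D u ≠ D v}) x := by
  constructor
  · rintro _ ⟨D, hD, rfl⟩
    have := sepVal_le (w := fun D => (I.cutCap D : EReal)) (F := {D | I.IsCut D}) hD.1 hD.2
    rw [sepCap] at h
    rw [← h] at this
    exact_mod_cast this
  · intro y hy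
    have : (y : EReal) ≤ I.sepCap u v := le_sepVal fun D hD hne => by
      exact_mod_cast hy ⟨D, ⟨hD, hne⟩, rfl⟩
    rw [← h] at this
    exact_mod_cast this

/-- A connected graph on `n` nodes has at least `n - 1` edges. This absorbs the `n * n` part of the
running time into `m * n`. -/
theorem n_le (I : Network) : I.n ≤ I.m + 1 := by
  have h1 := I.connected.card_vert_le_card_edgeSet_add_one
  have h2 : (SimpleGraph.fromEdgeSet
      (Set.range fun i => s(I.tail i, I.head i))).edgeSet ⊆ Set.range fun i => s(I.tail i, I.head i) := by
    rw [SimpleGraph.edgeSet_fromEdgeSet]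
    exact Set.sdiff_subset
  have h3 := Nat.card_mono (Set.finite_range _) h2
  have h4 : Nat.card (Set.range fun i => s(I.tail i, I.head i)) ≤ I.m := by
    simpa using Finite.card_range_le fun i => s(I.tail i, I.head i)
  simp only [Nat.card_eq_fintype_card, Fintype.card_fin] at h1 h3 h4
  omega

theorem two_le_n (I : Network) : 2 ≤ I.n := by
  have h1 := I.s.2
  have h2 := I.t.2
  have h3 : (I.s : ℕ) ≠ I.t := fun h => I.s_ne_t (Fin.ext h)
  omega

end Network

/-- Equivalence of tests. -/
def BExp.iff (p q : BExp) : BExp := .not (.and (.not (.and p q)) (.not (.and (.not p) (.not q))))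

theorem BExp.holds_iff {σ : State} {p q : BExp} : (BExp.iff p q).Holds σ ↔ (p.Holds σ ↔ q.Holds σ) := by
  simp only [BExp.iff, BExp.Holds]
  tauto

/-- Label the components of the tree on the nodes below variable `23` after deleting the arcs of
weight at most the real variable `1`. -/
def components : Cmd :=
  .upto 26 (.lit 0) 23
    (.cond (.and (.ltI (.lit 0) (.var 26)) (.ltR (.var 1) (.read 5 (.var 26))))
      (.storeI 15 (.var 26) (.read 15 (.read 14 (.var 26)))) (.storeI 15 (.var 26) (.var 26)))

/-- Attach the later nodes on the side of the node in variable `23` to it, if they are attached to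
the component of its parent. -/
def reassign : Cmd :=
  .upto 26 (.succ (.var 23)) 0
    (.cond (.and (.iff (.eqI (.read 13 (.var 26)) (.lit 0)) (.eqI (.read 13 (.var 23)) (.lit 0)))
        (.eqI (.read 15 (.read 14 (.var 26))) (.read 15 (.var 24))))
      (.storeI 14 (.var 26) (.var 23)) .skip)

/-- Make the node in variable `23` a tree node. -/
def growTree : Cmd :=
  .setI 24 (.read 14 (.var 23)) ;; separate ;; .storeR 5 (.var 23) (.var 1) ;; components ;;
  reassign ;; .setI 23 (.succ (.var 23))

variable {R : MaxFlowRoutine} {X : ℕ} {σ : State} {I : Network}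

/-- One sweep in increasing order suffices: parents have smaller numbers, so the label of the parent
is final when `a` is reached. -/
theorem components_does (hX : 1 ≤ X) {k : ℕ} (hk : σ.ivar 23 = k) (hkX : k ≤ X)
    (hpar : ∀ a < k, 0 < a → σ.iarr 14 a < a) :
    Does R X components σ fun τ => ∀ a < k, τ.iarr 15 a =
      if 0 < a ∧ σ.rvar 1 < σ.rarr 5 a then τ.iarr 15 (σ.iarr 14 a) else a := by
  refine Does.mono (Does.upto (j₀ := 0) hX (by simp [Cmd.Straight])
    (fun j τ => ∀ a < j, τ.iarr 15 a =
      if 0 < a ∧ σ.rvar 1 < σ.rarr 5 a then τ.iarr 15 (σ.iarr 14 a) else a)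
    rfl hk (Nat.zero_le _) (by omega) (by decide) (by decide) (by decide) (by simp) ?_)
    (fun τ _ h => h.2)
  intro j τ hf hj _ hjm hinv a ha
  have r1 := hf.rvar 1 (by decide)
  have r5 := hf.rarr 5 (by decide)
  have a14 := hf.iarr 14 (by decide)
  have hset : ((Cmd.cond (.and (.ltI (.lit 0) (.var 26)) (.ltR (.var 1) (.read 5 (.var 26))))
      (.storeI 15 (.var 26) (.read 15 (.read 14 (.var 26)))) (.storeI 15 (.var 26) (.var 26)) ;;
      .setI 26 (.succ (.var 26))).sem τ).iarr 15 = Function.update (τ.iarr 15) j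
        (if 0 < j ∧ σ.rvar 1 < σ.rarr 5 j then τ.iarr 15 (σ.iarr 14 j) else j) := by
    by_cases hc : 0 < j ∧ σ.rvar 1 < σ.rarr 5 j
    · simp [Cmd.sem, BExp.Holds, IExp.eval, RExp.eval, hj, r1, r5, a14, hc]
    · rw [if_neg hc]
      simp only [Cmd.sem, BExp.Holds, IExp.eval, RExp.eval, hj, r1, r5, if_neg hc]
      simp
  rw [hset]
  have hlt := hpar a (by omega)
  by_cases haj : a = j
  · subst haj
    rw [Function.update_self]
    split_ifs with hc
    · have := hlt hc.1
      rw [Function.update_of_ne (by omega)]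
    · rfl
  · rw [Function.update_of_ne haj, hinv a (by omega)]
    by_cases hc : 0 < a ∧ σ.rvar 1 < σ.rarr 5 a
    · have := hlt hc.1
      rw [if_pos hc, if_pos hc, Function.update_of_ne (by omega)]
    · rw [if_neg hc, if_neg hc]

/-- Entry `x` of array `14` is read and written only in the iteration for `x`, so each decision
depends on the original table alone. -/
theorem reassign_does (hX : 1 ≤ X) {n k : ℕ} (hn : σ.ivar 0 = n) (hnX : n ≤ X)
    (hk : σ.ivar 23 = k) (hkn : k < n) :
    Does R X reassign σ fun τ => (∀ x ≤ k, τ.iarr 14 x = σ.iarr 14 x) ∧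
      ∀ x < n, k < x → τ.iarr 14 x = if (σ.iarr 13 x = 0 ↔ σ.iarr 13 k = 0) ∧
        σ.iarr 15 (σ.iarr 14 x) = σ.iarr 15 (σ.ivar 24) then k else σ.iarr 14 x := by
  refine Does.mono (Does.upto (j₀ := k + 1) hX (by simp [Cmd.Straight])
    (fun j τ => (∀ x, x ≤ k ∨ j ≤ x → τ.iarr 14 x = σ.iarr 14 x) ∧
      ∀ x < j, k < x → τ.iarr 14 x = if (σ.iarr 13 x = 0 ↔ σ.iarr 13 k = 0) ∧
        σ.iarr 15 (σ.iarr 14 x) = σ.iarr 15 (σ.ivar 24) then k else σ.iarr 14 x)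
    (by simp [IExp.eval, hk]) hn (by omega) (by omega) (by decide) (by decide) (by decide)
    ⟨by simp, fun x _ _ => by omega⟩ ?_) (fun τ _ h => ⟨fun x hx => h.2.1 x (Or.inl hx), h.2.2⟩)
  intro j τ hf hj hj0 hjm ⟨hinv, hinv'⟩
  have a13 := hf.iarr 13 (by decide)
  have a15 := hf.iarr 15 (by decide)
  have v24 := hf.ivar 24 (by decide)
  have v23 := hf.ivar 23 (by decide)
  have hj14 := hinv j (Or.inr le_rfl)
  have hset : ((Cmd.cond (.and (.iff (.eqI (.read 13 (.var 26)) (.lit 0))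
        (.eqI (.read 13 (.var 23)) (.lit 0)))
        (.eqI (.read 15 (.read 14 (.var 26))) (.read 15 (.var 24))))
      (.storeI 14 (.var 26) (.var 23)) .skip ;;
      .setI 26 (.succ (.var 26))).sem τ).iarr 14 = Function.update (τ.iarr 14) j
        (if (σ.iarr 13 j = 0 ↔ σ.iarr 13 k = 0) ∧
        σ.iarr 15 (σ.iarr 14 j) = σ.iarr 15 (σ.ivar 24) then k else σ.iarr 14 j) := by
    have hb : BExp.Holds τ (.and (.iff (.eqI (.read 13 (.var 26)) (.lit 0))
        (.eqI (.read 13 (.var 23)) (.lit 0)))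
        (.eqI (.read 15 (.read 14 (.var 26))) (.read 15 (.var 24)))) ↔
        (σ.iarr 13 j = 0 ↔ σ.iarr 13 k = 0) ∧
        σ.iarr 15 (σ.iarr 14 j) = σ.iarr 15 (σ.ivar 24) := by
      rw [BExp.Holds, BExp.holds_iff]
      simp only [BExp.Holds, IExp.eval, hj, a13, a15, v23, v24, hk, hj14]
    by_cases hc : (σ.iarr 13 j = 0 ↔ σ.iarr 13 k = 0) ∧
        σ.iarr 15 (σ.iarr 14 j) = σ.iarr 15 (σ.ivar 24)
    · rw [if_pos hc]
      simp only [Cmd.sem, if_pos (hb.2 hc)]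
      simp [IExp.eval, hj, v23, hk]
    · rw [if_neg hc]
      simp only [Cmd.sem, if_neg (fun h => hc (hb.1 h))]
      rw [← hj14]
      simp
  rw [hset]
  refine ⟨fun x hx => ?_, fun x hx hkx => ?_⟩
  · rw [Function.update_of_ne (by omega)]
    exact hinv x (by omega)
  · by_cases hxj : x = j
    · subst hxj; rw [Function.update_self]
    · rw [Function.update_of_ne hxj]
      exact hinv' x (by omega) hkx

theorem growTree_runs (hX : 1 ≤ X) (h : Stored inputLayout I σ) (hn : I.n ≤ X) (hm : I.m ≤ X)
    {k : ℕ} (hk : σ.ivar 23 = k) (hkn : k < I.n) (ht : I.IsTree k σ) :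
    Runs R growTree σ (growTree.rate * X) fun τ l =>
      (l.length ≤ 2 ∧ ∀ J ∈ l, J.n ≤ I.n ∧ J.m ≤ I.m) ∧ τ.ivar 23 = k + 1 ∧
      I.IsTree (k + 1) τ := by
  obtain ⟨p, hp⟩ : ∃ p, p = σ.iarr 14 k := ⟨_, rfl⟩
  have hpk : p < k := hp ▸ ht.par_lt' k hkn le_rfl
  refine Does.runs_seq (P₁ := fun τ => τ.ivar 24 = p)
    (Does.straight hX trivial (by simp [Cmd.sem, IExp.eval, hk, hp])) fun τ₁ f₁ h₁ => ?_
  have s₁ := h.frame f₁ (by decide) (by decide) (by decide)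
  have k₁ : τ₁.ivar 23 = k := (f₁.ivar 23 (by decide)).trans hk
  refine Runs.seq_does (separate_runs hX s₁ hn hm (by omega) (by omega) (by omega))
    fun τ₂ l f₂ ⟨hl, h₂⟩ => ?_
  rw [k₁, h₁] at h₂
  have s₂ := s₁.frame f₂ (by decide) (by decide) (by decide)
  have k₂ : τ₂.ivar 23 = k := (f₂.ivar 23 (by decide)).trans k₁
  obtain ⟨v, hv⟩ : ∃ v, v = τ₂.rvar 1 := ⟨_, rfl⟩
  rw [← hv] at h₂
  have r5₂ : τ₂.rarr 5 = σ.rarr 5 := (f₂.rarr 5 (by decide)).trans (f₁.rarr 5 (by decide))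
  have a14₂ : τ₂.iarr 14 = σ.iarr 14 := (f₂.iarr 14 (by decide)).trans (f₁.iarr 14 (by decide))
  refine Does.seq (P₁ := fun τ => τ.rarr 5 = Function.update (σ.rarr 5) k v)
    (Does.straight hX trivial (by simp [Cmd.sem, IExp.eval, RExp.eval, k₂, r5₂, hv]))
    fun τ₃ f₃ h₃ => ?_
  have s₃ := s₂.frame f₃ (by decide) (by decide) (by decide)
  have k₃ : τ₃.ivar 23 = k := (f₃.ivar 23 (by decide)).trans k₂
  have a14₃ : τ₃.iarr 14 = σ.iarr 14 := (f₃.iarr 14 (by decide)).trans a14₂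
  refine Does.seq (components_does hX k₃ (by omega) fun a ha h0 => by
    rw [a14₃]; exact ht.par_lt a (by omega) h0) fun τ₄ f₄ h₄ => ?_
  rw [a14₃, h₃, f₃.rvar 1 (by decide), ← hv] at h₄
  have s₄ := s₃.frame f₄ (by decide) (by decide) (by decide)
  have k₄ : τ₄.ivar 23 = k := (f₄.ivar 23 (by decide)).trans k₃
  have a14₄ : τ₄.iarr 14 = σ.iarr 14 := (f₄.iarr 14 (by decide)).trans a14₃
  have p₄ : τ₄.ivar 24 = p := by
    rw [f₄.ivar 24 (by decide), f₃.ivar 24 (by decide), f₂.ivar 24 (by decide), h₁]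
  have a13₄ : τ₄.iarr 13 = τ₂.iarr 13 := (f₄.iarr 13 (by decide)).trans (f₃.iarr 13 (by decide))
  refine Does.seq (reassign_does hX s₄.n hn k₄ hkn) fun τ₅ f₅ ⟨h₅, h₅'⟩ => ?_
  have k₅ : τ₅.ivar 23 = k := (f₅.ivar 23 (by decide)).trans k₄
  have r5₅ : τ₅.rarr 5 = Function.update (σ.rarr 5) k v := by
    rw [f₅.rarr 5 (by decide), f₄.rarr 5 (by decide), h₃]
  refine Does.straight hX trivial ⟨hl, by simp [Cmd.sem, IExp.eval, k₅], ?_⟩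
  rw [a14₄] at h₅ h₅'
  rw [a13₄, p₄] at h₅'
  obtain ⟨c1, c2, c3, c4⟩ := h₂
  -- The cut that was found attains the infimum defining the separation value of `k` and its parent,
  -- as `TreeInv.step` requires.
  have hw : ((I.cutCap fun x => decide (τ₂.iarr 13 x ≠ 0) : ℝ) : EReal) =
      sepVal {D | I.IsCut D} (fun D => (I.cutCap D : EReal)) k (σ.iarr 14 k) := by
    rw [← hp]
    refine le_antisymm (le_sepVal fun D hD hne => ?_) (sepVal_le c1 c2)
    rw [c3]
    exact_mod_cast c4 D hD hne
  -- Comparing labels decides whether two tree nodes are joined above `v`. Without path queries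
  -- here, the reassignment stays linear in `n`.
  have hcomp : ∀ {a b : ℕ}, a < k → b < k → (τ₄.iarr 15 a = τ₄.iarr 15 b ↔ (v : EReal) <
      sepVal {D | I.IsCut D} (fun D => (I.cutCap D : EReal)) a b) := by
    intro a b ha hb
    refine ht.lt_sepVal_iff hkn.le (EReal.coe_lt_top v) (fun a ha => ?_) ha hb
    rw [h₄ a ha, Function.update_of_ne ha.ne]
    simp only [EReal.coe_lt_coe_iff]
  refine ht.step hkn (C := fun x => decide (τ₂.iarr 13 x ≠ 0)) c1 (hp ▸ c2) hw
    (EReal.coe_lt_top _) (fun x _ hx => h₅ x hx) (fun x hx hkx => ?_) (fun a ha => ?_) ?_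
  · change τ₅.iarr 14 x = _
    rw [h₅' x hx hkx, ← hp, c3]
    refine if_congr (and_congr ?_ (hcomp (ht.par_lt' x hx hkx.le) hpk)) rfl rfl
    rw [decide_eq_decide, not_iff_not]
  · change ((τ₅.rarr 5 a : ℝ) : EReal) = _
    rw [r5₅, Function.update_of_ne ha.ne]
  · change ((τ₅.rarr 5 k : ℝ) : EReal) = _
    rw [r5₅, Function.update_self, c3]

end MaxFlowVitality

/-! ### Path minima, vitalities and the total running time. -/

namespace MaxFlowVitality

open Finset

/-- Build the tree that represents the minimum cuts between all pairs of nodes. -/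
def buildTree : Cmd :=
  .upto 26 (.lit 0) 0 (.storeI 14 (.var 26) (.lit 0)) ;; .setI 23 (.lit 1) ;;
  .loop (.ltI (.var 23) (.var 0)) growTree

/-- Find the least weight on the tree path between the nodes in the variables `27` and `28`. -/
def pathMin : Cmd :=
  .cond (.ltI (.var 27) (.var 28)) (.setR 3 (.read 5 (.var 28))) (.setR 3 (.read 5 (.var 27))) ;;
  .loop (.not (.eqI (.var 27) (.var 28)))
    (.cond (.ltI (.var 27) (.var 28))
      (.cond (.ltR (.read 5 (.var 28)) (.var 3)) (.setR 3 (.read 5 (.var 28))) .skip ;;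
        .setI 28 (.read 14 (.var 28)))
      (.cond (.ltR (.read 5 (.var 27)) (.var 3)) (.setR 3 (.read 5 (.var 27))) .skip ;;
        .setI 27 (.read 14 (.var 27))))

/-- Store the maximum flow in the real variable `2`. -/
def findMaxFlow : Cmd :=
  (.setI 27 (.var 2) ;; .setI 28 (.var 3)) ;; pathMin ;; .setR 2 (.var 3)

/-- Store the vitality of the arc in variable `29`. -/
def arcVitality : Cmd :=
  (.setI 27 (.read 0 (.var 29)) ;; .setI 28 (.read 1 (.var 29))) ;; pathMin ;;
  (.setR 3 (.sub (.var 3) (.read 0 (.var 29))) ;;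
  .cond (.ltR (.var 3) (.var 2)) (.storeR 1 (.var 29) (.sub (.var 2) (.var 3)))
    (.storeR 1 (.var 29) .zero) ;;
  .setI 29 (.succ (.var 29)))

/-- Compute the vitalities of all arcs. -/
def vitalities : Cmd :=
  buildTree ;; findMaxFlow ;; .setI 29 (.lit 0) ;; .loop (.ltI (.var 29) (.var 1)) arcVitality

variable {R : MaxFlowRoutine} {X : ℕ} {σ : State} {I : Network}

/-- A loop with at most `8 * Y` iterations whose body stays within its rate. -/
theorem Runs.loop_rate {b : BExp} {c : Cmd} {Y : ℕ} (hX : 1 ≤ X) (hY : 1 ≤ Y)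
    {Inv : ℕ → State → List Network → Prop}
    (step : ∀ f τ l, Frame c σ τ → Inv f τ l → b.Holds τ →
      Runs R c τ (c.rate * X) (fun υ l' => ∃ f' < f, Inv f' υ (l ++ l')))
    {f : ℕ} (hf : f ≤ 8 * Y) (h₀ : Inv f σ []) :
    Runs R (.loop b c) σ ((Cmd.loop b c).rate * (X * Y))
      (fun τ l => ¬ b.Holds τ ∧ ∃ f', Inv f' τ l) := by
  have := Runs.loop (R := R) (b := b) (c := c) (σ := σ) (B := c.rate * X)
    (Inv := fun f τ l => Frame c σ τ ∧ Inv f τ l) (fun f τ l h hb =>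
      (step f τ l h.1 h.2 hb).mono le_rfl fun υ l' hfr ⟨f', hf', h'⟩ =>
        ⟨f', hf', h.1.trans hfr, h'⟩) f [] ⟨Frame.refl _ _, h₀⟩
  refine this.mono ?_ fun τ l _ ⟨hb, f', _, h⟩ => ⟨hb, f', h⟩
  simp only [Cmd.rate]
  have h1 : b.cost ≤ b.cost * X := Nat.le_mul_of_pos_right _ hX
  have h2 : b.cost * X ≤ b.cost * X * Y := Nat.le_mul_of_pos_right _ hY
  calc f * (b.cost + c.rate * X) + b.cost
      ≤ 8 * Y * (b.cost * X + c.rate * X) + b.cost * X * Y := by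
        gcongr
        exact h1.trans h2
    _ = _ := by ring

/-- The tree starts with node `0` alone, and each of the other `n - 1` nodes takes one round with at
most two calls. -/
theorem buildTree_runs (h : Stored inputLayout I σ) (hn : I.n ≤ X) (hm : I.m ≤ X) :
    Runs R buildTree σ (buildTree.rate * (X * I.n)) fun τ l =>
      (l.length ≤ 2 * (I.n - 1) ∧ ∀ J ∈ l, J.n ≤ I.n ∧ J.m ≤ I.m) ∧ I.IsTree I.n τ := by
  have hn2 := I.two_le_n
  have hX : 1 ≤ X := by omega
  have hXn : X ≤ X * I.n := Nat.le_mul_of_pos_right _ (by omega)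
  have hX' : 1 ≤ X * I.n := hX.trans hXn
  refine Does.runs_seq (P₁ := fun τ => ∀ x < I.n, τ.iarr 14 x = 0) (Does.mono
    (Does.upto (j₀ := 0) hX' (by simp [Cmd.Straight]) (fun j τ => ∀ i < j, τ.iarr 14 i = 0)
      rfl h.n (Nat.zero_le _) (by omega) (by decide) (by decide) (by decide) (by simp) ?_)
    (fun τ _ h => h.2)) fun τ₁ f₁ h₁ => ?_
  · intro j τ hf hj _ hjm hinv i hi
    by_cases hij : i = j
    · subst hij; simp [Cmd.sem, IExp.eval, hj]
    · simpa [Cmd.sem, IExp.eval, hj, hij] using hinv i (by omega)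
  have s₁ := h.frame f₁ (by decide) (by decide) (by decide)
  refine Does.runs_seq (P₁ := fun τ => τ.ivar 23 = 1)
    (Does.straight hX' trivial (by simp [Cmd.sem, IExp.eval])) fun τ₂ f₂ h₂ => ?_
  have s₂ := s₁.frame f₂ (by decide) (by decide) (by decide)
  refine Runs.mono (Runs.loop_rate hX (by omega) (f := I.n - 1)
    (Inv := fun f τ l => ∃ k, f = I.n - k ∧ 1 ≤ k ∧ k ≤ I.n ∧ τ.ivar 23 = k ∧ I.IsTree k τ ∧
      l.length ≤ 2 * (k - 1) ∧ ∀ J ∈ l, J.n ≤ I.n ∧ J.m ≤ I.m) ?_ (by omega) ?_) le_rfl ?_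
  · rintro _ τ l hf ⟨k, rfl, hk1, hkn, hk, ht, hl, hl'⟩ hb
    have hs := s₂.frame hf (by decide) (by decide) (by decide)
    have hlt : k < I.n := by
      have h0 : τ.ivar 0 = I.n := hs.n
      simpa [BExp.Holds, IExp.eval, hk, h0] using hb
    refine (growTree_runs hX hs hn hm hk hlt ht).mono le_rfl fun υ l' _ ⟨⟨h3, h4⟩, h5, h6⟩ => ?_
    refine ⟨I.n - (k + 1), by omega, k + 1, rfl, by omega, hlt, h5, h6, ?_, fun J hJ => ?_⟩
    · rw [List.length_append]; omega
    · exact (List.mem_append.1 hJ).elim (hl' J) (h4 J)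
  · refine ⟨1, rfl, le_rfl, by omega, h₂, TreeInv.init fun x hx => ?_, by simp, by simp⟩
    rw [f₂.iarr 14 (by decide)]
    exact h₁ x hx
  · rintro τ l hf ⟨hb, f, k, -, hk1, hkn, hk, ht, hl, hl'⟩
    have hs := s₂.frame hf (by decide) (by decide) (by decide)
    have h0 : τ.ivar 0 = I.n := hs.n
    simp only [BExp.Holds, IExp.eval, hk, h0] at hb
    obtain rfl : k = I.n := by omega
    exact ⟨⟨hl, hl'⟩, ht⟩

/-- The larger of the two nodes is replaced by its parent and the weight passed is collected,
following `TreeInv.sep`. The sum of the two nodes decreases, and when they meet the remaining value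
is `⊤`. -/
theorem pathMin_does (ht : I.IsTree I.n σ) (hu : σ.ivar 27 < I.n) (hv : σ.ivar 28 < I.n)
    (huv : σ.ivar 27 ≠ σ.ivar 28) :
    Does R I.n pathMin σ fun τ => (τ.rvar 3 : EReal) = I.sepCap (σ.ivar 27) (σ.ivar 28) := by
  have hX : 1 ≤ I.n := by omega
  have hsep : ∀ a < I.n, ∀ b < a, I.sepCap a b = min (σ.rarr 5 a : EReal) (I.sepCap (σ.iarr 14 a) b) :=
    ht.sep
  have hcomm : ∀ a b, I.sepCap a b = I.sepCap b a := fun a b => sepVal_comm a b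
  -- Programs have no infinite constant. The running minimum starts instead with the arc above the
  -- larger node, which lies on the path and so bounds the result from above.
  refine Does.seq (P₁ := fun τ => I.sepCap (σ.ivar 27) (σ.ivar 28) ≤ (τ.rvar 3 : EReal))
    (Does.straight hX (by simp [Cmd.Straight]) ?_) fun τ₁ f₁ h₁ => ?_
  · by_cases hlt : σ.ivar 27 < σ.ivar 28
    · have := hsep _ hv _ hlt
      rw [hcomm (σ.ivar 27), this]
      simp [Cmd.sem, BExp.Holds, IExp.eval, RExp.eval, hlt]
    · have := hsep _ hu (σ.ivar 28) (by omega)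
      rw [this]
      simp [Cmd.sem, BExp.Holds, IExp.eval, RExp.eval, hlt]
  have a14 := f₁.iarr 14 (by decide)
  have r5 := f₁.rarr 5 (by decide)
  have v27 := f₁.ivar 27 (by decide)
  have v28 := f₁.ivar 28 (by decide)
  refine Does.mono (Does.loop hX (by simp [Cmd.Straight]) (fun f τ =>
    f = τ.ivar 27 + τ.ivar 28 ∧ τ.ivar 27 < I.n ∧ τ.ivar 28 < I.n ∧
    I.sepCap (σ.ivar 27) (σ.ivar 28) =
      min (τ.rvar 3 : EReal) (I.sepCap (τ.ivar 27) (τ.ivar 28)))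
    (f := σ.ivar 27 + σ.ivar 28) (by omega)
    ⟨by rw [v27, v28], by omega, by omega, by rw [v27, v28, min_eq_right h₁]⟩ ?_) ?_
  · rintro _ τ hf ⟨rfl, h27, h28, heq⟩ hb
    have b14 := (hf.iarr 14 (by decide)).trans a14
    have b5 := (hf.rarr 5 (by decide)).trans r5
    have hmin : ∀ x y : ℝ, ((if x < y then x else y : ℝ) : EReal) = min (x : EReal) (y : EReal) := by
      intro x y
      split_ifs with hxy
      · rw [min_eq_left (by exact_mod_cast hxy.le)]
      · rw [min_eq_right (by exact_mod_cast not_lt.1 hxy)]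
    simp only [BExp.Holds, IExp.eval] at hb
    rcases lt_or_gt_of_ne hb with hlt | hgt
    · have hp := ht.par_lt _ h28 (by omega)
      have hstep := hsep _ h28 _ hlt
      rw [hcomm (τ.ivar 27), hstep, ← min_assoc, min_comm (τ.rvar 3 : EReal), ← hmin,
        hcomm (σ.iarr 14 _)] at heq
      refine ⟨τ.ivar 27 + σ.iarr 14 (τ.ivar 28), by omega, ?_⟩
      by_cases hc : σ.rarr 5 (τ.ivar 28) < τ.rvar 3
      · rw [if_pos hc] at heq
        simpa [Cmd.sem, BExp.Holds, IExp.eval, RExp.eval, hlt, b14, b5, hc, h27, hp.trans h28]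
          using heq
      · rw [if_neg hc] at heq
        simpa [Cmd.sem, BExp.Holds, IExp.eval, RExp.eval, hlt, b14, b5, hc, h27, hp.trans h28]
          using heq
    · have hp := ht.par_lt _ h27 (by omega)
      have hstep := hsep _ h27 _ hgt
      rw [hstep, ← min_assoc, min_comm (τ.rvar 3 : EReal), ← hmin] at heq
      refine ⟨σ.iarr 14 (τ.ivar 27) + τ.ivar 28, by omega, ?_⟩
      by_cases hc : σ.rarr 5 (τ.ivar 27) < τ.rvar 3
      · rw [if_pos hc] at heq
        simpa [Cmd.sem, BExp.Holds, IExp.eval, RExp.eval, hgt.not_gt, b14, b5, hc, h28,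
          hp.trans h27] using heq
      · rw [if_neg hc] at heq
        simpa [Cmd.sem, BExp.Holds, IExp.eval, RExp.eval, hgt.not_gt, b14, b5, hc, h28,
          hp.trans h27] using heq
  · rintro τ - ⟨hb, f, -, -, -, heq⟩
    simp only [BExp.Holds, IExp.eval, not_not] at hb
    rw [heq, hb, Network.sepCap, sepVal_self, min_eq_left le_top]

theorem findMaxFlow_does (h : Stored inputLayout I σ) (ht : I.IsTree I.n σ) :
    Does R I.n findMaxFlow σ fun τ => (τ.rvar 2 : EReal) = I.sepCap I.s I.t := by
  have hX : 1 ≤ I.n := by have := I.two_le_n; omega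
  have h2 : σ.ivar 2 = I.s := h.s
  have h3 : σ.ivar 3 = I.t := h.t
  refine Does.seq (P₁ := fun τ => τ.ivar 27 = I.s ∧ τ.ivar 28 = I.t)
    (Does.straight hX (by simp [Cmd.Straight]) (by simp [Cmd.sem, IExp.eval, h2, h3]))
    fun τ₁ f₁ ⟨h27, h28⟩ => ?_
  have t₁ : I.IsTree I.n τ₁ := by
    rw [Network.IsTree, f₁.iarr 14 (by decide), f₁.rarr 5 (by decide)]
    exact ht
  refine Does.seq (pathMin_does t₁ (by rw [h27]; exact I.s.2) (by rw [h28]; exact I.t.2)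
    (by rw [h27, h28]; exact fun h => I.s_ne_t (Fin.ext h))) fun τ₂ f₂ h₂ => ?_
  rw [h27, h28] at h₂
  exact Does.straight hX trivial (by simpa [Cmd.sem, RExp.eval] using h₂)

/-- Every s-t cut separates `s` from `t`, so the maximum flow is itself a separation value and can
be read off the tree without a further call. -/
theorem isGLB_cutCap {F : ℝ} (h : (F : EReal) = I.sepCap I.s I.t) :
    IsGLB (I.cutCap '' {D | I.IsCut D}) F := by
  have hset : {D | I.IsCut D} = {D | I.IsCut D ∧ D I.s ≠ D I.t} := by
    ext D
    simp only [Set.mem_ofPred_eq, iff_self_and]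
    rintro hD
    simp [hD.1, hD.2]
  rw [hset]
  exact Network.isGLB_of_sepCap_eq h

theorem arcVitality_does (h : Stored inputLayout I σ) (ht : I.IsTree I.n σ)
    (hF : (σ.rvar 2 : EReal) = I.sepCap I.s I.t) (e : Fin I.m) (he : σ.ivar 29 = e) :
    Does R I.n arcVitality σ fun τ => τ.ivar 29 = e + 1 ∧
      τ.rarr 1 = Function.update (σ.rarr 1) e (I.flowVit e) := by
  have hX : 1 ≤ I.n := by have := I.two_le_n; omega
  have htail : σ.iarr 0 e = I.tail e := h.tail e
  have hhead : σ.iarr 1 e = I.head e := h.head e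
  refine Does.seq (P₁ := fun τ => τ.ivar 27 = I.tail e ∧ τ.ivar 28 = I.head e)
    (Does.straight hX (by simp [Cmd.Straight]) (by simp [Cmd.sem, IExp.eval, htail, hhead, he]))
    fun τ₁ f₁ ⟨h27, h28⟩ => ?_
  have t₁ : I.IsTree I.n τ₁ := by
    rw [Network.IsTree, f₁.iarr 14 (by decide), f₁.rarr 5 (by decide)]
    exact ht
  refine Does.seq (pathMin_does t₁ (by rw [h27]; exact (I.tail e).2)
    (by rw [h28]; exact (I.head e).2)
    (by rw [h27, h28]; exact fun h => I.loopless e (Fin.ext h))) fun τ₂ f₂ h₂ => ?_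
  rw [h27, h28] at h₂
  have hvit := I.flowVit_eq R e (isGLB_cutCap hF) (Network.isGLB_of_sepCap_eq h₂)
  have e₂ : τ₂.ivar 29 = e := by
    rw [f₂.ivar 29 (by decide), f₁.ivar 29 (by decide), he]
  have r2 : τ₂.rvar 2 = σ.rvar 2 := by
    rw [f₂.rvar 2 (by decide), f₁.rvar 2 (by decide)]
  have r1 : τ₂.rarr 1 = σ.rarr 1 := by
    rw [f₂.rarr 1 (by decide), f₁.rarr 1 (by decide)]
  have r0 : τ₂.rarr 0 e = I.cap e := by
    rw [f₂.rarr 0 (by decide), f₁.rarr 0 (by decide)]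
    exact h.cap e
  refine Does.straight hX (by simp [Cmd.Straight]) ?_
  by_cases hc : τ₂.rvar 3 - I.cap e < σ.rvar 2
  · rw [hvit, min_eq_right hc.le]
    simp [Cmd.sem, BExp.Holds, IExp.eval, RExp.eval, e₂, r2, r1, r0, hc]
  · rw [hvit, min_eq_left (not_lt.1 hc), sub_self]
    simp [Cmd.sem, BExp.Holds, IExp.eval, RExp.eval, e₂, r2, r1, r0, hc]

theorem vitalities_runs (h : Stored inputLayout I σ) (hn : I.n ≤ X) (hm : I.m ≤ X) :
    Runs R vitalities σ (vitalities.rate * (X * I.n)) fun τ l =>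
      (l.length ≤ 2 * (I.n - 1) ∧ ∀ J ∈ l, J.n ≤ I.n ∧ J.m ≤ I.m) ∧
      ∀ e : Fin I.m, τ.rarr outputArray e = I.flowVit e := by
  have hn2 := I.two_le_n
  have hX : 1 ≤ X := by omega
  have hnX : I.n ≤ X * I.n := Nat.le_mul_of_pos_left _ hX
  refine Runs.seq_rate (buildTree_runs h hn hm) fun τ₁ l f₁ ⟨hl, t₁⟩ => ?_
  have s₁ := h.frame f₁ (by decide) (by decide) (by decide)
  refine Does.runs_seq (P₁ := fun τ => (τ.rvar 2 : EReal) = I.sepCap I.s I.t)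
    (Runs.mono (findMaxFlow_does s₁ t₁) (Nat.mul_le_mul_left _ hnX) fun τ l _ h => h)
    fun τ₂ f₂ h₂ => ?_
  have s₂ := s₁.frame f₂ (by decide) (by decide) (by decide)
  have t₂ : I.IsTree I.n τ₂ := by
    rw [Network.IsTree, f₂.iarr 14 (by decide), f₂.rarr 5 (by decide)]
    exact t₁
  refine Does.runs_seq (P₁ := fun τ => τ.ivar 29 = 0)
    (Does.straight (by omega) trivial (by simp [Cmd.sem, IExp.eval])) fun τ₃ f₃ h₃ => ?_
  have s₃ := s₂.frame f₃ (by decide) (by decide) (by decide)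
  have t₃ : I.IsTree I.n τ₃ := by
    rw [Network.IsTree, f₃.iarr 14 (by decide), f₃.rarr 5 (by decide)]
    exact t₂
  have hF : (τ₃.rvar 2 : EReal) = I.sepCap I.s I.t := by rw [f₃.rvar 2 (by decide), h₂]
  -- In the loop over the arcs the factors exchange roles: the body is linear in `n`, and there are
  -- at most `X` iterations.
  rw [mul_comm X]
  refine Runs.mono (Runs.loop_rate (X := I.n) (by omega) hX (f := I.m)
    (Inv := fun f τ l' => ∃ j, f = I.m - j ∧ j ≤ I.m ∧ τ.ivar 29 = j ∧ l' = [] ∧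
      ∀ e : Fin I.m, (e : ℕ) < j → τ.rarr 1 e = I.flowVit e) ?_ (by omega) ?_) le_rfl ?_
  · rintro _ τ _ hf ⟨j, rfl, hjm, hj, rfl, hinv⟩ hb
    have hs := s₃.frame hf (by decide) (by decide) (by decide)
    have ht : I.IsTree I.n τ := by
      rw [Network.IsTree, hf.iarr 14 (by decide), hf.rarr 5 (by decide)]
      exact t₃
    have hlt : j < I.m := by
      have h1 : τ.ivar 1 = I.m := hs.m
      simpa [BExp.Holds, IExp.eval, hj, h1] using hb
    refine Runs.mono (arcVitality_does hs ht (by rw [hf.rvar 2 (by decide), hF]) ⟨j, hlt⟩ hj)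
      le_rfl fun υ l' _ ⟨hl', hj', hr⟩ => ?_
    refine ⟨I.m - (j + 1), by omega, j + 1, rfl, hlt, hj', by simp [hl'], fun e he => ?_⟩
    rw [hr]
    by_cases hej : (e : ℕ) = j
    · obtain rfl : e = ⟨j, hlt⟩ := Fin.ext hej
      exact Function.update_self ..
    · rw [Function.update_of_ne hej]
      exact hinv e (by omega)
  · exact ⟨0, rfl, Nat.zero_le _, h₃, rfl, fun e he => absurd he (Nat.not_lt_zero _)⟩
  · rintro τ _ hf ⟨hb, _, j, -, hjm, hj, rfl, hinv⟩
    have hs := s₃.frame hf (by decide) (by decide) (by decide)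
    have h1 : τ.ivar 1 = I.m := hs.m
    simp only [BExp.Holds, IExp.eval, hj, h1] at hb
    exact ⟨by simpa using hl, fun e => hinv e (by have := e.2; omega)⟩

end MaxFlowVitality

theorem mainTheorem4 :
    ∃ (P : Cmd) (K : ℕ), ∀ (R : MaxFlowRoutine) (I : Network) (σ : State),
      Stored inputLayout I σ →
      ∃ (σ' : State) (steps : ℕ) (calls : List Network),
        Exec R P σ σ' steps calls ∧
        (∀ e : Fin I.m, σ'.rarr outputArray e = I.flowVit e) ∧
        calls.length ≤ 2 * (I.n - 1) ∧
        (∀ J ∈ calls, J.n ≤ I.n ∧ J.m ≤ I.m) ∧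
        steps ≤ K * (I.m * I.n) ∧
        ∀ MF : ℕ → ℕ → ℕ, R.RunsIn MF →
          steps + (calls.map R.time).sum ≤ K * (I.n * MF I.n I.m + I.m * I.n) := by
  -- With `X = n + m`, the inequality `n + m ≤ 3 * m` gives the factor `3`; the summand `2` pays for
  -- the calls, of which there are at most `2 * n`.
  refine ⟨vitalities, vitalities.rate * 3 + 2, fun R I σ h => ?_⟩
  obtain ⟨τ, k, l, he, hk, ⟨hl, hl'⟩, hvit⟩ := vitalities_runs (R := R) (X := I.n + I.m) h
    (Nat.le_add_right _ _) (Nat.le_add_left _ _)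
  have hn := I.n_le
  have hn2 := I.two_le_n
  have hk' : k ≤ (vitalities.rate * 3 + 2) * (I.m * I.n) :=
    calc k ≤ vitalities.rate * ((I.n + I.m) * I.n) := hk
      _ ≤ vitalities.rate * (3 * I.m * I.n) := by gcongr; omega
      _ = vitalities.rate * 3 * (I.m * I.n) := by ring
      _ ≤ _ := by gcongr; omega
  refine ⟨τ, k, l, he, hvit, hl, hl', hk', fun MF hMF => ?_⟩
  have hsum : (l.map R.time).sum ≤ (vitalities.rate * 3 + 2) * (I.n * MF I.n I.m) :=
    calc (l.map R.time).sum ≤ (l.map R.time).length • MF I.n I.m := by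
          refine List.sum_le_card_nsmul _ _ fun x hx => ?_
          obtain ⟨J, hJ, rfl⟩ := List.mem_map.1 hx
          exact hMF _ _ J (hl' J hJ).1 (hl' J hJ).2
      _ = l.length * MF I.n I.m := by rw [List.length_map, smul_eq_mul]
      _ ≤ 2 * I.n * MF I.n I.m := by gcongr; omega
      _ = 2 * (I.n * MF I.n I.m) := by ring
      _ ≤ _ := by gcongr; omega
  rw [mul_add]
  omega
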